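/- **Conventions.** Let $K$ be a field and let $\mathfrak E=\bigoplus_k\mathfrak E_k$ be a graded $K$-vector space concentrated in degrees $-2,-1,0$, with a finite homogeneous basis $(\tau_\alpha)$. Let $V=\mathfrak E[1]^*$ with dual basis $(t^\alpha)$, so that $|t^\alpha|=1-|\tau_\alpha|\in\{1,2,3\}$; we write $|\beta|$ for $|t^\beta|$. **$EL_\infty$-algebras.** Let $\mathcal E(V)$ be the free (non-unital) algebra generated by $V$ with bilinear products $\oslash_i$, $i\in\mathbb N$, where $|a\oslash_i b|=|a|+|b|+i$, modulo the identities (for homogeneous $a,b,c$) $$a\oslash_i(b\oslash_i c)=(-1)^{i(|a|+1)}\big((a\oslash_i b)\oslash_i c+(-1)^{i+|a||b|}(b\oslash_i a)\oslash_i c\big),$$ $$a\oslash_i(b\oslash_j c)=(-1)^{ij+j|a|}(a\oslash_i b)\oslash_j c\quad (i<j),$$ $$a\oslash_j(b\oslash_i c)=(-1)^{i|a|+|a||b|}(b\oslash_i a)\oslash_j c+[j-i\ge 2]\,(-1)^{i(|a|+j+1)+(|a|+|b|)|c|}(c\oslash_{j-1}a)\oslash_{i+1}b$$ $$\qquad\qquad+[j-i\ge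 3]\,(-1)^{j+|a|(|b|+i)+(|a|+|b|)|c|}(c\oslash_{i+1}b)\oslash_{j-1}a\quad (i<j).$$ An (uncurved) $EL_\infty$-algebra structure on $\mathfrak E$ is a linear map $Q:\mathcal E(V)\to\mathcal E(V)$ of degree $1$ with $Q^2=0$ and $$Q(a\oslash_i b)=(-1)^i\big((Qa)\oslash_i b+(-1)^{|a|}a\oslash_i Qb\big)+(-1)^i a\oslash_{i+1}b-(-1)^{|a||b|}b\oslash_{i+1}a .$$ **Weak Lie 3-algebras.** A weak Lie 3-algebra structure on $\mathfrak E$ consists of multilinear operations $\varepsilon_1$ (unary, degree $1$), $\varepsilon_2,\ \mathsf{alt},\ \mathsf{alt}_2$ (binary, degrees $0,-1,-2$), $\mathsf J,\ \mathsf J^{L},\ \mathsf J^{R}$ (ternary, degrees $-1,-2,-2$) and $\mathsf J_4$ (4-ary, degree $-2$) on $\mathfrak E$ that satisfy the following. Write $[x,y]=\varepsilon_2(x,y)$ and $(\partial f)(x_1,\dots,x_n)=\varepsilon_1(f(x_1,\dots,x_n))-(-1)^{|f|}\sum_k(-1)^{|x_1|+\dots+|x_{k-1}|}f(x_1,\dots,\varepsilon_1x_k,\dots,x_n)$.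 For all homogeneous $x,y,z,u$: 1. $\varepsilon_1^2=0$ and $\partial\varepsilon_2=0$; 2. $\partial\mathsf{alt}(x,y)=[x,y]+(-1)^{|x||y|}[y,x]$; 3. $\partial\mathsf{alt}_2(x,y)=\mathsf{alt}(x,y)-(-1)^{|x||y|}\mathsf{alt}(y,x)$; 4. $\partial\mathsf J(x,y,z)=[[x,y],z]-[x,[y,z]]+(-1)^{|x||y|}[y,[x,z]]$; 5. $\partial\mathsf J^L(x,y,z)=\mathsf J(x,y,z)+(-1)^{|x||y|}\mathsf J(y,x,z)-[\mathsf{alt}(x,y),z]$; 6. $\partial\mathsf J^R(x,y,z)=\mathsf J(x,y,z)+(-1)^{|y||z|}\mathsf J(x,z,y)-\mathsf{alt}([x,y],z)+(-1)^{|x|}[x,\mathsf{alt}(y,z)]-(-1)^{|x||y|}\mathsf{alt}(y,[x,z])$; 7. $\partial\mathsf J_4(x,y,z,u)=[\mathsf J(x,y,z),u]+(-1)^{|x|}[x,\mathsf J(y,z,u)]-(-1)^{|x||y|+|y|}[y,\mathsf J(x,z,u)]+(-1)^{(|x|+|y|+1)|z|}[z,\mathsf J(x,y,u)]-\mathsf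 J([x,y],z,u)+\mathsf J(x,[y,z],u)-(-1)^{|x||y|}\mathsf J(y,[x,z],u)-\mathsf J(x,y,[z,u])+(-1)^{|y||z|}\mathsf J(x,z,[y,u])-(-1)^{|x|(|y|+|z|)}\mathsf J(y,z,[x,u])$; and for all $x,y,z,u,v\in\mathfrak E_0$: 8. $\mathsf{alt}_2(x,y)+\mathsf{alt}_2(y,x)=0$; 9. $\mathsf J^L(x,y,z)-\mathsf J^L(y,x,z)+[\mathsf{alt}_2(x,y),z]=0$; 10. $\mathsf J^R(x,y,z)-\mathsf J^R(x,z,y)+\mathsf{alt}_2([x,y],z)+\mathsf{alt}_2(y,[x,z])-[x,\mathsf{alt}_2(y,z)]=0$; 11. $\mathsf J^R(x,y,z)+\mathsf J^R(y,x,z)+\mathsf J^R(z,x,y)-\mathsf J^L(x,y,z)-\mathsf J^L(x,z,y)-\mathsf J^L(y,z,x)=\mathsf{alt}(\mathsf{alt}(x,y),z)+\mathsf{alt}(x,\mathsf{alt}(y,z))+\mathsf{alt}(y,\mathsf{alt}(x,z))+\mathsf{alt}_2(y,[z,x])$; 12. $\mathsf J_4(x,y,z,u)+\mathsf J_4(y,x,z,u)=\mathsf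 J(\mathsf{alt}(x,y),z,u)+[\mathsf J^L(x,y,z),u]+[z,\mathsf J^L(x,y,u)]-\mathsf J^L(x,y,[z,u])$; 13. $\mathsf J_4(x,y,z,u)+\mathsf J_4(x,z,y,u)=[\mathsf J^R(x,y,z),u]+[x,\mathsf J^L(y,z,u)]-\mathsf J(x,\mathsf{alt}(y,z),u)-\mathsf J^L([x,y],z,u)-\mathsf J^L(y,[x,z],u)-\mathsf J^L(y,z,[x,u])$; 14. $\mathsf J_4(x,y,z,u)+\mathsf J_4(x,y,u,z)=\mathsf{alt}(\mathsf J(x,y,z),u)+\mathsf{alt}(z,\mathsf J(x,y,u))+\mathsf J(x,y,\mathsf{alt}(z,u))+[x,\mathsf J^R(y,z,u)]-[y,\mathsf J^R(x,z,u)]-\mathsf J^R([x,y],z,u)+\mathsf J^R(x,[y,z],u)-\mathsf J^R(y,[x,z],u)+\mathsf J^R(x,z,[y,u])-\mathsf J^R(y,z,[x,u])$; 15. $[\mathsf J_4(x,y,z,u),v]-[x,\mathsf J_4(y,z,u,v)]+[y,\mathsf J_4(x,z,u,v)]-[z,\mathsf J_4(x,y,u,v)]+[u,\mathsf J_4(x,y,z,v)]+\mathsf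 J_4([x,y],z,u,v)-\mathsf J_4(x,[y,z],u,v)+\mathsf J_4(y,[x,z],u,v)+\mathsf J_4(x,y,[z,u],v)-\mathsf J_4(x,z,[y,u],v)+\mathsf J_4(y,z,[x,u],v)-\mathsf J_4(x,y,z,[u,v])+\mathsf J_4(x,y,u,[z,v])-\mathsf J_4(x,z,u,[y,v])+\mathsf J_4(y,z,u,[x,v])$ $=\mathsf J(\mathsf J(x,y,z),u,v)+\mathsf J(x,\mathsf J(y,z,u),v)-\mathsf J(y,\mathsf J(x,z,u),v)+\mathsf J(z,\mathsf J(x,y,u),v)+\mathsf J(x,y,\mathsf J(z,u,v))-\mathsf J(x,z,\mathsf J(y,u,v))+\mathsf J(x,u,\mathsf J(y,z,v))+\mathsf J(y,z,\mathsf J(x,u,v))-\mathsf J(y,u,\mathsf J(x,z,v))+\mathsf J(z,u,\mathsf J(x,y,v))$. **Theorem.** An $EL_\infty$-algebra structure on $\mathfrak E$ is the same as a weak Lie 3-algebra structure on $\mathfrak E$: for every $EL_\infty$-algebra structure $Q$ there is exactly one weak Lie 3-algebra structure, and for every weak Lie 3-algebra structure there is exactly one $EL_\infty$-algebra structure $Q$,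 such that for all $\alpha$ $$Qt^\alpha=-\sum_{(f,\,i_1,\dots,i_{n-1})}\ \sum_{\beta_1,\dots,\beta_n}(-1)^{|f|\sum_k|\beta_k|+\sum_{j<k}|\beta_k|(|\beta_j|-1)}\,f^{\alpha}_{\beta_1\dots\beta_n}\,(\cdots(t^{\beta_1}\oslash_{i_1}t^{\beta_2})\oslash_{i_2}\cdots)\oslash_{i_{n-1}}t^{\beta_n},$$ where $(f,i_1,\dots,i_{n-1})$ runs over $(\varepsilon_1)$, $(\varepsilon_2,0)$, $(\mathsf{alt},1)$, $(\mathsf{alt}_2,2)$, $(\mathsf J,0,0)$, $(\mathsf J^L,1,0)$, $(\mathsf J^R,0,1)$, $(\mathsf J_4,0,0,0)$, $|f|$ is the degree of the $n$-ary operation $f$, and $f(\tau_{\beta_1},\dots,\tau_{\beta_n})=f^\alpha_{\beta_1\dots\beta_n}\tau_\alpha$. -/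

import Mathlib

noncomputable section

/-- The sign `(-1)^n`. -/
def ksgn (n : ℤ) : ℤ := (Int.negOnePow n : ℤ)

/-! ## Semifree `Eilh`-algebras

The generators `t^α`, `α : ι`, carry the degrees `d α`. There is one binary product `⊘ᵢ` of
degree `i` for every natural number `i`. -/

/-- Non-associative monomials in generators indexed by `ι`, with binary products `⊘ᵢ`, `i : ℕ`. -/
inductive EMon (ι : Type*) where
  | gen : ι → EMon ι
  | mul : ℕ → EMon ι → EMon ι → EMon ι

/-- The degree of a monomial: `|a ⊘ᵢ b| = |a| + |b| + i`. -/
def EMon.deg {ι : Type*} (d : ι → ℤ) : EMon ι → ℤ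
  | .gen a => d a
  | .mul i a b => a.deg d + b.deg d + i

/-- The free vector space with non-associative bilinear products `⊘ᵢ` on the generators. -/
abbrev FreeE (K ι : Type*) [Field K] := EMon ι →₀ K

/-- A monomial as an element of the free algebra. -/
def FreeE.mon (K : Type*) {ι : Type*} [Field K] (a : EMon ι) : FreeE K ι := Finsupp.single a 1

/-- The bilinear product `⊘ᵢ` on the free algebra. -/
def FreeE.mul (K : Type*) {ι : Type*} [Field K] (i : ℕ) :
    FreeE K ι →ₗ[K] FreeE K ι →ₗ[K] FreeE K ι :=
  Finsupp.linearCombination K (fun a => Finsupp.lmapDomain K K (EMon.mul i a))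

section

open EMon FreeE

/-- The quadratic identities of `Eilh`, for monomials `a`, `b`, `c` (these are homogeneous, so that
the identities for all homogeneous elements follow by linearity). -/
inductive EilhRel (K : Type*) {ι : Type*} [Field K] (d : ι → ℤ) : FreeE K ι → FreeE K ι → Prop
  | same (i : ℕ) (a b c : EMon ι) : EilhRel K d
      (mon K (mul i a (mul i b c)))
      (ksgn (i * (a.deg d + 1)) • (mon K (mul i (mul i a b) c) +
        ksgn (i + a.deg d * b.deg d) • mon K (mul i (mul i b a) c)))
  | less (i j : ℕ) (hij : i < j) (a b c : EMon ι) : EilhRel K d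
      (mon K (mul i a (mul j b c)))
      (ksgn (i * j + j * a.deg d) • mon K (mul j (mul i a b) c))
  | one (i j : ℕ) (hij : j = i + 1) (a b c : EMon ι) : EilhRel K d
      (mon K (mul j a (mul i b c)))
      (ksgn (i * a.deg d + a.deg d * b.deg d) • mon K (mul j (mul i b a) c))
  | two (i j : ℕ) (hij : j = i + 2) (a b c : EMon ι) : EilhRel K d
      (mon K (mul j a (mul i b c)))
      (ksgn (i * a.deg d + a.deg d * b.deg d) • mon K (mul j (mul i b a) c) +
        ksgn (i * (a.deg d + j + 1) + (a.deg d + b.deg d) * c.deg d) •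
          mon K (mul (i + 1) (mul (j - 1) c a) b))
  | more (i j : ℕ) (hij : i + 2 < j) (a b c : EMon ι) : EilhRel K d
      (mon K (mul j a (mul i b c)))
      (ksgn (i * a.deg d + a.deg d * b.deg d) • mon K (mul j (mul i b a) c) +
        ksgn (i * (a.deg d + j + 1) + (a.deg d + b.deg d) * c.deg d) •
          mon K (mul (i + 1) (mul (j - 1) c a) b) +
        ksgn (j + a.deg d * (b.deg d + i) + (a.deg d + b.deg d) * c.deg d) •
          mon K (mul (j - 1) (mul (i + 1) c b) a))

/-- The ideal generated by the quadratic identities: the smallest subspace that contains them and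
is stable under left and right multiplication by arbitrary elements with all products. -/
def eilhIdeal (K : Type*) {ι : Type*} [Field K] (d : ι → ℤ) : Submodule K (FreeE K ι) :=
  sInf {I | (∀ x y, EilhRel K d x y → x - y ∈ I) ∧
    ∀ (i : ℕ) (x y : FreeE K ι), x ∈ I → FreeE.mul K i x y ∈ I ∧ FreeE.mul K i y x ∈ I}

end

theorem eilhIdeal_mul_mem {K ι : Type*} [Field K] (d : ι → ℤ) (i : ℕ) (x y : FreeE K ι)
    (hx : x ∈ eilhIdeal K d) :
    FreeE.mul K i x y ∈ eilhIdeal K d ∧ FreeE.mul K i y x ∈ eilhIdeal K d := by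
  simp only [eilhIdeal, Submodule.mem_sInf] at hx ⊢
  exact ⟨fun I hI => (hI.2 i x y (hx I hI)).1, fun I hI => (hI.2 i x y (hx I hI)).2⟩

/-- The (reduced) tensor algebra `𝓔(V)`: the free `Eilh`-algebra on the graded vector space `V`
with basis `t^α`, `α : ι`, of degrees `d α`. -/
abbrev Eilh (K : Type*) {ι : Type*} [Field K] (d : ι → ℤ) := FreeE K ι ⧸ eilhIdeal K d

/-- The generator `t^α` of `𝓔(V)`. -/
def Eilh.gen (K : Type*) {ι : Type*} [Field K] (d : ι → ℤ) (α : ι) : Eilh K d :=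
  (eilhIdeal K d).mkQ (FreeE.mon K (EMon.gen α))

/-- The product `⊘ᵢ` of `𝓔(V)`. -/
def Eilh.mul {K ι : Type*} [Field K] (d : ι → ℤ) (i : ℕ) :
    Eilh K d →ₗ[K] Eilh K d →ₗ[K] Eilh K d :=
  (eilhIdeal K d).liftQ
    (LinearMap.mk₂ K
      (fun x => (eilhIdeal K d).mapQ (eilhIdeal K d) (FreeE.mul K i x)
        (fun y hy => (eilhIdeal_mul_mem d i y x hy).2))
      (fun x x' y => by
        induction y using Submodule.Quotient.induction_on with
        | H y => simp)
      (fun c x y => by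
        induction y using Submodule.Quotient.induction_on with
        | H y => simp)
      (fun x y y' => map_add _ y y')
      (fun c x y => map_smul _ c y))
    (fun x hx => by
      ext y
      simpa using (eilhIdeal_mul_mem d i x (Finsupp.single y 1) hx).1)

theorem Eilh.mul_mk {K ι : Type*} [Field K] (d : ι → ℤ) (i : ℕ) (x y : FreeE K ι) :
    Eilh.mul d i ((eilhIdeal K d).mkQ x) ((eilhIdeal K d).mkQ y) =
      (eilhIdeal K d).mkQ (FreeE.mul K i x y) := rfl

/-- The homogeneous part of degree `n` of `𝓔(V)`. -/
def Eilh.homog (K : Type*) {ι : Type*} [Field K] (d : ι → ℤ) (n : ℤ) : Submodule K (Eilh K d) :=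
  Submodule.span K {x | ∃ a : EMon ι, a.deg d = n ∧ x = (eilhIdeal K d).mkQ (FreeE.mon K a)}

/-- A nilquadratic differential on the semifree `Eilh`-algebra `𝓔(V)`: a linear map `Q` of degree
`1` which satisfies the deformed Leibniz rule and `Q² = 0`. For `V = E[1]*` this is an (uncurved)
`EL_∞`-algebra structure on the graded vector space `E`. -/
structure EilhDifferential (K : Type*) {ι : Type*} [Field K] (d : ι → ℤ) where
  Q : Eilh K d →ₗ[K] Eilh K d
  degree : ∀ (p : ℤ), ∀ x ∈ Eilh.homog K d p, Q x ∈ Eilh.homog K d (p + 1)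
  leibniz : ∀ (i : ℕ) (p q : ℤ), ∀ a ∈ Eilh.homog K d p, ∀ b ∈ Eilh.homog K d q,
    Q (Eilh.mul d i a b) =
      ksgn i • (Eilh.mul d i (Q a) b + ksgn p • Eilh.mul d i a (Q b)) +
        ksgn i • Eilh.mul d (i + 1) a b - ksgn (p * q) • Eilh.mul d (i + 1) b a
  sq : ∀ x, Q (Q x) = 0

/-! ## Weak Lie 3-algebras -/

/-- The grading `ℳ` is concentrated in the degrees `-2`, `-1` and `0`. -/
def IsThreeTerm {K E : Type*} [Field K] [AddCommGroup E] [Module K E]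
    (ℳ : ℤ → Submodule K E) : Prop :=
  ∀ k : ℤ, k ≠ -2 → k ≠ -1 → k ≠ 0 → ℳ k = ⊥

/-- A weak Lie 3-algebra: a three-term complex `E₋₂ → E₋₁ → E₀` with a bracket `br` of degree `0`,
an alternator `alt` and a higher alternator `alt₂` (the homotopies which control the antisymmetry
of `br` and the symmetry of `alt`), a Jacobiator `jac`, the homotopies `jacL` and `jacR` which
control the behaviour of `jac` under the transposition of the first two and of the last two
arguments, a four-ary homotopy `jac₄` for the coherence of the Jacobiator, and the coherence
conditions which these homotopies satisfy. By degree, `alt₂`, `jacL`, `jacR` and `jac₄` can be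
non-zero only on `E₀`, and this is where the last eight conditions live. -/
structure WeakLieThree {K E : Type*} [Field K] [AddCommGroup E] [Module K E]
    (ℳ : ℤ → Submodule K E) where
  threeTerm : IsThreeTerm ℳ
  d : E →ₗ[K] E
  br : E →ₗ[K] E →ₗ[K] E
  alt : E →ₗ[K] E →ₗ[K] E
  alt₂ : E →ₗ[K] E →ₗ[K] E
  jac : E →ₗ[K] E →ₗ[K] E →ₗ[K] E
  jacL : E →ₗ[K] E →ₗ[K] E →ₗ[K] E
  jacR : E →ₗ[K] E →ₗ[K] E →ₗ[K] E
  jac₄ : E →ₗ[K] E →ₗ[K] E →ₗ[K] E →ₗ[K] E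
  -- the degrees of the operations
  d_mem : ∀ p, ∀ x ∈ ℳ p, d x ∈ ℳ (p + 1)
  br_mem : ∀ p q, ∀ x ∈ ℳ p, ∀ y ∈ ℳ q, br x y ∈ ℳ (p + q)
  alt_mem : ∀ p q, ∀ x ∈ ℳ p, ∀ y ∈ ℳ q, alt x y ∈ ℳ (p + q - 1)
  alt₂_mem : ∀ p q, ∀ x ∈ ℳ p, ∀ y ∈ ℳ q, alt₂ x y ∈ ℳ (p + q - 2)
  jac_mem : ∀ p q r, ∀ x ∈ ℳ p, ∀ y ∈ ℳ q, ∀ z ∈ ℳ r, jac x y z ∈ ℳ (p + q + r - 1)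
  jacL_mem : ∀ p q r, ∀ x ∈ ℳ p, ∀ y ∈ ℳ q, ∀ z ∈ ℳ r, jacL x y z ∈ ℳ (p + q + r - 2)
  jacR_mem : ∀ p q r, ∀ x ∈ ℳ p, ∀ y ∈ ℳ q, ∀ z ∈ ℳ r, jacR x y z ∈ ℳ (p + q + r - 2)
  jac₄_mem : ∀ p q r s, ∀ x ∈ ℳ p, ∀ y ∈ ℳ q, ∀ z ∈ ℳ r, ∀ u ∈ ℳ s,
    jac₄ x y z u ∈ ℳ (p + q + r + s - 2)
  -- the boundaries of the operations
  d_d : ∀ x, d (d x) = 0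
  d_br : ∀ p q, ∀ x ∈ ℳ p, ∀ y ∈ ℳ q,
    d (br x y) - br (d x) y - ksgn p • br x (d y) = 0
  d_alt : ∀ p q, ∀ x ∈ ℳ p, ∀ y ∈ ℳ q,
    d (alt x y) + alt (d x) y + ksgn p • alt x (d y)
      = br x y + ksgn (p * q) • br y x
  d_alt₂ : ∀ p q, ∀ x ∈ ℳ p, ∀ y ∈ ℳ q,
    d (alt₂ x y) - alt₂ (d x) y - ksgn p • alt₂ x (d y)
      = alt x y - ksgn (p * q) • alt y x
  d_jac : ∀ p q r, ∀ x ∈ ℳ p, ∀ y ∈ ℳ q, ∀ z ∈ ℳ r,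
    d (jac x y z) + jac (d x) y z + ksgn p • jac x (d y) z + ksgn (p + q) • jac x y (d z)
      = br (br x y) z - br x (br y z) + ksgn (p * q) • br y (br x z)
  d_jacL : ∀ p q r, ∀ x ∈ ℳ p, ∀ y ∈ ℳ q, ∀ z ∈ ℳ r,
    d (jacL x y z) - jacL (d x) y z - ksgn p • jacL x (d y) z - ksgn (p + q) • jacL x y (d z)
      = jac x y z + ksgn (p * q) • jac y x z - br (alt x y) z
  d_jacR : ∀ p q r, ∀ x ∈ ℳ p, ∀ y ∈ ℳ q, ∀ z ∈ ℳ r,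
    d (jacR x y z) - jacR (d x) y z - ksgn p • jacR x (d y) z - ksgn (p + q) • jacR x y (d z)
      = jac x y z + ksgn (q * r) • jac x z y
        - alt (br x y) z + ksgn p • br x (alt y z) - ksgn (p * q) • alt y (br x z)
  d_jac₄ : ∀ p q r s, ∀ x ∈ ℳ p, ∀ y ∈ ℳ q, ∀ z ∈ ℳ r, ∀ u ∈ ℳ s,
    d (jac₄ x y z u) - jac₄ (d x) y z u - ksgn p • jac₄ x (d y) z u
        - ksgn (p + q) • jac₄ x y (d z) u - ksgn (p + q + r) • jac₄ x y z (d u)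
      = br (jac x y z) u + ksgn p • br x (jac y z u) - ksgn (p * q + q) • br y (jac x z u)
        + ksgn (p * r + q * r + r) • br z (jac x y u)
        - jac (br x y) z u + jac x (br y z) u - ksgn (p * q) • jac y (br x z) u
        - jac x y (br z u) + ksgn (q * r) • jac x z (br y u)
        - ksgn (p * q + p * r) • jac y z (br x u)
  -- the coherence conditions on `E₀`
  alt₂_skew : ∀ x ∈ ℳ 0, ∀ y ∈ ℳ 0, alt₂ x y + alt₂ y x = 0
  jacL_coh : ∀ x ∈ ℳ 0, ∀ y ∈ ℳ 0, ∀ z ∈ ℳ 0,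
    jacL x y z - jacL y x z + br (alt₂ x y) z = 0
  jacR_coh : ∀ x ∈ ℳ 0, ∀ y ∈ ℳ 0, ∀ z ∈ ℳ 0,
    jacR x y z - jacR x z y + alt₂ (br x y) z + alt₂ y (br x z) - br x (alt₂ y z) = 0
  braid_coh : ∀ x ∈ ℳ 0, ∀ y ∈ ℳ 0, ∀ z ∈ ℳ 0,
    jacR x y z + jacR y x z + jacR z x y - jacL x y z - jacL x z y - jacL y z x
      - alt (alt x y) z - alt x (alt y z) - alt y (alt x z) - alt₂ y (br z x) = 0
  jac₄_coh₁ : ∀ x ∈ ℳ 0, ∀ y ∈ ℳ 0, ∀ z ∈ ℳ 0, ∀ u ∈ ℳ 0,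
    jac₄ x y z u + jac₄ y x z u
      = jac (alt x y) z u + br (jacL x y z) u + br z (jacL x y u) - jacL x y (br z u)
  jac₄_coh₂ : ∀ x ∈ ℳ 0, ∀ y ∈ ℳ 0, ∀ z ∈ ℳ 0, ∀ u ∈ ℳ 0,
    jac₄ x y z u + jac₄ x z y u
      = br (jacR x y z) u + br x (jacL y z u) - jac x (alt y z) u
        - jacL (br x y) z u - jacL y (br x z) u - jacL y z (br x u)
  jac₄_coh₃ : ∀ x ∈ ℳ 0, ∀ y ∈ ℳ 0, ∀ z ∈ ℳ 0, ∀ u ∈ ℳ 0,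
    jac₄ x y z u + jac₄ x y u z
      = alt (jac x y z) u + alt z (jac x y u) + jac x y (alt z u)
        + br x (jacR y z u) - br y (jacR x z u)
        - jacR (br x y) z u + jacR x (br y z) u - jacR y (br x z) u
        + jacR x z (br y u) - jacR y z (br x u)
  jac₄_coh : ∀ x ∈ ℳ 0, ∀ y ∈ ℳ 0, ∀ z ∈ ℳ 0, ∀ u ∈ ℳ 0, ∀ v ∈ ℳ 0,
    br (jac₄ x y z u) v - br x (jac₄ y z u v) + br y (jac₄ x z u v) - br z (jac₄ x y u v)
      + br u (jac₄ x y z v)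
      + jac₄ (br x y) z u v - jac₄ x (br y z) u v + jac₄ y (br x z) u v
      + jac₄ x y (br z u) v - jac₄ x z (br y u) v + jac₄ y z (br x u) v
      - jac₄ x y z (br u v) + jac₄ x y u (br z v) - jac₄ x z u (br y v) + jac₄ y z u (br x v)
      = jac (jac x y z) u v + jac x (jac y z u) v - jac y (jac x z u) v + jac z (jac x y u) v
        + jac x y (jac z u v) - jac x z (jac y u v) + jac x u (jac y z v)
        + jac y z (jac x u v) - jac y u (jac x z v) + jac z u (jac x y v)

/-! ## The correspondence -/

/-- The value of the Chevalley–Eilenberg differential on the generator `t^α` that is dual to the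
operations of a weak Lie 3-algebra. Here `τ` is a homogeneous basis of `E`, the degree of `t^β` is
`e β` (for `V = E[1]*` this is one minus the degree of `τ β`), and the coefficients are the structure
constants of the operations with respect to `τ`. -/
def WeakLieThree.ceGen {K E ι : Type*} [Field K] [AddCommGroup E] [Module K E] [Fintype ι]
    {ℳ : ℤ → Submodule K E} (W : WeakLieThree ℳ) (τ : Module.Basis ι K E) (e : ι → ℤ) (α : ι) :
    Eilh K e :=
  let t := Eilh.gen K e
  let m₂ := fun (i : ℕ) (β γ : ι) => Eilh.mul e i (t β) (t γ)
  let m₃ := fun (i j : ℕ) (β γ δ : ι) => Eilh.mul e j (m₂ i β γ) (t δ)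
  let m₄ := fun (i j k : ℕ) (β γ δ ζ : ι) => Eilh.mul e k (m₃ i j β γ δ) (t ζ)
  let s₂ := fun β γ : ι => e γ * (e β - 1)
  let s₃ := fun β γ δ : ι => s₂ β γ + e δ * (e β + e γ - 2)
  let s₄ := fun β γ δ ζ : ι => s₃ β γ δ + e ζ * (e β + e γ + e δ - 3);
  -((∑ β, ksgn (e β) • τ.coord α (W.d (τ β)) • t β)
    + (∑ β, ∑ γ, (
      ksgn (s₂ β γ) • τ.coord α (W.br (τ β) (τ γ)) • m₂ 0 β γ
      + ksgn (e β + e γ + s₂ β γ) • τ.coord α (W.alt (τ β) (τ γ)) • m₂ 1 β γ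
      + ksgn (s₂ β γ) • τ.coord α (W.alt₂ (τ β) (τ γ)) • m₂ 2 β γ))
    + (∑ β, ∑ γ, ∑ δ, (
      ksgn (e β + e γ + e δ + s₃ β γ δ) • τ.coord α (W.jac (τ β) (τ γ) (τ δ)) • m₃ 0 0 β γ δ
      + ksgn (s₃ β γ δ) • τ.coord α (W.jacL (τ β) (τ γ) (τ δ)) • m₃ 1 0 β γ δ
      + ksgn (s₃ β γ δ) • τ.coord α (W.jacR (τ β) (τ γ) (τ δ)) • m₃ 0 1 β γ δ))
    + (∑ β, ∑ γ, ∑ δ, ∑ ζ,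
      ksgn (s₄ β γ δ ζ) • τ.coord α (W.jac₄ (τ β) (τ γ) (τ δ) (τ ζ)) • m₄ 0 0 0 β γ δ ζ))

end

/-! ### Arithmetic of the signs modulo two. -/

set_option linter.unusedSimpArgs false
set_option linter.unusedTactic false
set_option linter.unreachableTactic false
set_option linter.unusedSectionVars false

/-! A map obeying the deformed Leibniz rule is determined by its values on the generators.
Conversely, every degree-one assignment on generators extends, because the rule carries the
quadratic identities into consequences of themselves (`FourTerm.leibniz`,
`eilhIdeal_le_ker_derFree`). The square of the extension vanishes as soon as it vanishes on
generators (`IsLeibniz.sq_eq_zero`). So an `EL_∞`-structure is a choice of elements `Q t^α` of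
degree `|α| + 1` with `Q (Q t^α) = 0`.

All of this happens in low degree. Generators have degree 1, 2 or 3, hence `Q t^α` has degree at
most 4 and `Q (Q t^α)` degree at most 5. The identities rewrite every monomial into left-nested
words (`homog_eq_span_left`). Call the number of letters plus the sum of the indices the weight of a
word. As letters have degree at least 1, the degree of a word is at least its weight. There are
eight shapes of words of weight at most 4, and these carry the eight operations. There are eight
shapes of weight 5; in degree 5 all their letters have degree 1, that is, they are dual to `E₀`. The
coefficient of `Q (Q t^α)` at a word of weight at most 4 is the boundary formula of the
corresponding operation, and at a word of weight 5 it is one of the eight coherence conditions on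
`E₀`.

Comparing coefficients requires that words of weight at most 5 are linearly independent in the
quotient. For this a model is built: functions on these words, with products dual to the explicit
lists `Wd.split`. The identities preserve the number of letters and the sum of the indices, so
truncating by weight is consistent. The model satisfies them (`fourTerm_kmul`), hence the
coefficient map `Eilh.coeff` exists on the quotient, and it sends a word to its indicator function
(`coeff_word`). With the spanning statement this gives `eq_zero_of_coeff_eq_zero`.

The index `α` is removed by pairing with the basis: `fam` records the coefficients of `∑ X_α ⊗ τ_α`
as an `E`-valued function of words. In this form `Q t` becomes `ceFun` and `Q (Q t)` becomes
`sqFun`, which is evaluated at all sixteen shapes. -/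

theorem ksgn_add (m n : ℤ) : ksgn (m + n) = ksgn m * ksgn n := by
  simp [ksgn, Int.negOnePow_add]

theorem ksgn_zero : ksgn 0 = 1 := by simp [ksgn]

theorem ksgn_one : ksgn 1 = -1 := by simp [ksgn]

theorem ksgn_eq_one_or (n : ℤ) : ksgn n = 1 ∨ ksgn n = -1 := by
  rcases Int.even_or_odd n with h | h
  · left; simp [ksgn, Int.negOnePow_even n h]
  · right; simp [ksgn, Int.negOnePow_odd n h]

theorem ksgn_mul_self (n : ℤ) : ksgn n * ksgn n = 1 := by
  rcases ksgn_eq_one_or n with h | h <;> simp [h]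

theorem ksgn_even {n : ℤ} (h : Even n) : ksgn n = 1 := by simp [ksgn, Int.negOnePow_even n h]

theorem ksgn_odd {n : ℤ} (h : Odd n) : ksgn n = -1 := by simp [ksgn, Int.negOnePow_odd n h]

theorem ksgn_congr {m n : ℤ} (h : Even (m - n)) : ksgn m = ksgn n := by
  have : m = (m - n) + n := by ring
  rw [this, ksgn_add, ksgn_even h, one_mul]

theorem ksgn_neg (n : ℤ) : ksgn (-n) = ksgn n := ksgn_congr ⟨-n, by ring⟩

theorem ksgn_sub (m n : ℤ) : ksgn (m - n) = ksgn m * ksgn n := by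
  rw [sub_eq_add_neg, ksgn_add, ksgn_neg]

theorem ksgn_sq (n : ℤ) : ksgn (n * n) = ksgn n :=
  ksgn_congr (by have := Int.even_mul_pred_self n; rwa [mul_sub, mul_one] at this)

theorem ksgn_pow_even {n : ℤ} {k : ℕ} (hk : Even k) : ksgn n ^ k = 1 := by
  rcases ksgn_eq_one_or n with h | h <;> simp [h, hk.neg_one_pow]

theorem ksgn_pow_odd {n : ℤ} {k : ℕ} (hk : Odd k) : ksgn n ^ k = ksgn n := by
  rcases ksgn_eq_one_or n with h | h <;> simp [h, hk.neg_one_pow]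

theorem ksgn_mul_even {n k : ℤ} (hk : Even k) : ksgn (n * k) = 1 := ksgn_even (hk.mul_left n)

theorem ksgn_mul_odd {n k : ℤ} (hk : Odd k) : ksgn (n * k) = ksgn n :=
  ksgn_congr (by obtain ⟨m, rfl⟩ := hk; exact ⟨n * m, by ring⟩)

theorem ksgn_pow_two (n : ℤ) : ksgn (n ^ 2) = ksgn n := by rw [sq, ksgn_sq]

/-! ### Monomials and homogeneous elements of `𝓔(V)`. -/

namespace Eilh

variable {K ι : Type*} [Field K] (d : ι → ℤ)

/-- The class of a monomial. -/
noncomputable def mono (K : Type*) {ι : Type*} [Field K] (d : ι → ℤ) (a : EMon ι) : Eilh K d :=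
  (eilhIdeal K d).mkQ (FreeE.mon K a)

theorem free_mul_mon (i : ℕ) (a b : EMon ι) :
    FreeE.mul K i (FreeE.mon K a) (FreeE.mon K b) = FreeE.mon K (.mul i a b) := by
  simp [FreeE.mul, FreeE.mon, Finsupp.lmapDomain_apply, Finsupp.mapDomain_single]

theorem mono_mul (i : ℕ) (a b : EMon ι) :
    mono K d (.mul i a b) = mul d i (mono K d a) (mono K d b) := by
  rw [mono, mono, mono, mul_mk, free_mul_mon]

theorem mono_mem_homog (a : EMon ι) : mono K d a ∈ homog K d (a.deg d) :=
  Submodule.subset_span ⟨a, rfl, rfl⟩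

variable {d}

theorem mono_mem_homog_of_eq {a : EMon ι} {n : ℤ} (h : a.deg d = n) :
    mono K d a ∈ homog K d n := h ▸ mono_mem_homog d a

theorem gen_mem_homog (α : ι) : gen K d α ∈ homog K d (d α) := mono_mem_homog d (.gen α)

theorem homog_induction {n : ℤ} {P : Eilh K d → Prop} (h0 : P 0)
    (hadd : ∀ x y, P x → P y → P (x + y)) (hsmul : ∀ (c : K) x, P x → P (c • x))
    (hmono : ∀ a : EMon ι, a.deg d = n → P (mono K d a)) {x : Eilh K d} (hx : x ∈ homog K d n) :
    P x := by
  refine Submodule.span_induction ?_ h0 (fun x y _ _ => hadd x y) (fun c x _ => hsmul c x) hx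
  rintro x ⟨a, ha, rfl⟩
  exact hmono a ha

theorem mul_mem_homog (i : ℕ) {p q : ℤ} {x y : Eilh K d} (hx : x ∈ homog K d p)
    (hy : y ∈ homog K d q) : mul d i x y ∈ homog K d (p + q + i) := by
  refine homog_induction (P := fun x => mul d i x y ∈ homog K d (p + q + i)) (by simp)
    (fun x x' h h' => by simpa using add_mem h h')
    (fun c x h => by simpa using Submodule.smul_mem _ c h) (fun a ha => ?_) hx
  refine homog_induction (P := fun y => mul d i (mono K d a) y ∈ homog K d (p + q + i)) (by simp)
    (fun x x' h h' => by simpa using add_mem h h')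
    (fun c x h => by simpa using Submodule.smul_mem _ c h) (fun b hb => ?_) hy
  rw [← mono_mul]
  exact mono_mem_homog_of_eq (by simp [EMon.deg, ha, hb])

theorem zsmul_mem_homog {p : ℤ} {x : Eilh K d} (c : ℤ) (hx : x ∈ homog K d p) :
    c • x ∈ homog K d p := zsmul_mem hx c

theorem mk_eq_of_rel {x y : FreeE K ι} (h : EilhRel K d x y) :
    (eilhIdeal K d).mkQ x = (eilhIdeal K d).mkQ y := by
  rw [← sub_eq_zero, ← map_sub, Submodule.mkQ_apply, Submodule.Quotient.mk_eq_zero]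
  simp only [eilhIdeal, Submodule.mem_sInf]
  exact fun I hI => hI.1 x y h

end Eilh

/-! ### The quadratic identities as a single four-term relation. -/

/-- The coefficient of `(x ⊘ᵢ y) ⊘ⱼ z` in the normal form of `x ⊘ᵢ (y ⊘ⱼ z)`. -/
def relA (i j : ℕ) (p : ℤ) : ℤ := if i ≤ j then ksgn (i * j + j * p) else 0

/-- The coefficient of `(y ⊘ⱼ x) ⊘ᵢ z` in the normal form of `x ⊘ᵢ (y ⊘ⱼ z)`. -/
def relB (i j : ℕ) (p q : ℤ) : ℤ := if j ≤ i then ksgn (j * p + p * q) else 0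

/-- The coefficient of `(z ⊘ᵢ₋₁ x) ⊘ⱼ₊₁ y` in the normal form of `x ⊘ᵢ (y ⊘ⱼ z)`. -/
def relC (i j : ℕ) (p q r : ℤ) : ℤ :=
  if j + 2 ≤ i then ksgn (j * (p + i + 1) + (p + q) * r) else 0

/-- The coefficient of `(z ⊘ⱼ₊₁ y) ⊘ᵢ₋₁ x` in the normal form of `x ⊘ᵢ (y ⊘ⱼ z)`. -/
def relD (i j : ℕ) (p q r : ℤ) : ℤ :=
  if j + 3 ≤ i then ksgn (i + p * (q + j) + (p + q) * r) else 0

/-- The four-term relation satisfied by a family of products. -/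
theorem EilhRel.exists_form {K ι : Type*} [Field K] {d : ι → ℤ} {x y : FreeE K ι}
    (h : EilhRel K d x y) : ∃ (i j : ℕ) (a b c : EMon ι),
      x = FreeE.mon K (.mul i a (.mul j b c)) ∧
      y = relA i j (a.deg d) • FreeE.mon K (.mul j (.mul i a b) c)
        + relB i j (a.deg d) (b.deg d) • FreeE.mon K (.mul i (.mul j b a) c)
        + relC i j (a.deg d) (b.deg d) (c.deg d) •
          FreeE.mon K (.mul (j + 1) (.mul (i - 1) c a) b)
        + relD i j (a.deg d) (b.deg d) (c.deg d) •
          FreeE.mon K (.mul (i - 1) (.mul (j + 1) c b) a) := by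
  cases h with
  | same i a b c =>
    refine ⟨i, i, a, b, c, rfl, ?_⟩
    simp only [relA, relB, relC, relD, le_refl, if_true, smul_add, smul_smul, ← ksgn_add,
      if_neg (show ¬ i + 2 ≤ i by omega), if_neg (show ¬ i + 3 ≤ i by omega), zero_smul, add_zero]
    congr 2
    -- The two forms of the sign agree because `i * i` and `i` have the same parity.
    · rw [mul_add, mul_one, ksgn_add, ksgn_add, ksgn_sq, mul_comm]
    · refine ksgn_congr ⟨i, by ring⟩
  | less i j hij a b c =>
    refine ⟨i, j, a, b, c, rfl, ?_⟩
    simp [relA, relB, relC, relD, hij.le, show ¬ j ≤ i by omega, show ¬ j + 2 ≤ i by omega,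
      show ¬ j + 3 ≤ i by omega]
  | one i j hij a b c =>
    refine ⟨j, i, a, b, c, rfl, ?_⟩
    subst hij
    simp [relA, relB, relC, relD]
  | two i j hij a b c =>
    refine ⟨j, i, a, b, c, rfl, ?_⟩
    subst hij
    simp [relA, relB, relC, relD]
  | more i j hij a b c =>
    refine ⟨j, i, a, b, c, rfl, ?_⟩
    simp [relA, relB, relC, relD, show ¬ j ≤ i by omega, show i ≤ j by omega,
      show i + 2 ≤ j by omega, show i + 3 ≤ j by omega]

/-- The cases of the relation differ only in which of four coefficients vanish. The truncated
subtraction `i - 1` is harmless at `i = 0`, since both terms that contain it then have coefficient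
zero. -/
theorem EilhRel.of_form (K : Type*) {ι : Type*} [Field K] (d : ι → ℤ) (i j : ℕ) (a b c : EMon ι) :
    EilhRel K d (FreeE.mon K (.mul i a (.mul j b c)))
      (relA i j (a.deg d) • FreeE.mon K (.mul j (.mul i a b) c)
        + relB i j (a.deg d) (b.deg d) • FreeE.mon K (.mul i (.mul j b a) c)
        + relC i j (a.deg d) (b.deg d) (c.deg d) •
          FreeE.mon K (.mul (j + 1) (.mul (i - 1) c a) b)
        + relD i j (a.deg d) (b.deg d) (c.deg d) •
          FreeE.mon K (.mul (i - 1) (.mul (j + 1) c b) a)) := by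
  rcases lt_trichotomy i j with h | h | h
  · convert EilhRel.less (K := K) (d := d) i j h a b c using 1
    simp [relA, relB, relC, relD, h.le, show ¬ j ≤ i by omega, show ¬ j + 2 ≤ i by omega,
      show ¬ j + 3 ≤ i by omega]
  · subst h
    convert EilhRel.same (K := K) (d := d) i a b c using 1
    simp only [relA, relB, relC, relD, le_refl, if_true, smul_add, smul_smul, ← ksgn_add,
      if_neg (show ¬ i + 2 ≤ i by omega), if_neg (show ¬ i + 3 ≤ i by omega), zero_smul, add_zero]
    congr 2
    · rw [mul_add, mul_one, ksgn_add, ksgn_add, ksgn_sq, mul_comm]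
    · refine ksgn_congr ⟨-i, by ring⟩
  · rcases (show i = j + 1 ∨ i = j + 2 ∨ j + 2 < i by omega) with h' | h' | h'
    · convert EilhRel.one (K := K) (d := d) j i h' a b c using 1
      subst h'
      simp [relA, relB, relC, relD]
    · convert EilhRel.two (K := K) (d := d) j i h' a b c using 1
      subst h'
      simp [relA, relB, relC, relD]
    · convert EilhRel.more (K := K) (d := d) j i h' a b c using 1
      simp [relA, relB, relC, relD, show ¬ i ≤ j by omega, show j ≤ i by omega,
        show j + 2 ≤ i by omega, show j + 3 ≤ i by omega]

namespace Eilh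

variable {K ι : Type*} [Field K] {d : ι → ℤ}

/-- The normal form of `x ⊘ᵢ (y ⊘ⱼ z)` for homogeneous elements. -/
theorem mul_mul {i j : ℕ} {p q r : ℤ} {x y z : Eilh K d} (hx : x ∈ homog K d p)
    (hy : y ∈ homog K d q) (hz : z ∈ homog K d r) :
    mul d i x (mul d j y z) = relA i j p • mul d j (mul d i x y) z
      + relB i j p q • mul d i (mul d j y x) z
      + relC i j p q r • mul d (j + 1) (mul d (i - 1) z x) y
      + relD i j p q r • mul d (i - 1) (mul d (j + 1) z y) x := by
  refine homog_induction (P := fun x => mul d i x (mul d j y z) = relA i j p • mul d j (mul d i x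
    y) z
      + relB i j p q • mul d i (mul d j y x) z
      + relC i j p q r • mul d (j + 1) (mul d (i - 1) z x) y
      + relD i j p q r • mul d (i - 1) (mul d (j + 1) z y) x) (by simp)
    (fun x x' h h' => by simp only [map_add, LinearMap.add_apply, h, h', smul_add]; abel)
    (fun c x h => by simp only [map_smul, LinearMap.smul_apply, h, smul_add, smul_comm c])
    (fun a ha => ?_) hx
  refine homog_induction (P := fun y => mul d i (mono K d a) (mul d j y z)
      = relA i j p • mul d j (mul d i (mono K d a) y) z
      + relB i j p q • mul d i (mul d j y (mono K d a)) z
      + relC i j p q r • mul d (j + 1) (mul d (i - 1) z (mono K d a)) y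
      + relD i j p q r • mul d (i - 1) (mul d (j + 1) z y) (mono K d a)) (by simp)
    (fun x x' h h' => by simp only [map_add, LinearMap.add_apply, h, h', smul_add]; abel)
    (fun c x h => by simp only [map_smul, LinearMap.smul_apply, h, smul_add, smul_comm c])
    (fun b hb => ?_) hy
  refine homog_induction (P := fun z => mul d i (mono K d a) (mul d j (mono K d b) z)
      = relA i j p • mul d j (mul d i (mono K d a) (mono K d b)) z
      + relB i j p q • mul d i (mul d j (mono K d b) (mono K d a)) z
      + relC i j p q r • mul d (j + 1) (mul d (i - 1) z (mono K d a)) (mono K d b)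
      + relD i j p q r • mul d (i - 1) (mul d (j + 1) z (mono K d b)) (mono K d a)) (by simp)
    (fun x x' h h' => by simp only [map_add, LinearMap.add_apply, h, h', smul_add]; abel)
    (fun c x h => by simp only [map_smul, LinearMap.smul_apply, h, smul_add, smul_comm c])
    (fun c hc => ?_) hz
  subst ha hb hc
  have := mk_eq_of_rel (EilhRel.of_form K d i j a b c)
  simp only [map_add, map_zsmul] at this
  simp only [← mono_mul]
  exact this

end Eilh

/-! ### Compatibility of the deformed Leibniz rule with the four-term relation. -/

/-- The four-term relation for a triple of elements. -/
def FourTerm {A : Type*} [AddCommGroup A] (m : ℕ → A → A → A) (p q r : ℤ) (x y z : A) : Prop :=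
  ∀ i j, m i x (m j y z) = relA i j p • m j (m i x y) z
      + relB i j p q • m i (m j y x) z
      + relC i j p q r • m (j + 1) (m (i - 1) z x) y
      + relD i j p q r • m (i - 1) (m (j + 1) z y) x

theorem relA_le {i j : ℕ} (h : i ≤ j) (p : ℤ) : relA i j p = ksgn (i * j + j * p) := if_pos h
theorem relA_gt {i j : ℕ} (h : j < i) (p : ℤ) : relA i j p = 0 := if_neg (by omega)
theorem relB_ge {i j : ℕ} (h : j ≤ i) (p q : ℤ) : relB i j p q = ksgn (j * p + p * q) := if_pos h
theorem relB_lt {i j : ℕ} (h : i < j) (p q : ℤ) : relB i j p q = 0 := if_neg (by omega)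
theorem relC_ge {i j : ℕ} (h : j + 2 ≤ i) (p q r : ℤ) :
    relC i j p q r = ksgn (j * (p + i + 1) + (p + q) * r) := if_pos h
theorem relC_lt {i j : ℕ} (h : i < j + 2) (p q r : ℤ) : relC i j p q r = 0 := if_neg (by omega)
theorem relD_ge {i j : ℕ} (h : j + 3 ≤ i) (p q r : ℤ) :
    relD i j p q r = ksgn (i + p * (q + j) + (p + q) * r) := if_pos h
theorem relD_lt {i j : ℕ} (h : i < j + 3) (p q r : ℤ) : relD i j p q r = 0 := if_neg (by omega)

set_option maxHeartbeats 4000000 in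
/-- The deformed Leibniz rule is compatible with the four-term relation. -/
theorem FourTerm.leibniz {A : Type*} [AddCommGroup A] (m : ℕ → A → A → A) {p q r : ℤ}
    {x y z x' y' z' : A}
    (madd : ∀ i a b c, m i (a + b) c = m i a c + m i b c)
    (addm : ∀ i a b c, m i a (b + c) = m i a b + m i a c)
    (msub : ∀ i a b c, m i (a - b) c = m i a c - m i b c)
    (subm : ∀ i a b c, m i a (b - c) = m i a b - m i a c)
    (zsm : ∀ i (n : ℤ) a b, m i (n • a) b = n • m i a b)
    (msz : ∀ i (n : ℤ) a b, m i a (n • b) = n • m i a b)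
    (h₁ : FourTerm m (p + 1) q r x' y z) (h₂ : FourTerm m p (q + 1) r x y' z)
    (h₃ : FourTerm m p q (r + 1) x y z') (h : FourTerm m p q r x y z) (h₄ : FourTerm m p r q x z y)
    (h₅ : FourTerm m r p q z x y) (h₆ : FourTerm m r q p z y x)
    (i j : ℕ) (Q₁ Q₂ Q₃ Q₄ Q₅ : A)
    (e₁ : Q₁ = ksgn i • (m i x' (m j y z)
          + ksgn p • m i x (ksgn j • (m j y' z + ksgn q • m j y z') + ksgn j • m (j + 1) y z
            - ksgn (q * r) • m (j + 1) z y))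
        + ksgn i • m (i + 1) x (m j y z) - ksgn (p * (q + r + j)) • m (i + 1) (m j y z) x)
    (e₂ : Q₂ = ksgn j • (m j (ksgn i • (m i x' y + ksgn p • m i x y') + ksgn i • m (i + 1) x y
            - ksgn (p * q) • m (i + 1) y x) z + ksgn (p + q + i) • m j (m i x y) z')
        + ksgn j • m (j + 1) (m i x y) z - ksgn ((p + q + i) * r) • m (j + 1) z (m i x y))
    (e₃ : Q₃ = ksgn i • (m i (ksgn j • (m j y' x + ksgn q • m j y x') + ksgn j • m (j + 1) y x
            - ksgn (q * p) • m (j + 1) x y) z + ksgn (q + p + j) • m i (m j y x) z')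
        + ksgn i • m (i + 1) (m j y x) z - ksgn ((q + p + j) * r) • m (i + 1) z (m j y x))
    (e₄ : Q₄ = ksgn (j + 1 : ℕ) • (m (j + 1) (ksgn (i - 1 : ℕ) • (m (i - 1) z' x
            + ksgn r • m (i - 1) z x') + ksgn (i - 1 : ℕ) • m (i - 1 + 1) z x
            - ksgn (r * p) • m (i - 1 + 1) x z) y
            + ksgn (r + p + (i - 1 : ℕ)) • m (j + 1) (m (i - 1) z x) y')
        + ksgn (j + 1 : ℕ) • m (j + 1 + 1) (m (i - 1) z x) y
        - ksgn ((r + p + (i - 1 : ℕ)) * q) • m (j + 1 + 1) y (m (i - 1) z x))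
    (e₅ : Q₅ = ksgn (i - 1 : ℕ) • (m (i - 1) (ksgn (j + 1 : ℕ) • (m (j + 1) z' y
            + ksgn r • m (j + 1) z y') + ksgn (j + 1 : ℕ) • m (j + 1 + 1) z y
            - ksgn (r * q) • m (j + 1 + 1) y z) x
            + ksgn (r + q + (j + 1 : ℕ)) • m (i - 1) (m (j + 1) z y) x')
        + ksgn (i - 1 : ℕ) • m (i - 1 + 1) (m (j + 1) z y) x
        - ksgn ((r + q + (j + 1 : ℕ)) * p) • m (i - 1 + 1) x (m (j + 1) z y))
    (h₈ : FourTerm m q r p y z x) :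
    Q₁ = relA i j p • Q₂ + relB i j p q • Q₃ + relC i j p q r • Q₄ + relD i j p q r • Q₅ := by
  have n₁ (a : ℕ) : a + 1 - 1 = a := rfl
  -- Which coefficients vanish is decided by comparing `i` with `j`, and the deformation terms shift
  -- these indices. The eight ranges are chosen so that every coefficient met below is settled by
  -- `omega`.
  have key : (∃ k, j = i + k + 2) ∨ j = i + 1 ∨ j = i ∨ i = j + 1 ∨ i = j + 2 ∨ i = j + 3 ∨
      i = j + 4 ∨ (∃ k, i = j + k + 5) := by
    by_cases h5 : j + 5 ≤ i
    · have : ∃ k, i = j + k + 5 := ⟨i - j - 5, by omega⟩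
      tauto
    · by_cases h2 : i + 2 ≤ j
      · exact Or.inl ⟨j - i - 2, by omega⟩
      · omega
  rw [e₁, e₂, e₃, e₄, e₅]
  clear e₁ e₂ e₃ e₄ e₅
  unfold FourTerm at h h₁ h₂ h₃ h₄ h₅ h₆ h₈
  rcases key with ⟨k, rfl⟩ | rfl | rfl | rfl | rfl | rfl | rfl | ⟨k, rfl⟩
  all_goals
    simp (disch := omega) only [relA_le, relA_gt, relB_ge, relB_lt, relC_ge, relC_lt, relD_ge,
      relD_lt, zero_smul, add_zero, zero_add]
    -- All right-nested products are replaced by left-nested ones. The latter are then treated as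
    -- independent atoms, and the coefficient of each is an identity between signs that follows from
    -- parity.
    simp only [madd, addm, msub, subm, zsm, msz, smul_add, smul_sub, smul_smul,
      h₁, h₂, h₃, h, h₄, h₅, h₆, h₈]
    simp (disch := omega) only [relA_le, relA_gt, relB_ge, relB_lt, relC_ge, relC_lt, relD_ge,
      relD_lt, n₁, zero_smul, mul_zero, add_zero, zero_add,
      ← ksgn_add]
    clear h h₁ h₂ h₃ h₄ h₅ h₆ h₈ madd addm msub subm zsm msz
    match_scalars
    all_goals ring_nf
    all_goals try simp (disch := decide) only [ksgn_add, ksgn_pow_two, ksgn_even, ksgn_odd,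
      ksgn_mul_even, ksgn_mul_odd]
    all_goals try ring_nf
    all_goals try simp (disch := decide) only [ksgn_pow_even]
    all_goals try ring_nf

/-! ### Derivations of `𝓔(V)` from their values on generators. -/

namespace Eilh

variable {K ι : Type*} [Field K] {d : ι → ℤ}

/-- The extension of an assignment on generators to monomials by the deformed Leibniz rule. -/
noncomputable def derMon (d : ι → ℤ) (q : ι → Eilh K d) : EMon ι → Eilh K d
  | .gen α => q α
  | .mul i a b =>
    ksgn i • (mul d i (derMon d q a) (mono K d b)
        + ksgn (a.deg d) • mul d i (mono K d a) (derMon d q b))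
      + ksgn i • mul d (i + 1) (mono K d a) (mono K d b)
      - ksgn (a.deg d * b.deg d) • mul d (i + 1) (mono K d b) (mono K d a)

/-- The extension of an assignment on generators to the free algebra. -/
noncomputable def derFree (d : ι → ℤ) (q : ι → Eilh K d) : FreeE K ι →ₗ[K] Eilh K d :=
  Finsupp.linearCombination K (derMon d q)

theorem derFree_mon (q : ι → Eilh K d) (a : EMon ι) :
    derFree d q (FreeE.mon K a) = derMon d q a := by
  simp [derFree, FreeE.mon]

theorem derMon_mem_homog {q : ι → Eilh K d} (hq : ∀ α, q α ∈ homog K d (d α + 1)) (a : EMon ι) :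
    derMon d q a ∈ homog K d (a.deg d + 1) := by
  induction a with
  | gen α => exact hq α
  | mul i a b ha hb =>
    have ea := mono_mem_homog (K := K) d a
    have eb := mono_mem_homog (K := K) d b
    have h1 := mul_mem_homog i ha eb
    have h2 := mul_mem_homog i ea hb
    have h3 := mul_mem_homog (i + 1) ea eb
    have h4 := mul_mem_homog (i + 1) eb ea
    have e1 : a.deg d + 1 + b.deg d + i = a.deg d + b.deg d + i + 1 := by ring
    have e2 : a.deg d + (b.deg d + 1) + i = a.deg d + b.deg d + i + 1 := by ring
    have e3 : a.deg d + b.deg d + ((i + 1 : ℕ) : ℤ) = a.deg d + b.deg d + i + 1 := by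
      push_cast; ring
    have e4 : b.deg d + a.deg d + ((i + 1 : ℕ) : ℤ) = a.deg d + b.deg d + i + 1 := by
      push_cast; ring
    rw [e1] at h1; rw [e2] at h2; rw [e3] at h3; rw [e4] at h4
    exact sub_mem (add_mem (zsmul_mem_homog _ (add_mem h1 (zsmul_mem_homog _ h2)))
      (zsmul_mem_homog _ h3)) (zsmul_mem_homog _ h4)

theorem fourTerm {p q r : ℤ} {x y z : Eilh K d} (hx : x ∈ homog K d p)
    (hy : y ∈ homog K d q) (hz : z ∈ homog K d r) :
    FourTerm (fun i x y => mul d i x y) p q r x y z := fun _ _ => mul_mul hx hy hz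

/-- Terms in which one argument is differentiated need the relation for that modified triple. The
deformation terms exchange factors, and therefore need the relation for the undifferentiated
monomials in five of their six orders. -/
theorem derMon_rel {q : ι → Eilh K d} (hq : ∀ α, q α ∈ homog K d (d α + 1)) (i j : ℕ)
    (a b c : EMon ι) :
    derMon d q (.mul i a (.mul j b c)) =
      relA i j (a.deg d) • derMon d q (.mul j (.mul i a b) c)
        + relB i j (a.deg d) (b.deg d) • derMon d q (.mul i (.mul j b a) c)
        + relC i j (a.deg d) (b.deg d) (c.deg d) • derMon d q (.mul (j + 1) (.mul (i - 1) c a) b)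
        + relD i j (a.deg d) (b.deg d) (c.deg d) •
          derMon d q (.mul (i - 1) (.mul (j + 1) c b) a) := by
  have ha := mono_mem_homog (K := K) d a
  have hb := mono_mem_homog (K := K) d b
  have hc := mono_mem_homog (K := K) d c
  have ha' := derMon_mem_homog hq a
  have hb' := derMon_mem_homog hq b
  have hc' := derMon_mem_homog hq c
  refine FourTerm.leibniz (fun i x y => mul d i x y) (by simp) (by simp) (by simp) (by simp)
    (by simp) (by simp) (fourTerm ha' hb hc) (fourTerm ha hb' hc) (fourTerm ha hb hc')
    (fourTerm ha hb hc) (fourTerm ha hc hb) (fourTerm hc ha hb) (fourTerm hc hb ha)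
    i j _ _ _ _ _ ?_ ?_ ?_ ?_ ?_ (fourTerm hb hc ha) <;>
  simp only [derMon, EMon.deg, mono_mul]

/-- The homogeneous part of degree `n` of the free algebra. -/
noncomputable def freeHomog (K : Type*) {ι : Type*} [Field K] (d : ι → ℤ) (n : ℤ) :
    Submodule K (FreeE K ι) :=
  Submodule.span K {x | ∃ a : EMon ι, a.deg d = n ∧ x = FreeE.mon K a}

theorem free_induction {P : FreeE K ι → Prop} (h0 : P 0)
    (hadd : ∀ x y, P x → P y → P (x + y)) (hsmul : ∀ (c : K) x, P x → P (c • x))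
    (hmon : ∀ a : EMon ι, P (FreeE.mon K a)) (x : FreeE K ι) : P x := by
  induction x using Finsupp.induction_linear with
  | zero => exact h0
  | add x y hx hy => exact hadd x y hx hy
  | single a c =>
    have := hsmul c _ (hmon a)
    simpa [FreeE.mon] using this

theorem freeHomog_induction {n : ℤ} {P : FreeE K ι → Prop} (h0 : P 0)
    (hadd : ∀ x y, P x → P y → P (x + y)) (hsmul : ∀ (c : K) x, P x → P (c • x))
    (hmon : ∀ a : EMon ι, a.deg d = n → P (FreeE.mon K a)) {x : FreeE K ι}
    (hx : x ∈ freeHomog K d n) : P x := by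
  refine Submodule.span_induction ?_ h0 (fun x y _ _ => hadd x y) (fun c x _ => hsmul c x) hx
  rintro x ⟨a, ha, rfl⟩
  exact hmon a ha

theorem mon_mem_freeHomog {a : EMon ι} {n : ℤ} (h : a.deg d = n) :
    FreeE.mon K a ∈ freeHomog K d n := Submodule.subset_span ⟨a, h, rfl⟩

theorem free_mul_mem_freeHomog (i : ℕ) {p q : ℤ} {x y : FreeE K ι} (hx : x ∈ freeHomog K d p)
    (hy : y ∈ freeHomog K d q) : FreeE.mul K i x y ∈ freeHomog K d (p + q + i) := by
  refine freeHomog_induction (P := fun x => FreeE.mul K i x y ∈ freeHomog K d (p + q + i))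
    (by simp) (fun x x' h h' => by simpa using add_mem h h')
    (fun c x h => by simpa using Submodule.smul_mem _ c h) (fun a ha => ?_) hx
  refine freeHomog_induction (P := fun y => FreeE.mul K i (FreeE.mon K a) y ∈
      freeHomog K d (p + q + i)) (by simp) (fun x x' h h' => by simpa using add_mem h h')
    (fun c x h => by simpa using Submodule.smul_mem _ c h) (fun b hb => ?_) hy
  rw [free_mul_mon]
  exact mon_mem_freeHomog (by simp [EMon.deg, ha, hb])

theorem derFree_mul (q : ι → Eilh K d) (i : ℕ) {p r : ℤ} {x y : FreeE K ι}
    (hx : x ∈ freeHomog K d p) (hy : y ∈ freeHomog K d r) :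
    derFree d q (FreeE.mul K i x y) =
      ksgn i • (mul d i (derFree d q x) ((eilhIdeal K d).mkQ y)
          + ksgn p • mul d i ((eilhIdeal K d).mkQ x) (derFree d q y))
        + ksgn i • mul d (i + 1) ((eilhIdeal K d).mkQ x) ((eilhIdeal K d).mkQ y)
        - ksgn (p * r) • mul d (i + 1) ((eilhIdeal K d).mkQ y) ((eilhIdeal K d).mkQ x) := by
  refine freeHomog_induction (P := fun x => derFree d q (FreeE.mul K i x y) =
      ksgn i • (mul d i (derFree d q x) ((eilhIdeal K d).mkQ y)
          + ksgn p • mul d i ((eilhIdeal K d).mkQ x) (derFree d q y))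
        + ksgn i • mul d (i + 1) ((eilhIdeal K d).mkQ x) ((eilhIdeal K d).mkQ y)
        - ksgn (p * r) • mul d (i + 1) ((eilhIdeal K d).mkQ y) ((eilhIdeal K d).mkQ x))
    (by simp)
    (fun x x' h h' => by simp only [map_add, LinearMap.add_apply, h, h', smul_add]; abel)
    (fun c x h => by
      simp only [map_smul, LinearMap.smul_apply, h, smul_add, smul_sub, smul_comm c])
    (fun a ha => ?_) hx
  refine freeHomog_induction (P := fun y => derFree d q (FreeE.mul K i (FreeE.mon K a) y) =
      ksgn i • (mul d i (derFree d q (FreeE.mon K a)) ((eilhIdeal K d).mkQ y)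
          + ksgn p • mul d i ((eilhIdeal K d).mkQ (FreeE.mon K a)) (derFree d q y))
        + ksgn i • mul d (i + 1) ((eilhIdeal K d).mkQ (FreeE.mon K a)) ((eilhIdeal K d).mkQ y)
        - ksgn (p * r) •
          mul d (i + 1) ((eilhIdeal K d).mkQ y) ((eilhIdeal K d).mkQ (FreeE.mon K a)))
    (by simp)
    (fun x x' h h' => by simp only [map_add, LinearMap.add_apply, h, h', smul_add]; abel)
    (fun c x h => by
      simp only [map_smul, LinearMap.smul_apply, h, smul_add, smul_sub, smul_comm c])
    (fun b hb => ?_) hy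
  subst ha hb
  rw [free_mul_mon, derFree_mon, derFree_mon, derFree_mon, derMon]
  rfl

/-- The homogeneous elements of the ideal which an extended assignment annihilates. -/
def annihilated (d : ι → ℤ) (q : ι → Eilh K d) : Set (FreeE K ι) :=
  {x | x ∈ eilhIdeal K d ∧ derFree d q x = 0 ∧ ∃ p, x ∈ freeHomog K d p}

theorem mkQ_eq_zero {x : FreeE K ι} (hx : x ∈ eilhIdeal K d) : (eilhIdeal K d).mkQ x = 0 := by
  rwa [Submodule.mkQ_apply, Submodule.Quotient.mk_eq_zero]

/-- Being killed by the derivation is not stable under products by itself: the Leibniz rule also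
produces `x ⊘ᵢ Q b` and the deformation terms in `⊘ᵢ₊₁`, which vanish because `x` lies in the ideal.
Homogeneity is kept because the rule has signs that depend on degrees. -/
theorem annihilated_mul {q : ι → Eilh K d} (i : ℕ) {x : FreeE K ι} (hx : x ∈ annihilated d q)
    (b : EMon ι) : FreeE.mul K i x (FreeE.mon K b) ∈ annihilated d q ∧
      FreeE.mul K i (FreeE.mon K b) x ∈ annihilated d q := by
  obtain ⟨h1, h2, p, h3⟩ := hx
  have hb : FreeE.mon K b ∈ freeHomog K d (b.deg d) := mon_mem_freeHomog rfl
  refine ⟨⟨(eilhIdeal_mul_mem d i _ _ h1).1, ?_, _, free_mul_mem_freeHomog i h3 hb⟩,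
    ⟨(eilhIdeal_mul_mem d i _ _ h1).2, ?_, _, free_mul_mem_freeHomog i hb h3⟩⟩
  · simp [derFree_mul q i h3 hb, h2, mkQ_eq_zero h1]
  · simp [derFree_mul q i hb h3, h2, mkQ_eq_zero h1]

theorem zsmul_mem_freeHomog {p : ℤ} {x : FreeE K ι} (c : ℤ) (hx : x ∈ freeHomog K d p) :
    c • x ∈ freeHomog K d p := zsmul_mem hx c

theorem rel_mem_annihilated {q : ι → Eilh K d} (hq : ∀ α, q α ∈ homog K d (d α + 1))
    {x y : FreeE K ι} (h : EilhRel K d x y) : x - y ∈ annihilated d q := by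
  refine ⟨?_, ?_, ?_⟩
  · simp only [eilhIdeal, Submodule.mem_sInf]
    exact fun I hI => hI.1 x y h
  · obtain ⟨i, j, a, b, c, rfl, rfl⟩ := h.exists_form
    simp only [map_sub, map_add, map_zsmul, derFree_mon]
    rw [derMon_rel hq, sub_self]
  · obtain ⟨i, j, a, b, c, rfl, rfl⟩ := h.exists_form
    refine ⟨a.deg d + b.deg d + c.deg d + i + j, sub_mem (mon_mem_freeHomog ?_)
      (add_mem (add_mem (add_mem ?_ ?_) ?_) ?_)⟩
    · simp only [EMon.deg]; ring
    · exact zsmul_mem_freeHomog _ (mon_mem_freeHomog (by simp only [EMon.deg]; ring))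
    · exact zsmul_mem_freeHomog _ (mon_mem_freeHomog (by simp only [EMon.deg]; ring))
    -- If the coefficient is nonzero, then `i ≥ 1`, so `i - 1` is a genuine difference and the
    -- degrees agree; otherwise the term is zero. The last term is treated alike.
    · by_cases hij : j + 2 ≤ i
      · refine zsmul_mem_freeHomog _ (mon_mem_freeHomog ?_)
        simp only [EMon.deg]
        push_cast [Nat.cast_sub (show 1 ≤ i by omega)]; ring
      · rw [relC_lt (by omega), zero_smul]; exact zero_mem _
    · by_cases hij : j + 3 ≤ i
      · refine zsmul_mem_freeHomog _ (mon_mem_freeHomog ?_)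
        simp only [EMon.deg]
        push_cast [Nat.cast_sub (show 1 ≤ i by omega)]; ring
      · rw [relD_lt (by omega), zero_smul]; exact zero_mem _

/-- The span of `S` is one of the subspaces whose infimum is the ideal, since stability under all
products follows from stability under products with monomials. This allows `S` to consist of
homogeneous elements, for which sign rules can be stated. -/
theorem eilhIdeal_le_of_homogeneous {S : Set (FreeE K ι)}
    (hrel : ∀ x y, EilhRel K d x y → x - y ∈ S)
    (hmul : ∀ (i : ℕ) (x : FreeE K ι) (b : EMon ι), x ∈ S →
      FreeE.mul K i x (FreeE.mon K b) ∈ S ∧ FreeE.mul K i (FreeE.mon K b) x ∈ S) :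
    eilhIdeal K d ≤ Submodule.span K S := by
  refine sInf_le ⟨fun x y h => Submodule.subset_span (hrel x y h), fun i x y hx => ?_⟩
  refine Submodule.span_induction (p := fun x _ => FreeE.mul K i x y ∈ Submodule.span K S ∧
    FreeE.mul K i y x ∈ Submodule.span K S) (fun x hx => ?_) (by simp) (fun x x' _ _ h h' => ?_)
    (fun c x _ h => ?_) hx
  · refine free_induction (P := fun y => FreeE.mul K i x y ∈ Submodule.span K S ∧
      FreeE.mul K i y x ∈ Submodule.span K S) (by simp) (fun y y' h h' => ?_) (fun c y h => ?_)
      (fun b => ?_) y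
    · simpa using ⟨add_mem h.1 h'.1, add_mem h.2 h'.2⟩
    · simpa using ⟨Submodule.smul_mem _ c h.1, Submodule.smul_mem _ c h.2⟩
    · exact ⟨Submodule.subset_span (hmul i x b hx).1, Submodule.subset_span (hmul i x b hx).2⟩
  · simpa using ⟨add_mem h.1 h'.1, add_mem h.2 h'.2⟩
  · simpa using ⟨Submodule.smul_mem _ c h.1, Submodule.smul_mem _ c h.2⟩

theorem eilhIdeal_le_ker_derFree {q : ι → Eilh K d} (hq : ∀ α, q α ∈ homog K d (d α + 1)) :
    eilhIdeal K d ≤ LinearMap.ker (derFree d q) := by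
  refine (eilhIdeal_le_of_homogeneous (S := annihilated d q)
    (fun x y h => rel_mem_annihilated hq h) (fun i x b hx => annihilated_mul i hx b)).trans ?_
  rw [Submodule.span_le]
  exact fun x hx => hx.2.1

/-- The derivation of `𝓔(V)` with given values of degree one on the generators. -/
noncomputable def der (q : ι → Eilh K d) (hq : ∀ α, q α ∈ homog K d (d α + 1)) :
    Eilh K d →ₗ[K] Eilh K d :=
  (eilhIdeal K d).liftQ (derFree d q) (eilhIdeal_le_ker_derFree hq)

theorem der_mono {q : ι → Eilh K d} (hq : ∀ α, q α ∈ homog K d (d α + 1)) (a : EMon ι) :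
    der q hq (mono K d a) = derMon d q a := derFree_mon q a

theorem der_gen {q : ι → Eilh K d} (hq : ∀ α, q α ∈ homog K d (d α + 1)) (α : ι) :
    der q hq (gen K d α) = q α := der_mono hq (.gen α)

theorem der_mem_homog {q : ι → Eilh K d} (hq : ∀ α, q α ∈ homog K d (d α + 1)) (p : ℤ)
    (x : Eilh K d) (hx : x ∈ homog K d p) : der q hq x ∈ homog K d (p + 1) := by
  refine homog_induction (P := fun x => der q hq x ∈ homog K d (p + 1)) (by simp)
    (fun x y h h' => by simpa using add_mem h h')
    (fun c x h => by simpa using Submodule.smul_mem _ c h) (fun a ha => ?_) hx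
  rw [der_mono, ← ha]
  exact derMon_mem_homog hq a

/-- The deformed Leibniz rule for a linear map. -/
def IsLeibniz (Q : Eilh K d →ₗ[K] Eilh K d) : Prop :=
  ∀ (i : ℕ) (p q : ℤ), ∀ a ∈ homog K d p, ∀ b ∈ homog K d q,
    Q (mul d i a b) =
      ksgn i • (mul d i (Q a) b + ksgn p • mul d i a (Q b)) +
        ksgn i • mul d (i + 1) a b - ksgn (p * q) • mul d (i + 1) b a

theorem IsLeibniz.of_mono {Q : Eilh K d →ₗ[K] Eilh K d}
    (h : ∀ (i : ℕ) (a b : EMon ι), Q (mul d i (mono K d a) (mono K d b)) =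
      ksgn i • (mul d i (Q (mono K d a)) (mono K d b)
          + ksgn (a.deg d) • mul d i (mono K d a) (Q (mono K d b)))
        + ksgn i • mul d (i + 1) (mono K d a) (mono K d b)
        - ksgn (a.deg d * b.deg d) • mul d (i + 1) (mono K d b) (mono K d a)) : IsLeibniz Q := by
  intro i p r x hx y hy
  refine homog_induction (P := fun x => Q (mul d i x y) =
      ksgn i • (mul d i (Q x) y + ksgn p • mul d i x (Q y)) +
        ksgn i • mul d (i + 1) x y - ksgn (p * r) • mul d (i + 1) y x)
    (by simp)
    (fun x x' h h' => by simp only [map_add, LinearMap.add_apply, h, h', smul_add]; abel)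
    (fun c x h => by
      simp only [map_smul, LinearMap.smul_apply, h, smul_add, smul_sub, smul_comm c])
    (fun a ha => ?_) hx
  refine homog_induction (P := fun y => Q (mul d i (mono K d a) y) =
      ksgn i • (mul d i (Q (mono K d a)) y + ksgn p • mul d i (mono K d a) (Q y)) +
        ksgn i • mul d (i + 1) (mono K d a) y - ksgn (p * r) • mul d (i + 1) y (mono K d a))
    (by simp)
    (fun x x' h h' => by simp only [map_add, LinearMap.add_apply, h, h', smul_add]; abel)
    (fun c x h => by
      simp only [map_smul, LinearMap.smul_apply, h, smul_add, smul_sub, smul_comm c])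
    (fun b hb => ?_) hy
  subst ha hb
  exact h i a b

theorem der_isLeibniz {q : ι → Eilh K d} (hq : ∀ α, q α ∈ homog K d (d α + 1)) :
    IsLeibniz (der q hq) := by
  refine IsLeibniz.of_mono fun i a b => ?_
  rw [← mono_mul, der_mono, der_mono, der_mono, derMon]

theorem ext_mono {N : Type*} [AddCommGroup N] [Module K N] {f g : Eilh K d →ₗ[K] N}
    (h : ∀ a, f (mono K d a) = g (mono K d a)) : f = g := by
  refine Submodule.linearMap_qext _ (Finsupp.lhom_ext' fun a => LinearMap.ext_ring ?_)
  exact h a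

theorem IsLeibniz.ext {Q Q' : Eilh K d →ₗ[K] Eilh K d} (hQ : IsLeibniz Q) (hQ' : IsLeibniz Q')
    (h : ∀ α, Q (gen K d α) = Q' (gen K d α)) : Q = Q' := by
  refine ext_mono fun a => ?_
  induction a with
  | gen α => exact h α
  | mul i a b ha hb =>
    rw [mono_mul, hQ i _ _ _ (mono_mem_homog d a) _ (mono_mem_homog d b),
      hQ' i _ _ _ (mono_mem_homog d a) _ (mono_mem_homog d b), ha, hb]

/-- Expand `Q (Q (a ⊘ᵢ b))` with the rule twice. The two terms `Q a ⊘ᵢ Q b` cancel, and so do all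
terms with `⊘ᵢ₊₁` and with `⊘ᵢ₊₂`. Only `Q (Q a) ⊘ᵢ b` and `a ⊘ᵢ Q (Q b)` are left, and these vanish
by induction on the monomial. -/
theorem IsLeibniz.sq_eq_zero {Q : Eilh K d →ₗ[K] Eilh K d} (hQ : IsLeibniz Q)
    (hdeg : ∀ (p : ℤ), ∀ x ∈ homog K d p, Q x ∈ homog K d (p + 1))
    (h : ∀ α, Q (Q (gen K d α)) = 0) (x : Eilh K d) : Q (Q x) = 0 := by
  have : Q ∘ₗ Q = 0 := by
    refine ext_mono fun a => ?_
    simp only [LinearMap.comp_apply, LinearMap.zero_apply]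
    induction a with
    | gen α => exact h α
    | mul i a b ha hb =>
      have ma := mono_mem_homog (K := K) d a
      have mb := mono_mem_homog (K := K) d b
      have qa := hdeg _ _ ma
      have qb := hdeg _ _ mb
      rw [mono_mul, hQ i _ _ _ ma _ mb]
      simp only [map_add, map_sub, map_zsmul]
      rw [hQ i _ _ _ qa _ mb, hQ i _ _ _ ma _ qb, hQ (i + 1) _ _ _ ma _ mb,
        hQ (i + 1) _ _ _ mb _ ma, ha, hb]
      simp only [map_zero, LinearMap.zero_apply, smul_zero, zero_add, add_zero]
      generalize mono K d a = x at *
      generalize mono K d b = y at *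
      clear ha hb ma mb qa qb h hdeg hQ
      generalize a.deg d = p
      generalize b.deg d = r
      generalize mul d (i + 1) (Q x) y = A1
      generalize mul d (i + 1) y (Q x) = A2
      generalize mul d (i + 1) x (Q y) = A3
      generalize mul d (i + 1) (Q y) x = A4
      generalize mul d i (Q x) (Q y) = A5
      generalize mul d (i + 1 + 1) x y = A6
      generalize mul d (i + 1 + 1) y x = A7
      push_cast
      match_scalars
      all_goals ring_nf
      all_goals try simp (disch := decide) only [ksgn_add, ksgn_odd]
      all_goals try ring_nf
      all_goals try simp (disch := decide) only [ksgn_pow_even]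
      all_goals try ring_nf
  exact LinearMap.congr_fun this x

end Eilh

/-! ### Left-nested monomials span. -/

/-- Left-nested monomials. -/
inductive EMon.IsLeft {ι : Type*} : EMon ι → Prop
  | gen (α : ι) : IsLeft (.gen α)
  | mul (i : ℕ) {a : EMon ι} (α : ι) (ha : IsLeft a) : IsLeft (.mul i a (.gen α))

/-- The number of generators in a monomial. -/
def EMon.size {ι : Type*} : EMon ι → ℕ
  | .gen _ => 1
  | .mul _ a b => a.size + b.size

theorem EMon.size_pos {ι : Type*} (a : EMon ι) : 0 < a.size := by
  induction a with
  | gen => simp [EMon.size]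
  | mul i a b ha hb => simp only [EMon.size]; omega

namespace Eilh

variable {K ι : Type*} [Field K] {d : ι → ℤ}

/-- The span of the left-nested monomials of given degree and size. -/
noncomputable def leftSpan (K : Type*) {ι : Type*} [Field K] (d : ι → ℤ) (n : ℤ) (N : ℕ) :
    Submodule K (Eilh K d) :=
  Submodule.span K {x | ∃ a : EMon ι, a.IsLeft ∧ a.deg d = n ∧ a.size = N ∧ x = mono K d a}

theorem mono_mem_leftSpan {a : EMon ι} (ha : a.IsLeft) {n : ℤ} {N : ℕ} (hn : a.deg d = n)
    (hN : a.size = N) : mono K d a ∈ leftSpan K d n N :=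
  Submodule.subset_span ⟨a, ha, hn, hN, rfl⟩

theorem leftSpan_induction {n : ℤ} {N : ℕ} {P : Eilh K d → Prop} (h0 : P 0)
    (hadd : ∀ x y, P x → P y → P (x + y)) (hsmul : ∀ (c : K) x, P x → P (c • x))
    (hmono : ∀ a : EMon ι, a.IsLeft → a.deg d = n → a.size = N → P (mono K d a)) {x : Eilh K d}
    (hx : x ∈ leftSpan K d n N) : P x := by
  refine Submodule.span_induction ?_ h0 (fun x y _ _ => hadd x y) (fun c x _ => hsmul c x) hx
  rintro x ⟨a, ha, hn, hN, rfl⟩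
  exact hmono a ha hn hN

theorem mul_gen_mem_leftSpan {n m : ℤ} {N M : ℕ} (i : ℕ) (α : ι) (hm : n + d α + i = m)
    (hM : N + 1 = M) {x : Eilh K d} (hx : x ∈ leftSpan K d n N) :
    mul d i x (mono K d (.gen α)) ∈ leftSpan K d m M := by
  refine leftSpan_induction (P := fun x => mul d i x (mono K d (.gen α)) ∈ leftSpan K d m M)
    (by simp) (fun x x' h h' => by simpa using add_mem h h')
    (fun c x h => by simpa using Submodule.smul_mem _ c h) (fun a ha hn hN => ?_) hx
  rw [← mono_mul]
  exact mono_mem_leftSpan (.mul i α ha) (by simp [EMon.deg, hn, hm]) (by simp [EMon.size, hN, hM])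

theorem mul_mem_leftSpan_of_mono {n m : ℤ} {N M : ℕ} (i : ℕ) (b : EMon ι)
    (h : ∀ a : EMon ι, a.IsLeft → a.deg d = n → a.size = N →
      mul d i (mono K d a) (mono K d b) ∈ leftSpan K d m M) {x : Eilh K d}
    (hx : x ∈ leftSpan K d n N) : mul d i x (mono K d b) ∈ leftSpan K d m M :=
  leftSpan_induction (P := fun x => mul d i x (mono K d b) ∈ leftSpan K d m M)
    (by simp) (fun x x' h h' => by simpa using add_mem h h')
    (fun c x h => by simpa using Submodule.smul_mem _ c h) h hx

theorem zsmul_mem_leftSpan {n : ℤ} {N : ℕ} {x : Eilh K d} (c : ℤ) (hx : x ∈ leftSpan K d n N) :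
    c • x ∈ leftSpan K d n N := zsmul_mem hx c

/-- Induction on the total size and, for fixed size, on the outer index `i`. In the normal form of
`a ⊘ᵢ (b ⊘ⱼ γ)` the first two terms end in the letter `γ`, so smaller products suffice. The other
two have the same size, but their outer indices `j + 1` and `i - 1` are smaller than `i` whenever
the terms occur. -/
theorem mono_mul_mono_mem_leftSpan (N : ℕ) : ∀ (i : ℕ) (a b : EMon ι), a.IsLeft → b.IsLeft →
    a.size + b.size = N →
    mul d i (mono K d a) (mono K d b) ∈ leftSpan K d (a.deg d + b.deg d + i) N := by
  induction N using Nat.strong_induction_on with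
  | _ N ihN =>
    intro i
    induction i using Nat.strong_induction_on with
    | _ i ihi =>
      intro a b ha hb hN
      cases hb with
      | gen α =>
        exact mul_gen_mem_leftSpan i α rfl (by simpa [EMon.size] using hN)
          (mono_mem_leftSpan ha rfl rfl)
      | @mul j b γ hb =>
        simp only [EMon.size] at hN
        have pa := a.size_pos
        have pb := b.size_pos
        rw [mono_mul, mul_mul (mono_mem_homog d a) (mono_mem_homog d b)
          (mono_mem_homog d (.gen γ))]
        have hab := ihN (a.size + b.size) (by omega) i a b ha hb rfl
        have hba := ihN (a.size + b.size) (by omega) j b a hb ha (by omega)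
        refine add_mem (add_mem (add_mem (zsmul_mem_leftSpan _ ?_) (zsmul_mem_leftSpan _ ?_)) ?_) ?_
        · exact mul_gen_mem_leftSpan j γ (by simp only [EMon.deg]; ring) (by omega) hab
        · exact mul_gen_mem_leftSpan i γ (by simp only [EMon.deg]; ring) (by omega) hba
        · by_cases hij : j + 2 ≤ i
          · have h := ihN (1 + a.size) (by omega) (i - 1) (.gen γ) a (.gen γ) ha rfl
            refine zsmul_mem_leftSpan _ (mul_mem_leftSpan_of_mono _ _ (fun c hc hd hs => ?_) h)
            convert ihi (j + 1) (by omega) c b hc hb (by omega) using 2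
            rw [hd]
            simp only [EMon.deg]
            push_cast [Nat.cast_sub (show 1 ≤ i by omega)]; ring
          · rw [relC_lt (by omega), zero_smul]; exact zero_mem _
        · by_cases hij : j + 3 ≤ i
          · have h := ihN (1 + b.size) (by omega) (j + 1) (.gen γ) b (.gen γ) hb rfl
            refine zsmul_mem_leftSpan _ (mul_mem_leftSpan_of_mono _ _ (fun c hc hd hs => ?_) h)
            convert ihi (i - 1) (by omega) c a hc ha (by omega) using 2
            rw [hd]
            simp only [EMon.deg]
            push_cast [Nat.cast_sub (show 1 ≤ i by omega)]; ring
          · rw [relD_lt (by omega), zero_smul]; exact zero_mem _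

theorem mono_mem_leftSpan_size (a : EMon ι) : mono K d a ∈ leftSpan K d (a.deg d) a.size := by
  induction a with
  | gen α => exact mono_mem_leftSpan (.gen α) rfl rfl
  | mul i a b ha hb =>
    rw [mono_mul]
    simp only [EMon.deg, EMon.size]
    refine leftSpan_induction (P := fun y => mul d i (mono K d a) y ∈
      leftSpan K d (a.deg d + b.deg d + i) (a.size + b.size)) (by simp)
      (fun x x' h h' => by simpa using add_mem h h')
      (fun c x h => by simpa using Submodule.smul_mem _ c h) (fun b' hb' hd hs => ?_) hb
    refine mul_mem_leftSpan_of_mono _ _ (fun a' ha' hd' hs' => ?_) ha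
    rw [← hd, ← hd', ← hs, ← hs']
    exact mono_mul_mono_mem_leftSpan _ i a' b' ha' hb' rfl

/-- The left-nested monomials of degree `n` span the homogeneous part of degree `n`. -/
theorem homog_eq_span_left (n : ℤ) :
    homog K d n = Submodule.span K {x | ∃ a : EMon ι, a.IsLeft ∧ a.deg d = n ∧ x = mono K d a} := by
  refine le_antisymm (Submodule.span_le.2 ?_) (Submodule.span_mono ?_)
  · rintro x ⟨a, rfl, rfl⟩
    refine Submodule.span_mono ?_ (mono_mem_leftSpan_size (K := K) (d := d) a)
    rintro x ⟨b, hb, hd, _, rfl⟩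
    exact ⟨b, hb, hd, rfl⟩
  · rintro x ⟨a, _, h, rfl⟩
    exact ⟨a, h, rfl⟩

end Eilh

/-! ### Words of weight at most five and the products dual to their splittings. -/

/-- Left-nested words `(⋯(a ⊘ᵢ b) ⊘ⱼ c ⋯)` for which the number of letters plus the sum of the
indices is at most five. The name of a constructor lists the indices. -/
inductive Wd (ι : Type*) where
  | w (a : ι)
  | w0 (a b : ι)
  | w1 (a b : ι)
  | w2 (a b : ι)
  | w3 (a b : ι)
  | w00 (a b c : ι)
  | w10 (a b c : ι)
  | w01 (a b c : ι)
  | w20 (a b c : ι)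
  | w11 (a b c : ι)
  | w02 (a b c : ι)
  | w000 (a b c d : ι)
  | w100 (a b c d : ι)
  | w010 (a b c d : ι)
  | w001 (a b c d : ι)
  | w0000 (a b c d f : ι)

/-- The degree of a word. -/
def Wd.deg {ι : Type*} (e : ι → ℤ) : Wd ι → ℤ
  | .w a => e a
  | .w0 a b => e a + e b
  | .w1 a b => e a + e b + 1
  | .w2 a b => e a + e b + 2
  | .w3 a b => e a + e b + 3
  | .w00 a b c => e a + e b + e c
  | .w10 a b c => e a + e b + 1 + e c
  | .w01 a b c => e a + e b + e c + 1
  | .w20 a b c => e a + e b + 2 + e c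
  | .w11 a b c => e a + e b + 1 + e c + 1
  | .w02 a b c => e a + e b + e c + 2
  | .w000 a b c d => e a + e b + e c + e d
  | .w100 a b c d => e a + e b + 1 + e c + e d
  | .w010 a b c d => e a + e b + e c + 1 + e d
  | .w001 a b c d => e a + e b + e c + e d + 1
  | .w0000 a b c d f => e a + e b + e c + e d + e f

/-- A word as a monomial. -/
def Wd.toMon {ι : Type*} : Wd ι → EMon ι
  | .w a => .gen a
  | .w0 a b => .mul 0 (.gen a) (.gen b)
  | .w1 a b => .mul 1 (.gen a) (.gen b)
  | .w2 a b => .mul 2 (.gen a) (.gen b)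
  | .w3 a b => .mul 3 (.gen a) (.gen b)
  | .w00 a b c => .mul 0 (.mul 0 (.gen a) (.gen b)) (.gen c)
  | .w10 a b c => .mul 0 (.mul 1 (.gen a) (.gen b)) (.gen c)
  | .w01 a b c => .mul 1 (.mul 0 (.gen a) (.gen b)) (.gen c)
  | .w20 a b c => .mul 0 (.mul 2 (.gen a) (.gen b)) (.gen c)
  | .w11 a b c => .mul 1 (.mul 1 (.gen a) (.gen b)) (.gen c)
  | .w02 a b c => .mul 2 (.mul 0 (.gen a) (.gen b)) (.gen c)
  | .w000 a b c d => .mul 0 (.mul 0 (.mul 0 (.gen a) (.gen b)) (.gen c)) (.gen d)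
  | .w100 a b c d => .mul 0 (.mul 0 (.mul 1 (.gen a) (.gen b)) (.gen c)) (.gen d)
  | .w010 a b c d => .mul 0 (.mul 1 (.mul 0 (.gen a) (.gen b)) (.gen c)) (.gen d)
  | .w001 a b c d => .mul 1 (.mul 0 (.mul 0 (.gen a) (.gen b)) (.gen c)) (.gen d)
  | .w0000 a b c d f =>
    .mul 0 (.mul 0 (.mul 0 (.mul 0 (.gen a) (.gen b)) (.gen c)) (.gen d)) (.gen f)

/-- The terms `u ⊘₀ v` in which a word occurs, with the coefficients. -/
def Wd.split₀ {ι : Type*} (e : ι → ℤ) : Wd ι → List (ℤ × Wd ι × Wd ι)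
  | .w0 a b =>
    [(1, .w a, .w b)]
  | .w00 a b c =>
    [(1, .w a, .w0 b c),
      (ksgn (e a * e b), .w b, .w0 a c),
      (1, .w0 a b, .w c)]
  | .w10 a b c =>
    [(1, .w1 a b, .w c)]
  | .w01 a b c =>
    [(ksgn (e a), .w a, .w1 b c)]
  | .w20 a b c =>
    [(1, .w2 a b, .w c)]
  | .w02 a b c =>
    [(1, .w a, .w2 b c)]
  | .w000 a b c d =>
    [(1, .w a, .w00 b c d),
      (ksgn (e a * e b), .w b, .w00 a c d),
      (ksgn (e a * e c + e b * e c), .w c, .w00 a b d),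
      (1, .w0 a b, .w0 c d),
      (ksgn (e b * e c), .w0 a c, .w0 b d),
      (ksgn (e a * e b + e a * e c), .w0 b c, .w0 a d),
      (1, .w00 a b c, .w d)]
  | .w100 a b c d =>
    [(ksgn (e c + e a * e c + e b * e c), .w c, .w10 a b d),
      (1, .w1 a b, .w0 c d),
      (1, .w10 a b c, .w d)]
  | .w010 a b c d =>
    [(ksgn (e a), .w a, .w10 b c d),
      (ksgn (e a * e b + e a * e c), .w1 b c, .w0 a d),
      (1, .w01 a b c, .w d)]
  | .w001 a b c d =>
    [(ksgn (e a), .w a, .w01 b c d),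
      (ksgn (e b + e a * e b), .w b, .w01 a c d),
      (ksgn (e a + e b), .w0 a b, .w1 c d)]
  | .w0000 a b c d f =>
    [(1, .w a, .w000 b c d f),
      (ksgn (e a * e b), .w b, .w000 a c d f),
      (ksgn (e a * e c + e b * e c), .w c, .w000 a b d f),
      (ksgn (e a * e d + e b * e d + e c * e d), .w d, .w000 a b c f),
      (1, .w0 a b, .w00 c d f),
      (ksgn (e b * e c), .w0 a c, .w00 b d f),
      (ksgn (e b * e d + e c * e d), .w0 a d, .w00 b c f),
      (ksgn (e a * e b + e a * e c), .w0 b c, .w00 a d f),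
      (ksgn (e a * e b + e a * e d + e c * e d), .w0 b d, .w00 a c f),
      (ksgn (e a * e c + e a * e d + e b * e c + e b * e d), .w0 c d, .w00 a b f),
      (1, .w00 a b c, .w0 d f),
      (ksgn (e c * e d), .w00 a b d, .w0 c f),
      (ksgn (e b * e c + e b * e d), .w00 a c d, .w0 b f),
      (ksgn (e a * e b + e a * e c + e a * e d), .w00 b c d, .w0 a f),
      (1, .w000 a b c d, .w f)]
  | _ => []

/-- The terms `u ⊘₁ v` in which a word occurs, with the coefficients. -/
def Wd.split₁ {ι : Type*} (e : ι → ℤ) : Wd ι → List (ℤ × Wd ι × Wd ι)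
  | .w1 a b =>
    [(1, .w a, .w b)]
  | .w01 a b c =>
    [(ksgn (e a * e b), .w b, .w0 a c),
      (1, .w0 a b, .w c)]
  | .w11 a b c =>
    [(ksgn (1 + e a), .w a, .w1 b c),
      (ksgn (e b + e a * e b), .w b, .w1 a c),
      (1, .w1 a b, .w c)]
  | .w001 a b c d =>
    [(ksgn (e a * e c + e b * e c), .w c, .w00 a b d),
      (ksgn (e b * e c), .w0 a c, .w0 b d),
      (ksgn (e a * e b + e a * e c), .w0 b c, .w0 a d),
      (1, .w00 a b c, .w d)]
  | _ => []

/-- The terms `u ⊘₂ v` in which a word occurs, with the coefficients. -/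
def Wd.split₂ {ι : Type*} (e : ι → ℤ) : Wd ι → List (ℤ × Wd ι × Wd ι)
  | .w2 a b =>
    [(1, .w a, .w b)]
  | .w11 a b c =>
    [(ksgn (e a * e b + e a * e c), .w b, .w0 c a)]
  | .w02 a b c =>
    [(ksgn (e a * e b), .w b, .w0 a c),
      (1, .w0 a b, .w c)]
  | _ => []

/-- The terms `u ⊘₃ v` in which a word occurs, with the coefficients. -/
def Wd.split₃ {ι : Type*} : Wd ι → List (ℤ × Wd ι × Wd ι)
  | .w3 a b =>
    [(1, .w a, .w b)]
  | _ => []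

/-- The terms `u ⊘ᵢ v` in which a word occurs, with the coefficients. -/
def Wd.split {ι : Type*} (e : ι → ℤ) : ℕ → Wd ι → List (ℤ × Wd ι × Wd ι)
  | 0 => Wd.split₀ e
  | 1 => Wd.split₁ e
  | 2 => Wd.split₂ e
  | 3 => Wd.split₃
  | _ => fun _ => []

theorem Wd.deg_of_mem_split {ι : Type*} (e : ι → ℤ) (i : ℕ) (x : Wd ι) (t : ℤ × Wd ι × Wd ι)
    (ht : t ∈ x.split e i) : t.2.1.deg e + t.2.2.deg e + i = x.deg e := by
  match i with
  | 0 | 1 | 2 | 3 =>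
    cases x <;>
    simp only [Wd.split, Wd.split₀, Wd.split₁, Wd.split₂, Wd.split₃, List.mem_cons,
      List.not_mem_nil, or_false] at ht <;>
    (try rcases ht with rfl | rfl | rfl | rfl | rfl | rfl | rfl | rfl | rfl | rfl | rfl | rfl | rfl
      | rfl | rfl) <;>
    simp only [Wd.deg] <;> push_cast <;> ring
  | (n + 4) => simp [Wd.split] at ht

section

variable {K ι A B C : Type*} [Field K] [AddCommGroup A] [Module K A] [AddCommGroup B] [Module K B]
  [AddCommGroup C] [Module K C]

/-- The product `⊘ᵢ` on coefficient functions, with values multiplied by `f` and with each term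
scaled by a function `s` of the degrees of its factors. -/
def wmul (e : ι → ℤ) (s : ℤ → ℤ → ℤ) (f : A →ₗ[K] B →ₗ[K] C) (i : ℕ) (x : Wd ι → A) (y : Wd ι → B)
    (u : Wd ι) : C :=
  ((u.split e i).map fun t =>
    (t.1 * s (t.2.1.deg e) (t.2.2.deg e)) • f (x t.2.1) (y t.2.2)).sum

/-- A coefficient function which is supported in degree `n`. -/
def IsHomog (e : ι → ℤ) (n : ℤ) (x : Wd ι → A) : Prop := ∀ u, x u ≠ 0 → u.deg e = n

theorem wmul_congr {e : ι → ℤ} {s s' : ℤ → ℤ → ℤ} {f : A →ₗ[K] B →ₗ[K] C} {i : ℕ} {x : Wd ι → A}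
    {y : Wd ι → B} {p q : ℤ} (hx : IsHomog e p x) (hy : IsHomog e q y) (h : s p q = s' p q) :
    wmul e s f i x y = wmul e s' f i x y := by
  funext u
  simp only [wmul]
  congr 1
  refine List.map_congr_left fun t _ => ?_
  by_cases h1 : x t.2.1 = 0
  · simp [h1]
  by_cases h2 : y t.2.2 = 0
  · simp [h2]
  rw [hx _ h1, hy _ h2, h]

theorem wmul_const (e : ι → ℤ) (s : ℤ → ℤ → ℤ) (c : ℤ) (f : A →ₗ[K] B →ₗ[K] C) (i : ℕ)
    (x : Wd ι → A) (y : Wd ι → B) :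
    wmul e (fun p q => c * s p q) f i x y = c • wmul e s f i x y := by
  funext u
  simp only [wmul, Pi.smul_apply, List.smul_sum, List.map_map]
  congr 1
  refine List.map_congr_left fun t _ => ?_
  simp only [Function.comp, smul_smul]
  congr 1; ring

/-- On homogeneous functions the scaling is only ever read at one pair of degrees. Moving a sign
from a scalar into the scaling turns it into a function of the letters of the word, so identities
can be checked word by word with no reference to `p` and `q`. -/
theorem smul_wmul {e : ι → ℤ} {s : ℤ → ℤ → ℤ} {f : A →ₗ[K] B →ₗ[K] C} {i : ℕ} {x : Wd ι → A}
    {y : Wd ι → B} {p q : ℤ} (hx : IsHomog e p x) (hy : IsHomog e q y) :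
    s p q • wmul e (fun _ _ => 1) f i x y = wmul e s f i x y := by
  rw [← wmul_const]
  exact wmul_congr hx hy (by simp)

theorem isHomog_wmul {e : ι → ℤ} {s : ℤ → ℤ → ℤ} {f : A →ₗ[K] B →ₗ[K] C} {i : ℕ} {x : Wd ι → A}
    {y : Wd ι → B} {p q : ℤ} (hx : IsHomog e p x) (hy : IsHomog e q y) :
    IsHomog e (p + q + i) (wmul e s f i x y) := by
  intro u hu
  by_contra hne
  refine hu (List.sum_eq_zero fun c hc => ?_)
  obtain ⟨t, ht, rfl⟩ := List.mem_map.1 hc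
  have := Wd.deg_of_mem_split e i u t ht
  by_cases h1 : x t.2.1 = 0
  · simp [h1]
  by_cases h2 : y t.2.2 = 0
  · simp [h2]
  rw [hx _ h1, hy _ h2] at this
  exact absurd this.symm hne

theorem wmul_add_left (e : ι → ℤ) (s : ℤ → ℤ → ℤ) (f : A →ₗ[K] B →ₗ[K] C) (i : ℕ)
    (x x' : Wd ι → A) (y : Wd ι → B) :
    wmul e s f i (x + x') y = wmul e s f i x y + wmul e s f i x' y := by
  funext u
  simp [wmul, List.sum_map_add]

theorem wmul_add_right (e : ι → ℤ) (s : ℤ → ℤ → ℤ) (f : A →ₗ[K] B →ₗ[K] C) (i : ℕ)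
    (x : Wd ι → A) (y y' : Wd ι → B) :
    wmul e s f i x (y + y') = wmul e s f i x y + wmul e s f i x y' := by
  funext u
  simp [wmul, List.sum_map_add]

theorem wmul_smul_left (e : ι → ℤ) (s : ℤ → ℤ → ℤ) (f : A →ₗ[K] B →ₗ[K] C) (i : ℕ) (c : K)
    (x : Wd ι → A) (y : Wd ι → B) :
    wmul e s f i (c • x) y = c • wmul e s f i x y := by
  funext u
  simp [wmul, List.smul_sum, List.map_map, Function.comp_def, smul_comm _ c]

theorem wmul_smul_right (e : ι → ℤ) (s : ℤ → ℤ → ℤ) (f : A →ₗ[K] B →ₗ[K] C) (i : ℕ) (c : K)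
    (x : Wd ι → A) (y : Wd ι → B) :
    wmul e s f i x (c • y) = c • wmul e s f i x y := by
  funext u
  simp [wmul, List.smul_sum, List.map_map, Function.comp_def, smul_comm _ c]

end

/-! ### The truncated model satisfies the quadratic identities. -/

section

variable {K ι : Type*} [Field K]

theorem intCast_ksgn_pow_even {n : ℤ} {k : ℕ} (hk : Even k) : ((ksgn n : ℤ) : K) ^ k = 1 := by
  rw [← Int.cast_pow, ksgn_pow_even hk, Int.cast_one]

/-- The product `⊘ᵢ` on coefficient functions, with each term scaled by a function `s` of the
degrees of its factors. -/
def kmul (e : ι → ℤ) (s : ℤ → ℤ → ℤ) (i : ℕ) (x y : Wd ι → K) : Wd ι → K :=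
  wmul e s (LinearMap.mul K K) i x y

/-- Three factors contribute at least three letters, so indices with sum at least three lead to
weight at least six, beyond the words that are kept. -/
theorem kmul_kmul_eq_zero (e : ι → ℤ) (s s' : ℤ → ℤ → ℤ) {i j : ℕ} (h : 3 ≤ i + j)
    (x y z : Wd ι → K) : kmul e s i x (kmul e s' j y z) = 0 := by
  funext u
  match i, j, h with
  | 0, 3, _ | 1, 2, _ | 1, 3, _ | 2, 1, _ | 2, 2, _ | 2, 3, _ | 3, 0, _ | 3, 1, _ | 3, 2, _
  | 3, 3, _ =>
    cases u <;>
    simp only [kmul, wmul, Wd.split, Wd.split₀, Wd.split₁, Wd.split₂, Wd.split₃, List.map_nil,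
      List.map_cons, List.sum_nil, List.sum_cons, map_zero, LinearMap.zero_apply, smul_zero,
      add_zero, Pi.zero_apply]
  | i + 4, _, _ => simp [kmul, wmul, Wd.split]
  | i, j + 4, _ => simp [kmul, wmul, Wd.split]

theorem kmul_kmul_eq_zero' (e : ι → ℤ) (s s' : ℤ → ℤ → ℤ) {i j : ℕ} (h : 3 ≤ i + j)
    (x y z : Wd ι → K) : kmul e s j (kmul e s' i x y) z = 0 := by
  funext u
  match i, j, h with
  | 0, 3, _ | 1, 2, _ | 1, 3, _ | 2, 1, _ | 2, 2, _ | 2, 3, _ | 3, 0, _ | 3, 1, _ | 3, 2, _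
  | 3, 3, _ =>
    cases u <;>
    simp only [kmul, wmul, Wd.split, Wd.split₀, Wd.split₁, Wd.split₂, Wd.split₃, List.map_nil,
      List.map_cons, List.sum_nil, List.sum_cons, map_zero, LinearMap.zero_apply, smul_zero,
      add_zero, Pi.zero_apply]
  | i + 4, _, _ => simp [kmul, wmul, Wd.split]
  | i, j + 4, _ => simp [kmul, wmul, Wd.split]

/-- This and the next five identities are the four-term relations with `i + j ≤ 2`, the only ones
that survive the truncation. Signs that depend on the degrees of `x` and `y` are stored in the
scaling of the inner product. -/
theorem kmul_zero_zero (e : ι → ℤ) (x y z : Wd ι → K) :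
    kmul e (fun _ _ => 1) 0 x (kmul e (fun _ _ => 1) 0 y z) =
      kmul e (fun _ _ => 1) 0 (kmul e (fun _ _ => 1) 0 x y) z
      + kmul e (fun _ _ => 1) 0 (kmul e (fun q p => ksgn (p * q)) 0 y x) z := by
  funext u
  cases u <;>
  simp only [kmul, wmul, Wd.split, Wd.split₀, Wd.deg, List.map_cons, List.map_nil, List.sum_cons,
    List.sum_nil, LinearMap.mul_apply', Pi.add_apply, mul_add, add_mul, ksgn_add, mul_one, one_mul,
    zero_mul, mul_zero, add_zero, zero_add, zsmul_eq_mul, Int.cast_mul]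
  all_goals ring_nf
  all_goals try simp (disch := decide) only [intCast_ksgn_pow_even]
  all_goals try ring_nf

theorem kmul_zero_one (e : ι → ℤ) (x y z : Wd ι → K) :
    kmul e (fun _ _ => 1) 0 x (kmul e (fun _ _ => 1) 1 y z) =
      kmul e (fun _ _ => 1) 1 (kmul e (fun p _ => ksgn p) 0 x y) z := by
  funext u
  cases u <;>
  simp only [kmul, wmul, Wd.split, Wd.split₀, Wd.split₁, Wd.deg, List.map_cons, List.map_nil,
    List.sum_cons, List.sum_nil, LinearMap.mul_apply', Pi.add_apply, Pi.zero_apply, mul_add,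
    add_mul, ksgn_add, mul_one, one_mul, zero_mul, mul_zero, smul_zero, add_zero, zero_add,
    zsmul_eq_mul, Int.cast_mul]
  all_goals ring_nf
  all_goals try simp (disch := decide) only [ksgn_pow_two, ksgn_one, ksgn_even, ksgn_odd,
    ksgn_mul_even, ksgn_mul_odd]
  all_goals try ring_nf
  all_goals try simp (disch := decide) only [intCast_ksgn_pow_even]
  all_goals try ring_nf

theorem kmul_zero_two (e : ι → ℤ) (x y z : Wd ι → K) :
    kmul e (fun _ _ => 1) 0 x (kmul e (fun _ _ => 1) 2 y z) =
      kmul e (fun _ _ => 1) 2 (kmul e (fun _ _ => 1) 0 x y) z := by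
  funext u
  cases u <;>
  simp only [kmul, wmul, Wd.split, Wd.split₀, Wd.split₂, Wd.deg, List.map_cons, List.map_nil,
    List.sum_cons, List.sum_nil, LinearMap.mul_apply', Pi.add_apply, Pi.zero_apply, mul_add,
    add_mul, ksgn_add, mul_one, one_mul, zero_mul, mul_zero, smul_zero, add_zero, zero_add,
    zsmul_eq_mul, Int.cast_mul]
  all_goals ring_nf
  all_goals try simp (disch := decide) only [ksgn_pow_two, ksgn_one, ksgn_even, ksgn_odd,
    ksgn_mul_even, ksgn_mul_odd]
  all_goals try ring_nf
  all_goals try simp (disch := decide) only [intCast_ksgn_pow_even]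
  all_goals try ring_nf

theorem kmul_one_zero (e : ι → ℤ) (x y z : Wd ι → K) :
    kmul e (fun _ _ => 1) 1 x (kmul e (fun _ _ => 1) 0 y z) =
      kmul e (fun _ _ => 1) 1 (kmul e (fun q p => ksgn (p * q)) 0 y x) z := by
  funext u
  cases u <;>
  simp only [kmul, wmul, Wd.split, Wd.split₀, Wd.split₁, Wd.deg, List.map_cons, List.map_nil,
    List.sum_cons, List.sum_nil, LinearMap.mul_apply', Pi.add_apply, Pi.zero_apply, mul_add,
    add_mul, ksgn_add, mul_one, one_mul, zero_mul, mul_zero, smul_zero, add_zero, zero_add,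
    zsmul_eq_mul, Int.cast_mul]
  all_goals ring_nf
  all_goals try simp (disch := decide) only [ksgn_pow_two, ksgn_one, ksgn_even, ksgn_odd,
    ksgn_mul_even, ksgn_mul_odd]
  all_goals try ring_nf
  all_goals try simp (disch := decide) only [intCast_ksgn_pow_even]
  all_goals try ring_nf

theorem kmul_one_one (e : ι → ℤ) (x y z : Wd ι → K) :
    kmul e (fun _ _ => 1) 1 x (kmul e (fun _ _ => 1) 1 y z) =
      kmul e (fun _ _ => 1) 1 (kmul e (fun p _ => ksgn (1 + p)) 1 x y) z
      + kmul e (fun _ _ => 1) 1 (kmul e (fun q p => ksgn (p + p * q)) 1 y x) z := by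
  funext u
  cases u <;>
  simp only [kmul, wmul, Wd.split, Wd.split₁, Wd.deg, List.map_cons, List.map_nil,
    List.sum_cons, List.sum_nil, LinearMap.mul_apply', Pi.add_apply, Pi.zero_apply, mul_add,
    add_mul, ksgn_add, mul_one, one_mul, zero_mul, mul_zero, smul_zero, add_zero, zero_add,
    zsmul_eq_mul, Int.cast_mul]
  all_goals ring_nf
  all_goals try simp (disch := decide) only [ksgn_pow_two, ksgn_one, ksgn_even, ksgn_odd,
    ksgn_mul_even, ksgn_mul_odd]
  all_goals try ring_nf
  all_goals try simp (disch := decide) only [intCast_ksgn_pow_even]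
  all_goals try ring_nf

/-- The sign of the last term involves all three degrees and cannot be absorbed into the scaling of
an inner product of two factors, which is why homogeneity is assumed here. That term is visible only
at words of shape `w11`. -/
theorem kmul_two_zero {e : ι → ℤ} {p q r : ℤ} {x y z : Wd ι → K} (hx : IsHomog e p x)
    (hy : IsHomog e q y) (hz : IsHomog e r z) :
    kmul e (fun _ _ => 1) 2 x (kmul e (fun _ _ => 1) 0 y z) =
      kmul e (fun _ _ => 1) 2 (kmul e (fun q p => ksgn (p * q)) 0 y x) z
      + ksgn ((p + q) * r) •
        kmul e (fun _ _ => 1) 1 (kmul e (fun _ _ => 1) 1 z x) y := by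
  funext u
  rw [Pi.add_apply, Pi.smul_apply]
  cases u with
  | w11 a b c =>
    -- Both sides are multiples of `x (.w b) * y (.w c) * z (.w a)`. If this is nonzero, homogeneity
    -- identifies `p`, `q`, `r` with the degrees of the letters.
    by_cases h1 : x (.w b) = 0
    · simp [kmul, wmul, Wd.split, Wd.split₀, Wd.split₁, Wd.split₂, h1]
    by_cases h2 : y (.w c) = 0
    · simp [kmul, wmul, Wd.split, Wd.split₀, Wd.split₁, Wd.split₂, h2]
    by_cases h3 : z (.w a) = 0
    · simp [kmul, wmul, Wd.split, Wd.split₀, Wd.split₁, Wd.split₂, h3]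
    rw [← hx _ h1, ← hy _ h2, ← hz _ h3]
    simp only [kmul, wmul, Wd.split, Wd.split₀, Wd.split₁, Wd.split₂, Wd.deg, List.map_cons,
      List.map_nil, List.sum_cons, List.sum_nil, LinearMap.mul_apply', Pi.add_apply, Pi.smul_apply,
      mul_one, one_mul, zero_mul, mul_zero, smul_zero, add_zero, zero_add, zsmul_eq_mul,
        Int.cast_one]
    ring_nf
  | _ =>
    simp only [kmul, wmul, Wd.split, Wd.split₀, Wd.split₁, Wd.split₂, Wd.deg, List.map_cons,
      List.map_nil, List.sum_cons, List.sum_nil, LinearMap.mul_apply', Pi.add_apply, Pi.smul_apply,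
      mul_one, one_mul, zero_mul, mul_zero, smul_zero, add_zero, zero_add, zsmul_eq_mul,
      Int.cast_one, mul_comm]
    all_goals try ring_nf

end

section

variable {K ι : Type*} [Field K]

/-- The four-term relation for coefficient functions. -/
theorem fourTerm_kmul {e : ι → ℤ} {p q r : ℤ} {x y z : Wd ι → K} (hx : IsHomog e p x)
    (hy : IsHomog e q y) (hz : IsHomog e r z) :
    FourTerm (kmul e (fun _ _ => 1)) p q r x y z := by
  -- Converts an outer sign into a scaling of the inner product, the form in which the six
  -- identities are stated.
  have tw (s : ℤ → ℤ → ℤ) (i j : ℕ) {p q : ℤ} {x y : Wd ι → K} (z : Wd ι → K)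
      (hx : IsHomog e p x) (hy : IsHomog e q y) :
      s p q • kmul e (fun _ _ => 1) j (kmul e (fun _ _ => 1) i x y) z =
        kmul e (fun _ _ => 1) j (kmul e s i x y) z := by
    have h : kmul e s i x y = ((s p q : ℤ) : K) • kmul e (fun _ _ => 1) i x y := by
      rw [Int.cast_smul_eq_zsmul, kmul, kmul, smul_wmul hx hy]
    simp only [kmul] at h ⊢
    rw [h, wmul_smul_left, Int.cast_smul_eq_zsmul]
  intro i j
  by_cases h : 3 ≤ i + j
  · have hA : kmul e (fun _ _ => 1) j (kmul e (fun _ _ => 1) i x y) z = 0 :=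
      kmul_kmul_eq_zero' _ _ _ h _ _ _
    have hB : kmul e (fun _ _ => 1) i (kmul e (fun _ _ => 1) j y x) z = 0 :=
      kmul_kmul_eq_zero' _ _ _ (by omega) _ _ _
    rw [kmul_kmul_eq_zero _ _ _ h, hA, hB]
    by_cases hij : j + 2 ≤ i
    · have hC : kmul e (fun _ _ => 1) (j + 1) (kmul e (fun _ _ => 1) (i - 1) z x) y = 0 :=
        kmul_kmul_eq_zero' _ _ _ (by omega) _ _ _
      have hD : kmul e (fun _ _ => 1) (i - 1) (kmul e (fun _ _ => 1) (j + 1) z y) x = 0 :=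
        kmul_kmul_eq_zero' _ _ _ (by omega) _ _ _
      simp [hC, hD]
    · rw [relC_lt (by omega), relD_lt (by omega)]
      simp
  · obtain ⟨rfl, rfl⟩ | ⟨rfl, rfl⟩ | ⟨rfl, rfl⟩ | ⟨rfl, rfl⟩ | ⟨rfl, rfl⟩ | ⟨rfl, rfl⟩ :
        i = 0 ∧ j = 0 ∨ i = 0 ∧ j = 1 ∨ i = 0 ∧ j = 2 ∨ i = 1 ∧ j = 0 ∨ i = 1 ∧ j = 1 ∨
        i = 2 ∧ j = 0 := by omega
    · simp (disch := omega) only [relA_le, relB_ge, relC_lt, relD_lt, zero_smul, add_zero]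
      rw [tw (fun q p => ksgn ((0 : ℕ) * p + p * q)) 0 0 z hy hx, kmul_zero_zero]
      simp [ksgn_zero]
    · simp (disch := omega) only [relA_le, relB_lt, relC_lt, relD_lt, zero_smul, add_zero]
      rw [tw (fun p _ => ksgn ((0 : ℕ) * (1 : ℕ) + (1 : ℕ) * p)) 0 1 z hx hy, kmul_zero_one]
      simp
    · simp (disch := omega) only [relA_le, relB_lt, relC_lt, relD_lt, zero_smul, add_zero]
      rw [kmul_zero_two, ksgn_even (by simp), one_smul]
    · simp (disch := omega) only [relA_gt, relB_ge, relC_lt, relD_lt, zero_smul, add_zero, zero_add]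
      rw [tw (fun q p => ksgn ((0 : ℕ) * p + p * q)) 0 1 z hy hx, kmul_one_zero]
      simp
    · simp (disch := omega) only [relA_le, relB_ge, relC_lt, relD_lt, zero_smul, add_zero]
      rw [tw (fun p _ => ksgn ((1 : ℕ) * (1 : ℕ) + (1 : ℕ) * p)) 1 1 z hx hy,
        tw (fun q p => ksgn ((1 : ℕ) * p + p * q)) 1 1 z hy hx, kmul_one_one]
      simp
    · simp (disch := omega) only [relA_gt, relB_ge, relC_ge, relD_lt, zero_smul, add_zero, zero_add]
      rw [tw (fun q p => ksgn ((0 : ℕ) * p + p * q)) 0 2 z hy hx, kmul_two_zero hx hy hz]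
      simp

/-! ### The coefficient map and the linear independence of words. -/

open Classical in
/-- The coefficient function of a word. -/
noncomputable def wordFun (K : Type*) {ι : Type*} [Field K] (u v : Wd ι) : K :=
  if v = u then 1 else 0

open Classical in
/-- The coefficient function of a generator. -/
noncomputable def genFun (K : Type*) {ι : Type*} [Field K] (α : ι) : Wd ι → K
  | .w a => if a = α then 1 else 0
  | _ => 0

/-- The product `⊘ᵢ` on coefficient functions as a bilinear map. -/
noncomputable def kmulLin (K : Type*) {ι : Type*} [Field K] (e : ι → ℤ) (i : ℕ) :
    (Wd ι → K) →ₗ[K] (Wd ι → K) →ₗ[K] (Wd ι → K) :=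
  LinearMap.mk₂ K (kmul e (fun _ _ => 1) i) (wmul_add_left e _ (LinearMap.mul K K) i)
    (wmul_smul_left e _ (LinearMap.mul K K) i) (wmul_add_right e _ (LinearMap.mul K K) i)
    (fun c x y => wmul_smul_right e _ (LinearMap.mul K K) i c x y)

/-- The coefficients of a monomial with respect to words. -/
noncomputable def coeffMon (K : Type*) {ι : Type*} [Field K] (e : ι → ℤ) : EMon ι → Wd ι → K
  | .gen α => genFun K α
  | .mul i a b => kmul e (fun _ _ => 1) i (coeffMon K e a) (coeffMon K e b)

theorem isHomog_coeffMon (e : ι → ℤ) (a : EMon ι) : IsHomog e (a.deg e) (coeffMon K e a) := by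
  induction a with
  | gen α =>
    intro u hu
    cases u <;> simp_all [coeffMon, genFun, Wd.deg, EMon.deg]
  | mul i a b ha hb =>
    rw [EMon.deg, coeffMon]
    exact isHomog_wmul ha hb

/-- The coefficients of an element of the free algebra with respect to words. -/
noncomputable def coeffFree (K : Type*) {ι : Type*} [Field K] (e : ι → ℤ) :
    FreeE K ι →ₗ[K] Wd ι → K :=
  Finsupp.linearCombination K (coeffMon K e)

theorem coeffFree_mon (e : ι → ℤ) (a : EMon ι) :
    coeffFree K e (FreeE.mon K a) = coeffMon K e a := by
  simp [coeffFree, FreeE.mon]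

theorem coeffFree_mul (e : ι → ℤ) (i : ℕ) (x y : FreeE K ι) :
    coeffFree K e (FreeE.mul K i x y) = kmulLin K e i (coeffFree K e x) (coeffFree K e y) := by
  refine Eilh.free_induction (P := fun x => coeffFree K e (FreeE.mul K i x y) =
    kmulLin K e i (coeffFree K e x) (coeffFree K e y)) (by simp) (fun x x' h h' => by simp [h, h'])
    (fun c x h => by simp [h]) (fun a => ?_) x
  refine Eilh.free_induction (P := fun y => coeffFree K e (FreeE.mul K i (FreeE.mon K a) y) =
    kmulLin K e i (coeffFree K e (FreeE.mon K a)) (coeffFree K e y)) (by simp)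
    (fun x x' h h' => by simp [h, h']) (fun c x h => by simp [h]) (fun b => ?_) y
  rw [Eilh.free_mul_mon, coeffFree_mon, coeffFree_mon, coeffFree_mon]
  rfl

/-- The kernel is stable under products because the coefficient map is multiplicative, and it
contains the identities because the model satisfies them. Hence coefficients are well defined on the
quotient, which is the source of all linear independence used later. -/
theorem eilhIdeal_le_ker_coeffFree (e : ι → ℤ) :
    eilhIdeal K e ≤ LinearMap.ker (coeffFree K e) := by
  refine sInf_le (⟨fun x y h => ?_, fun i x y hx => ?_⟩ : _ ∧ _)
  · obtain ⟨i, j, a, b, c, rfl, rfl⟩ := h.exists_form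
    rw [LinearMap.mem_ker, map_sub, sub_eq_zero]
    simp only [map_add, map_zsmul, coeffFree_mon]
    exact fourTerm_kmul (isHomog_coeffMon e a) (isHomog_coeffMon e b) (isHomog_coeffMon e c) i j
  · rw [LinearMap.mem_ker] at hx
    simp [LinearMap.mem_ker, coeffFree_mul, hx]

namespace Eilh

/-- The coefficients of an element of `𝓔(V)` with respect to words. -/
noncomputable def coeff (e : ι → ℤ) : Eilh K e →ₗ[K] Wd ι → K :=
  (eilhIdeal K e).liftQ (coeffFree K e) (eilhIdeal_le_ker_coeffFree e)

theorem coeff_mono (e : ι → ℤ) (a : EMon ι) : coeff e (mono K e a) = coeffMon K e a :=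
  coeffFree_mon e a

theorem coeff_gen (e : ι → ℤ) (α : ι) : coeff e (gen K e α) = genFun K α :=
  coeff_mono e (.gen α)

theorem coeff_mul (e : ι → ℤ) (i : ℕ) (x y : Eilh K e) :
    coeff e (mul e i x y) = kmul e (fun _ _ => 1) i (coeff e x) (coeff e y) := by
  induction x using Submodule.Quotient.induction_on with
  | H x =>
    induction y using Submodule.Quotient.induction_on with
    | H y => exact coeffFree_mul e i x y

theorem isHomog_coeff {e : ι → ℤ} {n : ℤ} {x : Eilh K e} (hx : x ∈ homog K e n) :
    IsHomog e n (coeff e x) := by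
  refine homog_induction (P := fun x => IsHomog e n (coeff e x)) ?_ ?_ ?_ ?_ hx
  · intro u hu
    simp at hu
  · intro x y h h' u hu
    by_cases h1 : coeff e x u = 0
    · exact h' u (by simpa [h1] using hu)
    · exact h u h1
  · intro c x h u hu
    exact h u fun h0 => hu (by simp [h0])
  · rintro a rfl
    rw [coeff_mono]
    exact isHomog_coeffMon e a

-- Appending a letter on the right: in the list of splittings of a word, the entry that cuts off the
-- last letter has coefficient one, and it is the only entry whose factors have the two shapes in
-- question.
set_option maxHeartbeats 4000000 in
theorem kmul_wordFun_genFun (e : ι → ℤ) :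
    (∀ a b : ι, kmul e (fun _ _ => 1) 0 (genFun K a) (genFun K b) =
        wordFun K (.w0 a b)) ∧
    (∀ a b : ι, kmul e (fun _ _ => 1) 1 (genFun K a) (genFun K b) =
        wordFun K (.w1 a b)) ∧
    (∀ a b : ι, kmul e (fun _ _ => 1) 2 (genFun K a) (genFun K b) =
        wordFun K (.w2 a b)) ∧
    (∀ a b : ι, kmul e (fun _ _ => 1) 3 (genFun K a) (genFun K b) =
        wordFun K (.w3 a b)) ∧
    (∀ a b c : ι, kmul e (fun _ _ => 1) 0 (wordFun K (.w0 a b)) (genFun K c) =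
        wordFun K (.w00 a b c)) ∧
    (∀ a b c : ι, kmul e (fun _ _ => 1) 0 (wordFun K (.w1 a b)) (genFun K c) =
        wordFun K (.w10 a b c)) ∧
    (∀ a b c : ι, kmul e (fun _ _ => 1) 1 (wordFun K (.w0 a b)) (genFun K c) =
        wordFun K (.w01 a b c)) ∧
    (∀ a b c : ι, kmul e (fun _ _ => 1) 0 (wordFun K (.w2 a b)) (genFun K c) =
        wordFun K (.w20 a b c)) ∧
    (∀ a b c : ι, kmul e (fun _ _ => 1) 1 (wordFun K (.w1 a b)) (genFun K c) =
        wordFun K (.w11 a b c)) ∧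
    (∀ a b c : ι, kmul e (fun _ _ => 1) 2 (wordFun K (.w0 a b)) (genFun K c) =
        wordFun K (.w02 a b c)) ∧
    (∀ a b c d : ι, kmul e (fun _ _ => 1) 0 (wordFun K (.w00 a b c)) (genFun K d) =
        wordFun K (.w000 a b c d)) ∧
    (∀ a b c d : ι, kmul e (fun _ _ => 1) 0 (wordFun K (.w10 a b c)) (genFun K d) =
        wordFun K (.w100 a b c d)) ∧
    (∀ a b c d : ι, kmul e (fun _ _ => 1) 0 (wordFun K (.w01 a b c)) (genFun K d) =
        wordFun K (.w010 a b c d)) ∧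
    (∀ a b c d : ι, kmul e (fun _ _ => 1) 1 (wordFun K (.w00 a b c)) (genFun K d) =
        wordFun K (.w001 a b c d)) ∧
    (∀ a b c d f : ι, kmul e (fun _ _ => 1) 0 (wordFun K (.w000 a b c d)) (genFun K f) =
        wordFun K (.w0000 a b c d f)) := by
  classical
  refine ⟨?_, ?_, ?_, ?_, ?_, ?_, ?_, ?_, ?_, ?_, ?_, ?_, ?_, ?_, ?_⟩ <;> intros <;> funext v <;>
    cases v <;> simp [kmul, wmul, genFun, wordFun, Wd.split, Wd.split₀, Wd.split₁,
      Wd.split₂, Wd.split₃, ← ite_and, and_assoc]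
  all_goals exact if_congr (by tauto) rfl rfl

theorem coeff_word (e : ι → ℤ) (u : Wd ι) : coeff e (mono K e u.toMon) = wordFun K u := by
  obtain ⟨h0, h1, h2, h3, h00, h10, h01, h20, h11, h02, h000, h100, h010, h001, h0000⟩ :=
    kmul_wordFun_genFun (K := K) e
  rw [coeff_mono]
  cases u with
  | w a =>
    funext v
    classical
    cases v <;> simp [Wd.toMon, coeffMon, genFun, wordFun]
  | _ =>
    simp only [Wd.toMon, coeffMon, h0, h1, h2, h3, h00, h10, h01, h20, h11, h02, h000, h100, h010,
      h001, h0000]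

/-- A left-nested monomial of degree at most five is one of the words. -/
theorem exists_word {e : ι → ℤ} (he : ∀ α, 1 ≤ e α) {a : EMon ι} (ha : a.IsLeft)
    (hd : a.deg e ≤ 5) : ∃ u : Wd ι, u.toMon = a := by
  -- Positivity of degrees bounds the number of letters plus the sum of the indices by five; it also
  -- excludes a nonempty prefix before five further letters.
  have pos : ∀ b : EMon ι, 1 ≤ b.deg e := by
    intro b
    induction b with
    | gen α => exact he α
    | mul i a b ha hb => simp only [EMon.deg]; omega
  cases ha with
  | gen α => exact ⟨.w α, rfl⟩
  | @mul i a α ha =>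
    have hα := he α
    simp only [EMon.deg] at hd
    cases ha with
    | gen β =>
      have hβ := he β
      simp only [EMon.deg] at hd
      have : i ≤ 3 := by omega
      interval_cases i
      exacts [⟨.w0 β α, rfl⟩, ⟨.w1 β α, rfl⟩, ⟨.w2 β α, rfl⟩, ⟨.w3 β α, rfl⟩]
    | @mul j a β ha =>
      have hβ := he β
      simp only [EMon.deg] at hd
      cases ha with
      | gen γ =>
        have hγ := he γ
        simp only [EMon.deg] at hd
        obtain ⟨rfl, rfl⟩ | ⟨rfl, rfl⟩ | ⟨rfl, rfl⟩ | ⟨rfl, rfl⟩ | ⟨rfl, rfl⟩ | ⟨rfl, rfl⟩ :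
          j = 0 ∧ i = 0 ∨ j = 1 ∧ i = 0 ∨ j = 0 ∧ i = 1 ∨ j = 2 ∧ i = 0 ∨ j = 1 ∧ i = 1 ∨
          j = 0 ∧ i = 2 := by omega
        exacts [⟨.w00 γ β α, rfl⟩, ⟨.w10 γ β α, rfl⟩, ⟨.w01 γ β α, rfl⟩, ⟨.w20 γ β α, rfl⟩,
          ⟨.w11 γ β α, rfl⟩, ⟨.w02 γ β α, rfl⟩]
      | @mul k a γ ha =>
        have hγ := he γ
        simp only [EMon.deg] at hd
        cases ha with
        | gen δ =>
          have hδ := he δ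
          simp only [EMon.deg] at hd
          obtain ⟨rfl, rfl, rfl⟩ | ⟨rfl, rfl, rfl⟩ | ⟨rfl, rfl, rfl⟩ | ⟨rfl, rfl, rfl⟩ :
            k = 0 ∧ j = 0 ∧ i = 0 ∨ k = 1 ∧ j = 0 ∧ i = 0 ∨ k = 0 ∧ j = 1 ∧ i = 0 ∨
            k = 0 ∧ j = 0 ∧ i = 1 := by omega
          exacts [⟨.w000 δ γ β α, rfl⟩, ⟨.w100 δ γ β α, rfl⟩, ⟨.w010 δ γ β α, rfl⟩,
            ⟨.w001 δ γ β α, rfl⟩]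
        | @mul l a δ ha =>
          have hδ := he δ
          have ha' := pos a
          simp only [EMon.deg] at hd
          cases ha with
          | gen ε =>
            obtain ⟨rfl, rfl, rfl, rfl⟩ : l = 0 ∧ k = 0 ∧ j = 0 ∧ i = 0 := by omega
            exact ⟨.w0000 ε δ γ β α, rfl⟩
          | @mul m a ε ha =>
            have hε := he ε
            have ha' := pos a
            simp only [EMon.deg] at hd
            omega

/-- Let `s` send a finite combination of words to its value in `𝓔(V)`. Then `coeff ∘ s` is the
inclusion of finitely supported functions, so `coeff` is injective on the range of `s`. By the
spanning of left-nested monomials this range contains everything homogeneous of degree at most five.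
-/
theorem eq_zero_of_coeff_eq_zero {e : ι → ℤ} (he : ∀ α, 1 ≤ e α) {n : ℤ} (hn : n ≤ 5)
    {x : Eilh K e} (hx : x ∈ homog K e n) (h : coeff e x = 0) : x = 0 := by
  let s : (Wd ι →₀ K) →ₗ[K] Eilh K e :=
    Finsupp.linearCombination K fun u => mono K e u.toMon
  have hs : ∀ f : Wd ι →₀ K, coeff e (s f) = f := by
    classical
    intro f
    induction f using Finsupp.induction_linear with
    | zero => simp
    | add f g hf hg => simp [hf, hg]
    | single u c =>
      funext v
      simp [s, coeff_word, wordFun, Finsupp.single_apply, eq_comm]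
  have : x ∈ LinearMap.range s := by
    rw [homog_eq_span_left] at hx
    refine Submodule.span_le.2 ?_ hx
    rintro _ ⟨a, ha, hd, rfl⟩
    obtain ⟨u, rfl⟩ := exists_word he ha (hd.le.trans hn)
    exact ⟨Finsupp.single u 1, by simp [s]⟩
  obtain ⟨f, rfl⟩ := this
  rw [hs] at h
  have : f = 0 := DFunLike.coe_injective h
  rw [this, map_zero]

theorem eq_of_coeff_eq {e : ι → ℤ} (he : ∀ α, 1 ≤ e α) {n : ℤ} (hn : n ≤ 5)
    {x y : Eilh K e} (hx : x ∈ homog K e n) (hy : y ∈ homog K e n) (h : coeff e x = coeff e y) :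
    x = y :=
  sub_eq_zero.1 (eq_zero_of_coeff_eq_zero he hn (sub_mem hx hy) (by rw [map_sub, h, sub_self]))

end Eilh

end

/-! ### Coefficient functions with values in a module. -/

section

variable {K ι A B C : Type*} [Field K] [AddCommGroup A] [Module K A] [AddCommGroup B] [Module K B]
  [AddCommGroup C] [Module K C]

theorem wmul_sum_left {κ : Type*} (s : Finset κ) (e : ι → ℤ) (S : ℤ → ℤ → ℤ)
    (f : A →ₗ[K] B →ₗ[K] C) (i : ℕ) (x : κ → Wd ι → A) (y : Wd ι → B) :
    wmul e S f i (∑ k ∈ s, x k) y = ∑ k ∈ s, wmul e S f i (x k) y := by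
  classical
  induction s using Finset.induction_on with
  | empty =>
    have := wmul_smul_left e S f i 0 0 y
    simpa using this
  | insert k s hk ih => rw [Finset.sum_insert hk, Finset.sum_insert hk, wmul_add_left, ih]

theorem wmul_sum_right {κ : Type*} (s : Finset κ) (e : ι → ℤ) (S : ℤ → ℤ → ℤ)
    (f : A →ₗ[K] B →ₗ[K] C) (i : ℕ) (x : Wd ι → A) (y : κ → Wd ι → B) :
    wmul e S f i x (∑ k ∈ s, y k) = ∑ k ∈ s, wmul e S f i x (y k) := by
  classical
  induction s using Finset.induction_on with
  | empty =>
    have := wmul_smul_right e S f i 0 x 0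
    simpa using this
  | insert k s hk ih => rw [Finset.sum_insert hk, Finset.sum_insert hk, wmul_add_right, ih]

theorem wmul_flip (e : ι → ℤ) (S : ℤ → ℤ → ℤ) (f : A →ₗ[K] B →ₗ[K] C) (i : ℕ) (x : Wd ι → K)
    (y : Wd ι → K) (v : A) (u : B) :
    wmul e S f i (fun w => x w • v) (fun w => y w • u) = fun w => kmul e S i x y w • f v u := by
  funext w
  simp only [wmul, kmul, map_smul, LinearMap.smul_apply, smul_smul, LinearMap.mul_apply',
    List.sum_smul, List.map_map]
  congr 1
  refine List.map_congr_left fun t _ => ?_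
  simp only [Function.comp, ← Int.cast_smul_eq_zsmul K, smul_smul, smul_eq_mul]
  congr 1; ring

namespace Eilh

variable {e : ι → ℤ} {κ μ : Type*} [Fintype κ] [Fintype μ]

/-- The coefficients with values in `A` of the element `∑ₖ X k ⊗ v k` of `𝓔(V) ⊗ A`. -/
noncomputable def fam (X : κ → Eilh K e) (v : κ → A) : Wd ι → A :=
  ∑ k, fun w => coeff e (X k) w • v k

theorem fam_apply (X : κ → Eilh K e) (v : κ → A) (w : Wd ι) :
    fam X v w = ∑ k, coeff e (X k) w • v k := by
  simp [fam, Finset.sum_apply]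

/-- The sign `S` refers to the labels `m k` and `n k`, whereas the elements have degrees shifted by
`a` and `b`, for instance after applying `Q`. Only the actual degrees can be seen at a word, so the
labels are recovered as `p - a` and `q - b`. -/
theorem fam_mul {X : κ → Eilh K e} {Y : μ → Eilh K e} {m : κ → ℤ} {n : μ → ℤ} (a b : ℤ)
    (hX : ∀ k, X k ∈ homog K e (m k + a)) (hY : ∀ k, Y k ∈ homog K e (n k + b))
    (v : κ → A) (u : μ → B) (S : ℤ → ℤ → ℤ) (f : A →ₗ[K] B →ₗ[K] C) (i : ℕ) :
    fam (fun k : κ × μ => mul e i (X k.1) (Y k.2))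
      (fun k => S (m k.1) (n k.2) • f (v k.1) (u k.2)) =
    wmul e (fun p q => S (p - a) (q - b)) f i (fam X v) (fam Y u) := by
  rw [fam, fam, fam, wmul_sum_left, Fintype.sum_prod_type]
  refine Finset.sum_congr rfl fun k _ => ?_
  rw [wmul_sum_right]
  refine Finset.sum_congr rfl fun l _ => ?_
  rw [wmul_flip]
  funext w
  have h := congrFun (smul_wmul (s := fun p q => S (p - a) (q - b)) (f := LinearMap.mul K K)
    (i := i) (isHomog_coeff (hX k)) (isHomog_coeff (hY l))) w
  simp only [add_sub_cancel_right] at h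
  rw [coeff_mul, kmul, kmul, ← h, Pi.smul_apply, smul_comm, smul_assoc]

/-- Needed for the term `b ⊘ᵢ₊₁ a` of the deformed rule, where the monomials are exchanged while the
value remains `f (v, u)`. -/
theorem fam_mul_swap {X : κ → Eilh K e} {Y : μ → Eilh K e} {m : κ → ℤ} {n : μ → ℤ}
    (hX : ∀ k, X k ∈ homog K e (m k)) (hY : ∀ k, Y k ∈ homog K e (n k))
    (v : κ → A) (u : μ → B) (S : ℤ → ℤ → ℤ) (f : A →ₗ[K] B →ₗ[K] C) (i : ℕ) :
    fam (fun k : κ × μ => mul e i (Y k.2) (X k.1))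
      (fun k => S (m k.1) (n k.2) • f (v k.1) (u k.2)) =
    wmul e (fun q p => S p q) f.flip i (fam Y u) (fam X v) := by
  have h := fam_mul (m := n) (n := m) 0 0 (by simpa using hY) (by simpa using hX) u v
    (fun q p => S p q) f.flip i
  simp only [sub_zero] at h
  rw [← h]
  funext w
  rw [fam_apply, fam_apply, ← (Equiv.prodComm κ μ).sum_comp]
  rfl

theorem fam_add (X X' : κ → Eilh K e) (v : κ → A) :
    fam (fun k => X k + X' k) v = fam X v + fam X' v := by
  funext w
  simp [fam_apply, add_smul, Finset.sum_add_distrib]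

/-- The coefficients of `Q` applied to the products of two families, if `x`, `y` are the
coefficients of the families and `x'`, `y'` those of `Q` applied to the families. -/
def leib (e : ι → ℤ) (S : ℤ → ℤ → ℤ) (f : A →ₗ[K] B →ₗ[K] C) (i : ℕ) (x x' : Wd ι → A)
    (y y' : Wd ι → B) : Wd ι → C :=
  ksgn i • (wmul e (fun p q => S (p - 1) q) f i x' y
      + wmul e (fun p q => ksgn p * S p (q - 1)) f i x y')
    + ksgn i • wmul e S f (i + 1) x y
    - wmul e (fun q p => ksgn (p * q) * S p q) f.flip (i + 1) y x

/-- Each of the four terms of the rule is a product of families. Where `Q` has been applied to a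
factor its degree has grown by one, which accounts for `p - 1` and `q - 1` in `leib`. -/
theorem fam_leibniz {Q : Eilh K e →ₗ[K] Eilh K e} (hQ : IsLeibniz Q)
    (hdeg : ∀ (p : ℤ), ∀ x ∈ homog K e p, Q x ∈ homog K e (p + 1))
    {X : κ → Eilh K e} {Y : μ → Eilh K e} {m : κ → ℤ} {n : μ → ℤ}
    (hX : ∀ k, X k ∈ homog K e (m k)) (hY : ∀ k, Y k ∈ homog K e (n k))
    (v : κ → A) (u : μ → B) (S : ℤ → ℤ → ℤ) (f : A →ₗ[K] B →ₗ[K] C) (i : ℕ) :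
    fam (fun k : κ × μ => Q (mul e i (X k.1) (Y k.2)))
      (fun k => S (m k.1) (n k.2) • f (v k.1) (u k.2)) =
    leib e S f i (fam X v) (fam (fun k => Q (X k)) v) (fam Y u) (fam (fun k => Q (Y k)) u) := by
  have h1 := fam_mul (K := K) (e := e) 1 0 (fun k => hdeg _ _ (hX k)) (by simpa using hY) v u S f i
  have h2 := fam_mul (K := K) (e := e) 0 1 (by simpa using hX) (fun k => hdeg _ _ (hY k)) v u
    (fun p q => ksgn p * S p q) f i
  have h3 := fam_mul (K := K) (e := e) 0 0 (by simpa using hX) (by simpa using hY) v u S f (i + 1)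
  have h4 := fam_mul_swap (K := K) (e := e) hX hY v u (fun p q => ksgn (p * q) * S p q) f (i + 1)
  simp only [sub_zero] at h1 h2 h3
  rw [leib, ← h1, ← h2, ← h3, ← h4]
  have hexp : ∀ k : κ × μ, Q (mul e i (X k.1) (Y k.2)) =
      ksgn i • (mul e i (Q (X k.1)) (Y k.2) + ksgn (m k.1) • mul e i (X k.1) (Q (Y k.2))) +
        ksgn i • mul e (i + 1) (X k.1) (Y k.2)
        - ksgn (m k.1 * n k.2) • mul e (i + 1) (Y k.2) (X k.1) :=
    fun k => hQ i _ _ _ (hX k.1) _ (hY k.2)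
  funext w
  simp only [fam_apply, Pi.add_apply, Pi.sub_apply, Pi.smul_apply, Finset.smul_sum,
    ← Finset.sum_add_distrib, ← Finset.sum_sub_distrib]
  refine Finset.sum_congr rfl fun k _ => ?_
  rw [hexp]
  simp only [map_add, map_sub, map_zsmul, Pi.add_apply, Pi.sub_apply, Pi.smul_apply]
  simp only [← Int.cast_smul_eq_zsmul K, smul_smul, smul_eq_mul, Int.cast_mul]
  module

end Eilh

end

/-! ### Operations without axioms and the dual values on generators. -/

/-- The operations of a weak Lie 3-algebra, without the axioms. -/
structure LieThreeOps {K E : Type*} [Field K] [AddCommGroup E] [Module K E]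
    (ℳ : ℤ → Submodule K E) where
  d : E →ₗ[K] E
  br : E →ₗ[K] E →ₗ[K] E
  alt : E →ₗ[K] E →ₗ[K] E
  alt₂ : E →ₗ[K] E →ₗ[K] E
  jac : E →ₗ[K] E →ₗ[K] E →ₗ[K] E
  jacL : E →ₗ[K] E →ₗ[K] E →ₗ[K] E
  jacR : E →ₗ[K] E →ₗ[K] E →ₗ[K] E
  jac₄ : E →ₗ[K] E →ₗ[K] E →ₗ[K] E →ₗ[K] E
  d_mem : ∀ p, ∀ x ∈ ℳ p, d x ∈ ℳ (p + 1)
  br_mem : ∀ p q, ∀ x ∈ ℳ p, ∀ y ∈ ℳ q, br x y ∈ ℳ (p + q)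
  alt_mem : ∀ p q, ∀ x ∈ ℳ p, ∀ y ∈ ℳ q, alt x y ∈ ℳ (p + q - 1)
  alt₂_mem : ∀ p q, ∀ x ∈ ℳ p, ∀ y ∈ ℳ q, alt₂ x y ∈ ℳ (p + q - 2)
  jac_mem : ∀ p q r, ∀ x ∈ ℳ p, ∀ y ∈ ℳ q, ∀ z ∈ ℳ r, jac x y z ∈ ℳ (p + q + r - 1)
  jacL_mem : ∀ p q r, ∀ x ∈ ℳ p, ∀ y ∈ ℳ q, ∀ z ∈ ℳ r, jacL x y z ∈ ℳ (p + q + r - 2)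
  jacR_mem : ∀ p q r, ∀ x ∈ ℳ p, ∀ y ∈ ℳ q, ∀ z ∈ ℳ r, jacR x y z ∈ ℳ (p + q + r - 2)
  jac₄_mem : ∀ p q r s, ∀ x ∈ ℳ p, ∀ y ∈ ℳ q, ∀ z ∈ ℳ r, ∀ u ∈ ℳ s,
    jac₄ x y z u ∈ ℳ (p + q + r + s - 2)

/-- The operations of a weak Lie 3-algebra. -/
def WeakLieThree.ops {K E : Type*} [Field K] [AddCommGroup E] [Module K E]
    {ℳ : ℤ → Submodule K E} (W : WeakLieThree ℳ) : LieThreeOps ℳ where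
  d := W.d
  br := W.br
  alt := W.alt
  alt₂ := W.alt₂
  jac := W.jac
  jacL := W.jacL
  jacR := W.jacR
  jac₄ := W.jac₄
  d_mem := W.d_mem
  br_mem := W.br_mem
  alt_mem := W.alt_mem
  alt₂_mem := W.alt₂_mem
  jac_mem := W.jac_mem
  jacL_mem := W.jacL_mem
  jacR_mem := W.jacR_mem
  jac₄_mem := W.jac₄_mem

/-- The sign of a pair of letters. -/
def pairSign (p q : ℤ) : ℤ := ksgn (q * (p - 1))

/-- The sign of a pair of letters for an operation of odd degree. -/
def pairSignOdd (p q : ℤ) : ℤ := ksgn (p + q + q * (p - 1))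

/-- The sign of a letter which is appended to a pair of letters with product `⊘ᵢ`. -/
def tripleSign (i : ℤ) (p q : ℤ) : ℤ := ksgn (q * (p - i - 2))

/-- The sign of a letter which is appended to a pair of letters, for an operation of odd degree. -/
def tripleSignOdd (p q : ℤ) : ℤ := ksgn (p + q + q * (p - 2))

/-- The sign of a letter which is appended to a triple of letters. -/
def quadSign (p q : ℤ) : ℤ := ksgn (q * (p - 3))

namespace LieThreeOps

open Eilh

variable {K E ι : Type*} [Field K] [AddCommGroup E] [Module K E]
  {ℳ : ℤ → Submodule K E} (W : LieThreeOps ℳ) (τ : Module.Basis ι K E) (e : ι → ℤ)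

/-- The value of the differential on a generator that is dual to the operations. -/
noncomputable def ceGen [Fintype ι] (α : ι) : Eilh K e :=
  let t := Eilh.gen K e
  let m₂ := fun (i : ℕ) (β γ : ι) => Eilh.mul e i (t β) (t γ)
  let m₃ := fun (i j : ℕ) (β γ δ : ι) => Eilh.mul e j (m₂ i β γ) (t δ)
  let m₄ := fun (i j k : ℕ) (β γ δ ζ : ι) => Eilh.mul e k (m₃ i j β γ δ) (t ζ)
  let s₂ := fun β γ : ι => e γ * (e β - 1)
  let s₃ := fun β γ δ : ι => s₂ β γ + e δ * (e β + e γ - 2)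
  let s₄ := fun β γ δ ζ : ι => s₃ β γ δ + e ζ * (e β + e γ + e δ - 3);
  -((∑ β, ksgn (e β) • τ.coord α (W.d (τ β)) • t β)
    + (∑ β, ∑ γ, (
      ksgn (s₂ β γ) • τ.coord α (W.br (τ β) (τ γ)) • m₂ 0 β γ
      + ksgn (e β + e γ + s₂ β γ) • τ.coord α (W.alt (τ β) (τ γ)) • m₂ 1 β γ
      + ksgn (s₂ β γ) • τ.coord α (W.alt₂ (τ β) (τ γ)) • m₂ 2 β γ))
    + (∑ β, ∑ γ, ∑ δ, (
      ksgn (e β + e γ + e δ + s₃ β γ δ) • τ.coord α (W.jac (τ β) (τ γ) (τ δ)) • m₃ 0 0 β γ δ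
      + ksgn (s₃ β γ δ) • τ.coord α (W.jacL (τ β) (τ γ) (τ δ)) • m₃ 1 0 β γ δ
      + ksgn (s₃ β γ δ) • τ.coord α (W.jacR (τ β) (τ γ) (τ δ)) • m₃ 0 1 β γ δ))
    + (∑ β, ∑ γ, ∑ δ, ∑ ζ,
      ksgn (s₄ β γ δ ζ) • τ.coord α (W.jac₄ (τ β) (τ γ) (τ δ) (τ ζ)) • m₄ 0 0 0 β γ δ ζ))

/-- The coefficient function of the generators with values in `E`. -/
noncomputable def letters : Wd ι → E
  | .w a => τ a
  | _ => 0

/-- The coefficient function of the dual differential on generators, with values in `E`. -/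
noncomputable def ceFun : Wd ι → E
  | .w a => -(ksgn (e a) • W.d (τ a))
  | .w0 a b => -(pairSign (e a) (e b) • W.br (τ a) (τ b))
  | .w1 a b => -(pairSignOdd (e a) (e b) • W.alt (τ a) (τ b))
  | .w2 a b => -(pairSign (e a) (e b) • W.alt₂ (τ a) (τ b))
  | .w00 a b c => -((tripleSignOdd (e a + e b) (e c) * pairSign (e a) (e b)) •
      W.jac (τ a) (τ b) (τ c))
  | .w10 a b c => -((tripleSign 0 (e a + e b) (e c) * pairSign (e a) (e b)) •
      W.jacL (τ a) (τ b) (τ c))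
  | .w01 a b c => -((tripleSign 0 (e a + e b) (e c) * pairSign (e a) (e b)) •
      W.jacR (τ a) (τ b) (τ c))
  | .w000 a b c d => -((quadSign (e a + e b + e c) (e d) *
      (tripleSign 0 (e a + e b) (e c) * pairSign (e a) (e b))) • W.jac₄ (τ a) (τ b) (τ c) (τ d))
  | _ => 0

variable [Fintype ι]

theorem fam_gen : fam (gen K e) τ = letters τ := by
  classical
  funext w
  rw [fam_apply]
  cases w <;> simp [coeff_gen, genFun, letters, Finset.sum_ite_eq]

variable {e}

/-- Since `∑ τ.coord α y • τ α = y`, pairing with the basis turns structure constants back into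
values of the operation. -/
theorem fam_sum_coord {κ : Type*} [Fintype κ] (s : κ → ℤ) (y : κ → E) (z : κ → Eilh K e)
    (L : Eilh K e →ₗ[K] Eilh K e) :
    fam (fun α => L (∑ k, s k • τ.coord α (y k) • z k)) τ =
      fam (fun k => L (z k)) (fun k => s k • y k) := by
  funext w
  simp only [fam_apply, map_sum, map_zsmul, map_smul, Finset.sum_apply, Pi.smul_apply,
    Finset.sum_smul]
  rw [Finset.sum_comm]
  refine Finset.sum_congr rfl fun k _ => ?_
  conv_rhs => rw [← τ.sum_repr (y k)]
  rw [Finset.smul_sum, Finset.smul_sum]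
  refine Finset.sum_congr rfl fun α _ => ?_
  simp only [← Int.cast_smul_eq_zsmul K, smul_smul, smul_eq_mul, Module.Basis.coord_apply]
  congr 1; ring

/-- The sign of each operation is factored into one sign per appended letter. This follows the
nesting of the monomials, so that `fam_mul` and `fam_leibniz` can be applied one product at a time.
-/
theorem ceGen_prod (α : ι) : W.ceGen τ e α =
    -((∑ β, ksgn (e β) • τ.coord α (W.d (τ β)) • gen K e β)
    + (∑ k : ι × ι, pairSign (e k.1) (e k.2) • τ.coord α (W.br (τ k.1) (τ k.2)) •
        mul e 0 (gen K e k.1) (gen K e k.2))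
    + (∑ k : ι × ι, pairSignOdd (e k.1) (e k.2) • τ.coord α (W.alt (τ k.1) (τ k.2)) •
        mul e 1 (gen K e k.1) (gen K e k.2))
    + (∑ k : ι × ι, pairSign (e k.1) (e k.2) • τ.coord α (W.alt₂ (τ k.1) (τ k.2)) •
        mul e 2 (gen K e k.1) (gen K e k.2))
    + (∑ k : (ι × ι) × ι, (tripleSignOdd (e k.1.1 + e k.1.2) (e k.2) *
        pairSign (e k.1.1) (e k.1.2)) • τ.coord α (W.jac (τ k.1.1) (τ k.1.2) (τ k.2)) •
        mul e 0 (mul e 0 (gen K e k.1.1) (gen K e k.1.2)) (gen K e k.2))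
    + (∑ k : (ι × ι) × ι, (tripleSign 0 (e k.1.1 + e k.1.2) (e k.2) *
        pairSign (e k.1.1) (e k.1.2)) • τ.coord α (W.jacL (τ k.1.1) (τ k.1.2) (τ k.2)) •
        mul e 0 (mul e 1 (gen K e k.1.1) (gen K e k.1.2)) (gen K e k.2))
    + (∑ k : (ι × ι) × ι, (tripleSign 0 (e k.1.1 + e k.1.2) (e k.2) *
        pairSign (e k.1.1) (e k.1.2)) • τ.coord α (W.jacR (τ k.1.1) (τ k.1.2) (τ k.2)) •
        mul e 1 (mul e 0 (gen K e k.1.1) (gen K e k.1.2)) (gen K e k.2))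
    + (∑ k : ((ι × ι) × ι) × ι, (quadSign (e k.1.1.1 + e k.1.1.2 + e k.1.2) (e k.2) *
        (tripleSign 0 (e k.1.1.1 + e k.1.1.2) (e k.1.2) * pairSign (e k.1.1.1) (e k.1.1.2))) •
        τ.coord α (W.jac₄ (τ k.1.1.1) (τ k.1.1.2) (τ k.1.2) (τ k.2)) •
        mul e 0 (mul e 0 (mul e 0 (gen K e k.1.1.1) (gen K e k.1.1.2)) (gen K e k.1.2))
          (gen K e k.2))) := by
  simp only [ceGen, Fintype.sum_prod_type, Finset.sum_add_distrib, pairSign, pairSignOdd, quadSign,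
    tripleSign, tripleSignOdd, ← ksgn_add, sub_zero]
  have h1 (a b c : ι) : ksgn (e a + e b + e c + e c * (e a + e b - 2) + e b * (e a - 1)) =
      ksgn (e a + e b + e c + (e b * (e a - 1) + e c * (e a + e b - 2))) := by congr 1; ring
  have h2 (a b c : ι) : ksgn (e c * (e a + e b - 2) + e b * (e a - 1)) =
      ksgn (e b * (e a - 1) + e c * (e a + e b - 2)) := by congr 1; ring
  have h3 (a b c d : ι) : ksgn (e d * (e a + e b + e c - 3) + (e c * (e a + e b - 2) +
      e b * (e a - 1))) = ksgn (e b * (e a - 1) + e c * (e a + e b - 2) +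
      e d * (e a + e b + e c - 3)) := by congr 1; ring
  simp only [h1, h2, h3]
  abel

variable (e) in
/-- The coefficients of a linear map applied to the dual differential. -/
theorem fam_ceGen (L : Eilh K e →ₗ[K] Eilh K e) :
    fam (fun α => L (W.ceGen τ e α)) τ =
    -(fam (fun β => L (gen K e β)) (fun β => ksgn (e β) • W.d (τ β))
    + fam (fun k : ι × ι => L (mul e 0 (gen K e k.1) (gen K e k.2)))
        (fun k => pairSign (e k.1) (e k.2) • W.br (τ k.1) (τ k.2))
    + fam (fun k : ι × ι => L (mul e 1 (gen K e k.1) (gen K e k.2)))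
        (fun k => pairSignOdd (e k.1) (e k.2) • W.alt (τ k.1) (τ k.2))
    + fam (fun k : ι × ι => L (mul e 2 (gen K e k.1) (gen K e k.2)))
        (fun k => pairSign (e k.1) (e k.2) • W.alt₂ (τ k.1) (τ k.2))
    + fam (fun k : (ι × ι) × ι =>
          L (mul e 0 (mul e 0 (gen K e k.1.1) (gen K e k.1.2)) (gen K e k.2)))
        (fun k => (tripleSignOdd (e k.1.1 + e k.1.2) (e k.2) * pairSign (e k.1.1) (e k.1.2)) •
          W.jac (τ k.1.1) (τ k.1.2) (τ k.2))
    + fam (fun k : (ι × ι) × ι =>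
          L (mul e 0 (mul e 1 (gen K e k.1.1) (gen K e k.1.2)) (gen K e k.2)))
        (fun k => (tripleSign 0 (e k.1.1 + e k.1.2) (e k.2) * pairSign (e k.1.1) (e k.1.2)) •
          W.jacL (τ k.1.1) (τ k.1.2) (τ k.2))
    + fam (fun k : (ι × ι) × ι =>
          L (mul e 1 (mul e 0 (gen K e k.1.1) (gen K e k.1.2)) (gen K e k.2)))
        (fun k => (tripleSign 0 (e k.1.1 + e k.1.2) (e k.2) * pairSign (e k.1.1) (e k.1.2)) •
          W.jacR (τ k.1.1) (τ k.1.2) (τ k.2))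
    + fam (fun k : ((ι × ι) × ι) × ι =>
          L (mul e 0 (mul e 0 (mul e 0 (gen K e k.1.1.1) (gen K e k.1.1.2)) (gen K e k.1.2))
            (gen K e k.2)))
        (fun k => (quadSign (e k.1.1.1 + e k.1.1.2 + e k.1.2) (e k.2) *
          (tripleSign 0 (e k.1.1.1 + e k.1.1.2) (e k.1.2) * pairSign (e k.1.1.1) (e k.1.1.2))) •
          W.jac₄ (τ k.1.1.1) (τ k.1.1.2) (τ k.1.2) (τ k.2))) := by
  have neg (X : ι → Eilh K e) : fam (fun α => -X α) τ = -fam X τ := by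
    funext w
    simp [fam_apply]
  simp only [ceGen_prod, map_neg, map_add, neg, fam_add]
  congr 1
  congr 1
  · congr 1
    · congr 1
      · congr 1
        · congr 1
          · congr 1
            · congr 1
              · exact fam_sum_coord τ _ _ _ L
              · exact fam_sum_coord τ _ _ _ L
            · exact fam_sum_coord τ _ _ _ L
          · exact fam_sum_coord τ _ _ _ L
        · exact fam_sum_coord τ _ _ _ L
      · exact fam_sum_coord τ _ _ _ L
    · exact fam_sum_coord τ _ _ _ L
  · exact fam_sum_coord τ _ _ _ L

end LieThreeOps

/-! ### Coefficients of the dual differential and of its square. -/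

namespace LieThreeOps

open Eilh

variable {K E ι : Type*} [Field K] [AddCommGroup E] [Module K E] [Fintype ι]
  {ℳ : ℤ → Submodule K E} (W : LieThreeOps ℳ) (τ : Module.Basis ι K E) {e : ι → ℤ}

theorem gen_mul_gen_mem (i : ℕ) (k : ι × ι) :
    mul e i (gen K e k.1) (gen K e k.2) ∈ homog K e (e k.1 + e k.2 + i) :=
  mul_mem_homog i (gen_mem_homog k.1) (gen_mem_homog k.2)

theorem gen_mul_gen_mul_gen_mem (k : (ι × ι) × ι) :
    mul e 0 (mul e 0 (gen K e k.1.1) (gen K e k.1.2)) (gen K e k.2) ∈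
      homog K e (e k.1.1 + e k.1.2 + e k.2) := by
  simpa using mul_mem_homog 0 (gen_mul_gen_mem 0 k.1) (gen_mem_homog k.2)

variable {A : Type*} [AddCommGroup A] [Module K A]

theorem fam_pair (S : ℤ → ℤ → ℤ) (f : E →ₗ[K] E →ₗ[K] A) (i : ℕ) :
    fam (fun k : ι × ι => mul e i (gen K e k.1) (gen K e k.2))
      (fun k => S (e k.1) (e k.2) • f (τ k.1) (τ k.2)) =
    wmul e S f i (letters τ) (letters τ) := by
  have := fam_mul (K := K) (e := e) (m := e) (n := e) 0 0
    (fun k => by simpa using gen_mem_homog k) (fun k => by simpa using gen_mem_homog k) τ τ S f i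
  simpa [fam_gen] using this

/-- A partially applied operation is a function with values in `E →ₗ[K] A`, and `LinearMap.id`, read
as a bilinear map, evaluates it at the next letter. The shift `p - i` appears because the inner
product has degree `e a + e b + i`, while the sign uses `e a + e b`. -/
theorem fam_triple (i j : ℕ) (S : ℤ → ℤ → ℤ) (f : E →ₗ[K] E →ₗ[K] E →ₗ[K] A) :
    fam (fun k : (ι × ι) × ι => mul e j (mul e i (gen K e k.1.1) (gen K e k.1.2)) (gen K e k.2))
      (fun k => (S (e k.1.1 + e k.1.2) (e k.2) * pairSign (e k.1.1) (e k.1.2)) •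
        f (τ k.1.1) (τ k.1.2) (τ k.2)) =
    wmul e (fun p q => S (p - i) q) LinearMap.id j
      (wmul e pairSign f i (letters τ) (letters τ)) (letters τ) := by
  have := fam_mul (K := K) (e := e) (n := e) 0 0
    (fun k => by simpa using gen_mul_gen_mem i k) (fun k => by simpa using gen_mem_homog k)
    (fun k : ι × ι => pairSign (e k.1) (e k.2) • f (τ k.1) (τ k.2)) τ
    (fun p q => S (p - i) q) LinearMap.id j
  simpa [fam_gen, fam_pair, smul_smul] using this

theorem fam_quad (f : E →ₗ[K] E →ₗ[K] E →ₗ[K] E →ₗ[K] A) :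
    fam (fun k : ((ι × ι) × ι) × ι =>
        mul e 0 (mul e 0 (mul e 0 (gen K e k.1.1.1) (gen K e k.1.1.2)) (gen K e k.1.2))
          (gen K e k.2))
      (fun k => (quadSign (e k.1.1.1 + e k.1.1.2 + e k.1.2) (e k.2) *
        (tripleSign 0 (e k.1.1.1 + e k.1.1.2) (e k.1.2) * pairSign (e k.1.1.1) (e k.1.1.2))) •
        f (τ k.1.1.1) (τ k.1.1.2) (τ k.1.2) (τ k.2)) =
    wmul e quadSign LinearMap.id 0 (wmul e (tripleSign 0) LinearMap.id 0
      (wmul e pairSign f 0 (letters τ) (letters τ)) (letters τ)) (letters τ) := by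
  have := fam_mul (K := K) (e := e) (n := e) 0 0
    (fun k => by simpa using gen_mul_gen_mul_gen_mem k) (fun k => by simpa using gen_mem_homog k)
    (fun k : (ι × ι) × ι => (tripleSign 0 (e k.1.1 + e k.1.2) (e k.2) *
      pairSign (e k.1.1) (e k.1.2)) • f (τ k.1.1) (τ k.1.2) (τ k.2)) τ
    quadSign LinearMap.id 0
  have h := fam_triple τ (e := e) 0 0 (tripleSign 0) f
  simp only [Nat.cast_zero, sub_zero] at h
  simpa [fam_gen, h, smul_smul] using this

-- As `letters` is supported on single letters, only the splitting that removes one letter at a time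
-- from the right survives. Each shape of word thus meets at most one operation.
variable (e) in
set_option maxHeartbeats 2000000 in
theorem fam_ceGen_eq_ceFun : fam (W.ceGen τ e) τ = W.ceFun τ e := by
  have h := W.fam_ceGen τ e LinearMap.id
  have hu : fam (fun β => gen K e β) (fun β => ksgn (e β) • W.d (τ β)) =
      fun w => ksgn (w.deg e) • W.d (letters τ w) := by
    classical
    funext w
    rw [fam_apply]
    cases w <;> simp [coeff_gen, genFun, letters, Finset.sum_ite_eq, Wd.deg]
  simp only [LinearMap.id_apply, fam_pair, fam_triple, fam_quad, hu] at h
  rw [h]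
  funext w
  cases w <;>
    simp only [Pi.add_apply, Pi.neg_apply, wmul, Wd.split]
  all_goals simp only [Wd.split₀, Wd.split₁, Wd.split₂]
  all_goals simp only [List.map_cons, List.map_nil, List.sum_cons, List.sum_nil, wmul, Wd.split,
    Wd.split₀, Wd.split₁, Wd.split₂]
  all_goals simp only [ceFun, letters]
  all_goals simp [Wd.deg, smul_smul]
  rw [mul_comm (pairSign _ _)]

theorem fam_leibniz_pair {Q : Eilh K e →ₗ[K] Eilh K e} (hQ : IsLeibniz Q)
    (hdeg : ∀ (p : ℤ), ∀ x ∈ homog K e p, Q x ∈ homog K e (p + 1))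
    (S : ℤ → ℤ → ℤ) (f : E →ₗ[K] E →ₗ[K] A) (i : ℕ) :
    fam (fun k : ι × ι => Q (mul e i (gen K e k.1) (gen K e k.2)))
      (fun k => S (e k.1) (e k.2) • f (τ k.1) (τ k.2)) =
    leib e S f i (letters τ) (fam (fun α => Q (gen K e α)) τ) (letters τ)
      (fam (fun α => Q (gen K e α)) τ) := by
  have := fam_leibniz hQ hdeg (m := e) (n := e) gen_mem_homog gen_mem_homog τ τ S f i
  simpa [fam_gen] using this

theorem fam_leibniz_triple {Q : Eilh K e →ₗ[K] Eilh K e} (hQ : IsLeibniz Q)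
    (hdeg : ∀ (p : ℤ), ∀ x ∈ homog K e p, Q x ∈ homog K e (p + 1))
    (i j : ℕ) (S : ℤ → ℤ → ℤ) (f : E →ₗ[K] E →ₗ[K] E →ₗ[K] A) :
    fam (fun k : (ι × ι) × ι =>
        Q (mul e j (mul e i (gen K e k.1.1) (gen K e k.1.2)) (gen K e k.2)))
      (fun k => (S (e k.1.1 + e k.1.2) (e k.2) * pairSign (e k.1.1) (e k.1.2)) •
        f (τ k.1.1) (τ k.1.2) (τ k.2)) =
    leib e (fun p q => S (p - i) q) LinearMap.id j
      (wmul e pairSign f i (letters τ) (letters τ))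
      (leib e pairSign f i (letters τ) (fam (fun α => Q (gen K e α)) τ) (letters τ)
        (fam (fun α => Q (gen K e α)) τ)) (letters τ) (fam (fun α => Q (gen K e α)) τ) := by
  have := fam_leibniz hQ hdeg (n := e) (gen_mul_gen_mem i) gen_mem_homog
    (fun k : ι × ι => pairSign (e k.1) (e k.2) • f (τ k.1) (τ k.2)) τ
    (fun p q => S (p - i) q) LinearMap.id j
  simpa [fam_gen, fam_pair, fam_leibniz_pair τ hQ hdeg, smul_smul] using this

theorem fam_leibniz_quad {Q : Eilh K e →ₗ[K] Eilh K e} (hQ : IsLeibniz Q)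
    (hdeg : ∀ (p : ℤ), ∀ x ∈ homog K e p, Q x ∈ homog K e (p + 1))
    (f : E →ₗ[K] E →ₗ[K] E →ₗ[K] E →ₗ[K] A) :
    fam (fun k : ((ι × ι) × ι) × ι =>
        Q (mul e 0 (mul e 0 (mul e 0 (gen K e k.1.1.1) (gen K e k.1.1.2)) (gen K e k.1.2))
          (gen K e k.2)))
      (fun k => (quadSign (e k.1.1.1 + e k.1.1.2 + e k.1.2) (e k.2) *
        (tripleSign 0 (e k.1.1.1 + e k.1.1.2) (e k.1.2) * pairSign (e k.1.1.1) (e k.1.1.2))) •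
        f (τ k.1.1.1) (τ k.1.1.2) (τ k.1.2) (τ k.2)) =
    leib e quadSign LinearMap.id 0
      (wmul e (tripleSign 0) LinearMap.id 0 (wmul e pairSign f 0 (letters τ) (letters τ))
        (letters τ))
      (leib e (tripleSign 0) LinearMap.id 0 (wmul e pairSign f 0 (letters τ) (letters τ))
        (leib e pairSign f 0 (letters τ) (fam (fun α => Q (gen K e α)) τ) (letters τ)
          (fam (fun α => Q (gen K e α)) τ)) (letters τ) (fam (fun α => Q (gen K e α)) τ))
      (letters τ) (fam (fun α => Q (gen K e α)) τ) := by
  have := fam_leibniz hQ hdeg (n := e) gen_mul_gen_mul_gen_mem gen_mem_homog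
    (fun k : (ι × ι) × ι => (tripleSign 0 (e k.1.1 + e k.1.2) (e k.2) *
      pairSign (e k.1.1) (e k.1.2)) • f (τ k.1.1) (τ k.1.2) (τ k.2)) τ
    quadSign LinearMap.id 0
  have h := fam_triple τ (e := e) 0 0 (tripleSign 0) f
  have h' := fam_leibniz_triple τ hQ hdeg 0 0 (tripleSign 0) f
  simp only [Nat.cast_zero, sub_zero] at h h'
  simpa [fam_gen, h, h', smul_smul] using this

/-- The coefficient function of the square of the differential on generators, with values in
`E`. -/
noncomputable def sqFun (e : ι → ℤ) : Wd ι → E :=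
  -((fun w => ksgn (w.deg e - 1) • W.d (W.ceFun τ e w))
    + leib e pairSign W.br 0 (letters τ) (W.ceFun τ e) (letters τ) (W.ceFun τ e)
    + leib e pairSignOdd W.alt 1 (letters τ) (W.ceFun τ e) (letters τ) (W.ceFun τ e)
    + leib e pairSign W.alt₂ 2 (letters τ) (W.ceFun τ e) (letters τ) (W.ceFun τ e)
    + leib e tripleSignOdd LinearMap.id 0 (wmul e pairSign W.jac 0 (letters τ) (letters τ))
        (leib e pairSign W.jac 0 (letters τ) (W.ceFun τ e) (letters τ) (W.ceFun τ e))
        (letters τ) (W.ceFun τ e)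
    + leib e (fun p q => tripleSign 0 (p - 1) q) LinearMap.id 0
        (wmul e pairSign W.jacL 1 (letters τ) (letters τ))
        (leib e pairSign W.jacL 1 (letters τ) (W.ceFun τ e) (letters τ) (W.ceFun τ e))
        (letters τ) (W.ceFun τ e)
    + leib e (tripleSign 0) LinearMap.id 1 (wmul e pairSign W.jacR 0 (letters τ) (letters τ))
        (leib e pairSign W.jacR 0 (letters τ) (W.ceFun τ e) (letters τ) (W.ceFun τ e))
        (letters τ) (W.ceFun τ e)
    + leib e quadSign LinearMap.id 0
        (wmul e (tripleSign 0) LinearMap.id 0 (wmul e pairSign W.jac₄ 0 (letters τ) (letters τ))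
          (letters τ))
        (leib e (tripleSign 0) LinearMap.id 0
          (wmul e pairSign W.jac₄ 0 (letters τ) (letters τ))
          (leib e pairSign W.jac₄ 0 (letters τ) (W.ceFun τ e) (letters τ) (W.ceFun τ e))
          (letters τ) (W.ceFun τ e))
        (letters τ) (W.ceFun τ e))

theorem fam_sq {Q : Eilh K e →ₗ[K] Eilh K e} (hQ : IsLeibniz Q)
    (hdeg : ∀ (p : ℤ), ∀ x ∈ homog K e p, Q x ∈ homog K e (p + 1))
    (hgen : ∀ α, Q (gen K e α) = W.ceGen τ e α) :
    fam (fun α => Q (Q (gen K e α))) τ = W.sqFun τ e := by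
  have h := W.fam_ceGen τ e Q
  have hD : fam (fun α => Q (gen K e α)) τ = W.ceFun τ e := by
    rw [← W.fam_ceGen_eq_ceFun τ e]
    exact congrArg (fun X => fam X τ) (funext hgen)
  -- The sign in the summand for `β` depends on `β`. But `Q t^β` is homogeneous of degree `e β + 1`,
  -- so a nonzero coefficient at `w` forces `e β = w.deg e - 1`, and the sign can be taken out of
  -- the sum.
  have hu : fam (fun β => Q (gen K e β)) (fun β => ksgn (e β) • W.d (τ β)) =
      fun w => ksgn (w.deg e - 1) • W.d (W.ceFun τ e w) := by
    funext w
    rw [← hD, fam_apply, fam_apply, map_sum, Finset.smul_sum]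
    refine Finset.sum_congr rfl fun k _ => ?_
    rw [map_smul]
    by_cases h0 : coeff e (Q (gen K e k)) w = 0
    · simp [h0]
    · rw [isHomog_coeff (hdeg _ _ (gen_mem_homog k)) w h0, add_sub_cancel_right, smul_comm]
  simp only [hu, fam_leibniz_pair τ hQ hdeg, fam_leibniz_triple τ hQ hdeg,
    fam_leibniz_quad τ hQ hdeg, hD, Nat.cast_zero, sub_zero, Nat.cast_one] at h
  simp only [hgen]
  exact h

end LieThreeOps

/-! ### The square of the differential at words of weight five. -/

namespace LieThreeOps
open Eilh
variable {K E ι : Type*} [Field K] [AddCommGroup E] [Module K E]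
  {ℳ : ℤ → Submodule K E} (W : LieThreeOps ℳ) (τ : Module.Basis ι K E) {e : ι → ℤ}

-- For the eight shapes of weight five only letters of degree one matter: with any letter of higher
-- degree the word has degree above five, which the square of the differential on a generator does
-- not reach. All signs are then numerical and are evaluated by `decide`.
set_option maxHeartbeats 4000000 in
theorem sqFun_w3 {a b : ι} (ha : e a = 1) (hb : e b = 1) :
    W.sqFun τ e (.w3 a b) =
      -(W.alt₂ (τ a) (τ b) + W.alt₂ (τ b) (τ a)) := by
  simp only [sqFun, leib, Pi.add_apply, Pi.neg_apply, Pi.sub_apply, Pi.smul_apply]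
  simp only [wmul, Wd.split]
  simp only [Wd.split₀, Wd.split₁, Wd.split₂, Wd.split₃]
  simp only [List.map_cons, List.map_nil, List.sum_cons, List.sum_nil, leib, Pi.add_apply,
    Pi.sub_apply, Pi.smul_apply, wmul, Wd.split, Wd.split₀, Wd.split₁, Wd.split₂, Wd.split₃]
  simp only [ceFun, letters]
  simp only [map_zero, LinearMap.zero_apply, smul_zero, add_zero, zero_add, neg_zero, sub_zero,
    LinearMap.id_apply, LinearMap.flip_apply, Wd.deg, ha, hb]
  simp (disch := decide) only [pairSign, pairSignOdd, tripleSign, tripleSignOdd, quadSign,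
    ksgn_even,
    ksgn_odd, map_neg, map_add, map_sub, map_zsmul, map_smul, LinearMap.neg_apply,
    LinearMap.add_apply, LinearMap.sub_apply, LinearMap.smul_apply]
  module

set_option maxHeartbeats 4000000 in
theorem sqFun_w20 {a b c : ι} (ha : e a = 1) (hb : e b = 1) (hc : e c = 1) :
    W.sqFun τ e (.w20 a b c) =
      W.jacL (τ a) (τ b) (τ c) - W.jacL (τ b) (τ a) (τ c) + W.br (W.alt₂ (τ a) (τ b)) (τ c) := by
  simp only [sqFun, leib, Pi.add_apply, Pi.neg_apply, Pi.sub_apply, Pi.smul_apply]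
  simp only [wmul, Wd.split]
  simp only [Wd.split₀, Wd.split₁, Wd.split₂, Wd.split₃]
  simp only [List.map_cons, List.map_nil, List.sum_cons, List.sum_nil, leib, Pi.add_apply,
    Pi.sub_apply, Pi.smul_apply, wmul, Wd.split, Wd.split₀, Wd.split₁, Wd.split₂, Wd.split₃]
  simp only [ceFun, letters]
  simp only [map_zero, LinearMap.zero_apply, smul_zero, add_zero, zero_add, neg_zero, sub_zero,
    LinearMap.id_apply, LinearMap.flip_apply, Wd.deg, ha, hb, hc]
  simp (disch := decide) only [pairSign, pairSignOdd, tripleSign, tripleSignOdd, quadSign,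
    ksgn_even,
    ksgn_odd, map_neg, map_add, map_sub, map_zsmul, map_smul, LinearMap.neg_apply,
    LinearMap.add_apply, LinearMap.sub_apply, LinearMap.smul_apply]
  module

set_option maxHeartbeats 4000000 in
theorem sqFun_w02 {a b c : ι} (ha : e a = 1) (hb : e b = 1) (hc : e c = 1) :
    W.sqFun τ e (.w02 a b c) =
      W.jacR (τ a) (τ b) (τ c) - W.jacR (τ a) (τ c) (τ b) + W.alt₂ (W.br (τ a) (τ b)) (τ c) +
      W.alt₂ (τ b) (W.br (τ a) (τ c)) - W.br (τ a) (W.alt₂ (τ b) (τ c)) := by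
  simp only [sqFun, leib, Pi.add_apply, Pi.neg_apply, Pi.sub_apply, Pi.smul_apply]
  simp only [wmul, Wd.split]
  simp only [Wd.split₀, Wd.split₁, Wd.split₂, Wd.split₃]
  simp only [List.map_cons, List.map_nil, List.sum_cons, List.sum_nil, leib, Pi.add_apply,
    Pi.sub_apply, Pi.smul_apply, wmul, Wd.split, Wd.split₀, Wd.split₁, Wd.split₂, Wd.split₃]
  simp only [ceFun, letters]
  simp only [map_zero, LinearMap.zero_apply, smul_zero, add_zero, zero_add, neg_zero, sub_zero,
    LinearMap.id_apply, LinearMap.flip_apply, Wd.deg, ha, hb, hc]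
  simp (disch := decide) only [pairSign, pairSignOdd, tripleSign, tripleSignOdd, quadSign,
    ksgn_even,
    ksgn_odd, map_neg, map_add, map_sub, map_zsmul, map_smul, LinearMap.neg_apply,
    LinearMap.add_apply, LinearMap.sub_apply, LinearMap.smul_apply]
  module

-- The last summand comes from the extra term in the normal form of `x ⊘₂ (y ⊘₀ z)`, recorded as the
-- only `⊘₂`-splitting of this shape.
set_option maxHeartbeats 4000000 in
theorem sqFun_w11 {a b c : ι} (ha : e a = 1) (hb : e b = 1) (hc : e c = 1) :
    W.sqFun τ e (.w11 a b c) =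
      W.jacR (τ a) (τ b) (τ c) + W.jacR (τ b) (τ a) (τ c) + W.jacR (τ c) (τ a) (τ b) -
      W.jacL (τ a) (τ b) (τ c) - W.jacL (τ a) (τ c) (τ b) - W.jacL (τ b) (τ c) (τ a) -
      W.alt (W.alt (τ a) (τ b)) (τ c) - W.alt (τ a) (W.alt (τ b) (τ c)) -
      W.alt (τ b) (W.alt (τ a) (τ c)) - W.alt₂ (τ b) (W.br (τ c) (τ a)) := by
  simp only [sqFun, leib, Pi.add_apply, Pi.neg_apply, Pi.sub_apply, Pi.smul_apply]
  simp only [wmul, Wd.split]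
  simp only [Wd.split₀, Wd.split₁, Wd.split₂, Wd.split₃]
  simp only [List.map_cons, List.map_nil, List.sum_cons, List.sum_nil, leib, Pi.add_apply,
    Pi.sub_apply, Pi.smul_apply, wmul, Wd.split, Wd.split₀, Wd.split₁, Wd.split₂, Wd.split₃]
  simp only [ceFun, letters]
  simp only [map_zero, LinearMap.zero_apply, smul_zero, add_zero, zero_add, neg_zero, sub_zero,
    LinearMap.id_apply, LinearMap.flip_apply, Wd.deg, ha, hb, hc]
  simp (disch := decide) only [pairSign, pairSignOdd, tripleSign, tripleSignOdd, quadSign,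
    ksgn_even,
    ksgn_odd, map_neg, map_add, map_sub, map_zsmul, map_smul, LinearMap.neg_apply,
    LinearMap.add_apply, LinearMap.sub_apply, LinearMap.smul_apply]
  module

set_option maxHeartbeats 4000000 in
theorem sqFun_w100 {a b c d : ι} (ha : e a = 1) (hb : e b = 1) (hc : e c = 1) (hd : e d = 1) :
    W.sqFun τ e (.w100 a b c d) =
      -(W.jac₄ (τ a) (τ b) (τ c) (τ d) + W.jac₄ (τ b) (τ a) (τ c) (τ d) -
      (W.jac (W.alt (τ a) (τ b)) (τ c) (τ d) + W.br (W.jacL (τ a) (τ b) (τ c)) (τ d) +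
        W.br (τ c) (W.jacL (τ a) (τ b) (τ d)) - W.jacL (τ a) (τ b) (W.br (τ c) (τ d)))) := by
  simp only [sqFun, leib, Pi.add_apply, Pi.neg_apply, Pi.sub_apply, Pi.smul_apply]
  simp only [wmul, Wd.split]
  simp only [Wd.split₀, Wd.split₁, Wd.split₂, Wd.split₃]
  simp only [List.map_cons, List.map_nil, List.sum_cons, List.sum_nil, leib, Pi.add_apply,
    Pi.sub_apply, Pi.smul_apply, wmul, Wd.split, Wd.split₀, Wd.split₁, Wd.split₂, Wd.split₃]
  simp only [ceFun, letters]
  simp only [map_zero, LinearMap.zero_apply, smul_zero, add_zero, zero_add, neg_zero, sub_zero,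
    LinearMap.id_apply, LinearMap.flip_apply, Wd.deg, ha, hb, hc, hd]
  simp (disch := decide) only [pairSign, pairSignOdd, tripleSign, tripleSignOdd, quadSign,
    ksgn_even,
    ksgn_odd, map_neg, map_add, map_sub, map_zsmul, map_smul, LinearMap.neg_apply,
    LinearMap.add_apply, LinearMap.sub_apply, LinearMap.smul_apply]
  module

set_option maxHeartbeats 4000000 in
theorem sqFun_w010 {a b c d : ι} (ha : e a = 1) (hb : e b = 1) (hc : e c = 1) (hd : e d = 1) :
    W.sqFun τ e (.w010 a b c d) =
      -(W.jac₄ (τ a) (τ b) (τ c) (τ d) + W.jac₄ (τ a) (τ c) (τ b) (τ d) -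
      (W.br (W.jacR (τ a) (τ b) (τ c)) (τ d) + W.br (τ a) (W.jacL (τ b) (τ c) (τ d)) -
        W.jac (τ a) (W.alt (τ b) (τ c)) (τ d) - W.jacL (W.br (τ a) (τ b)) (τ c) (τ d) -
        W.jacL (τ b) (W.br (τ a) (τ c)) (τ d) - W.jacL (τ b) (τ c) (W.br (τ a) (τ d)))) := by
  simp only [sqFun, leib, Pi.add_apply, Pi.neg_apply, Pi.sub_apply, Pi.smul_apply]
  simp only [wmul, Wd.split]
  simp only [Wd.split₀, Wd.split₁, Wd.split₂, Wd.split₃]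
  simp only [List.map_cons, List.map_nil, List.sum_cons, List.sum_nil, leib, Pi.add_apply,
    Pi.sub_apply, Pi.smul_apply, wmul, Wd.split, Wd.split₀, Wd.split₁, Wd.split₂, Wd.split₃]
  simp only [ceFun, letters]
  simp only [map_zero, LinearMap.zero_apply, smul_zero, add_zero, zero_add, neg_zero, sub_zero,
    LinearMap.id_apply, LinearMap.flip_apply, Wd.deg, ha, hb, hc, hd]
  simp (disch := decide) only [pairSign, pairSignOdd, tripleSign, tripleSignOdd, quadSign,
    ksgn_even,
    ksgn_odd, map_neg, map_add, map_sub, map_zsmul, map_smul, LinearMap.neg_apply,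
    LinearMap.add_apply, LinearMap.sub_apply, LinearMap.smul_apply]
  module

set_option maxHeartbeats 4000000 in
theorem sqFun_w001 {a b c d : ι} (ha : e a = 1) (hb : e b = 1) (hc : e c = 1) (hd : e d = 1) :
    W.sqFun τ e (.w001 a b c d) =
      -(W.jac₄ (τ a) (τ b) (τ c) (τ d) + W.jac₄ (τ a) (τ b) (τ d) (τ c) -
      (W.alt (W.jac (τ a) (τ b) (τ c)) (τ d) + W.alt (τ c) (W.jac (τ a) (τ b) (τ d)) +
        W.jac (τ a) (τ b) (W.alt (τ c) (τ d)) + W.br (τ a) (W.jacR (τ b) (τ c) (τ d)) -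
        W.br (τ b) (W.jacR (τ a) (τ c) (τ d)) - W.jacR (W.br (τ a) (τ b)) (τ c) (τ d) +
        W.jacR (τ a) (W.br (τ b) (τ c)) (τ d) - W.jacR (τ b) (W.br (τ a) (τ c)) (τ d) +
        W.jacR (τ a) (τ c) (W.br (τ b) (τ d)) - W.jacR (τ b) (τ c) (W.br (τ a) (τ d)))) := by
  simp only [sqFun, leib, Pi.add_apply, Pi.neg_apply, Pi.sub_apply, Pi.smul_apply]
  simp only [wmul, Wd.split]
  simp only [Wd.split₀, Wd.split₁, Wd.split₂, Wd.split₃]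
  simp only [List.map_cons, List.map_nil, List.sum_cons, List.sum_nil, leib, Pi.add_apply,
    Pi.sub_apply, Pi.smul_apply, wmul, Wd.split, Wd.split₀, Wd.split₁, Wd.split₂, Wd.split₃]
  simp only [ceFun, letters]
  simp only [map_zero, LinearMap.zero_apply, smul_zero, add_zero, zero_add, neg_zero, sub_zero,
    LinearMap.id_apply, LinearMap.flip_apply, Wd.deg, ha, hb, hc, hd]
  simp (disch := decide) only [pairSign, pairSignOdd, tripleSign, tripleSignOdd, quadSign,
    ksgn_even,
    ksgn_odd, map_neg, map_add, map_sub, map_zsmul, map_smul, LinearMap.neg_apply,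
    LinearMap.add_apply, LinearMap.sub_apply, LinearMap.smul_apply]
  module

-- Products add indices, so a word with all indices zero sees only `br`, `jac` and `jac₄`. With five
-- letters the contributions are a bracket with a `jac₄` inside, a `jac₄` with a bracket inside, or
-- a `jac` inside a `jac`.
set_option maxHeartbeats 4000000 in
theorem sqFun_w0000 {a b c d f : ι} (ha : e a = 1) (hb : e b = 1) (hc : e c = 1) (hd : e d = 1) (hf
  : e f = 1) :
    W.sqFun τ e (.w0000 a b c d f) =
      W.br (W.jac₄ (τ a) (τ b) (τ c) (τ d)) (τ f) - W.br (τ a) (W.jac₄ (τ b) (τ c) (τ d) (τ f))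
        + W.br (τ b) (W.jac₄ (τ a) (τ c) (τ d) (τ f)) - W.br (τ c) (W.jac₄ (τ a) (τ b) (τ d) (τ f))
      + W.br (τ d) (W.jac₄ (τ a) (τ b) (τ c) (τ f))
      + W.jac₄ (W.br (τ a) (τ b)) (τ c) (τ d) (τ f) - W.jac₄ (τ a) (W.br (τ b) (τ c)) (τ d) (τ f)
        + W.jac₄ (τ b) (W.br (τ a) (τ c)) (τ d) (τ f)
      + W.jac₄ (τ a) (τ b) (W.br (τ c) (τ d)) (τ f) - W.jac₄ (τ a) (τ c) (W.br (τ b) (τ d)) (τ f)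
        + W.jac₄ (τ b) (τ c) (W.br (τ a) (τ d)) (τ f)
      - W.jac₄ (τ a) (τ b) (τ c) (W.br (τ d) (τ f)) + W.jac₄ (τ a) (τ b) (τ d) (W.br (τ c) (τ f))
        - W.jac₄ (τ a) (τ c) (τ d) (W.br (τ b) (τ f)) + W.jac₄ (τ b) (τ c) (τ d) (W.br (τ a) (τ f))
          -
      (W.jac (W.jac (τ a) (τ b) (τ c)) (τ d) (τ f) + W.jac (τ a) (W.jac (τ b) (τ c) (τ d)) (τ f)
        - W.jac (τ b) (W.jac (τ a) (τ c) (τ d)) (τ f) + W.jac (τ c) (W.jac (τ a) (τ b) (τ d)) (τ f)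
        + W.jac (τ a) (τ b) (W.jac (τ c) (τ d) (τ f)) - W.jac (τ a) (τ c) (W.jac (τ b) (τ d) (τ f))
          + W.jac (τ a) (τ d) (W.jac (τ b) (τ c) (τ f))
        + W.jac (τ b) (τ c) (W.jac (τ a) (τ d) (τ f)) - W.jac (τ b) (τ d) (W.jac (τ a) (τ c) (τ f))
          + W.jac (τ c) (τ d) (W.jac (τ a) (τ b) (τ f))) := by
  simp only [sqFun, leib, Pi.add_apply, Pi.neg_apply, Pi.sub_apply, Pi.smul_apply]
  simp only [wmul, Wd.split]
  simp only [Wd.split₀, Wd.split₁, Wd.split₂, Wd.split₃]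
  simp only [List.map_cons, List.map_nil, List.sum_cons, List.sum_nil, leib, Pi.add_apply,
    Pi.sub_apply, Pi.smul_apply, wmul, Wd.split, Wd.split₀, Wd.split₁, Wd.split₂, Wd.split₃]
  simp only [ceFun, letters]
  simp only [map_zero, LinearMap.zero_apply, smul_zero, add_zero, zero_add, neg_zero, sub_zero,
    LinearMap.id_apply, LinearMap.flip_apply, Wd.deg, ha, hb, hc, hd, hf]
  simp (disch := decide) only [pairSign, pairSignOdd, tripleSign, tripleSignOdd, quadSign,
    ksgn_even,
    ksgn_odd, map_neg, map_add, map_sub, map_zsmul, map_smul, LinearMap.neg_apply,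
    LinearMap.add_apply, LinearMap.sub_apply, LinearMap.smul_apply]
  module

end LieThreeOps

/-! ### The square of the differential at words of weight at most four. -/

namespace LieThreeOps
open Eilh
variable {K E ι : Type*} [Field K] [AddCommGroup E] [Module K E]
  {ℳ : ℤ → Submodule K E} (W : LieThreeOps ℳ) (τ : Module.Basis ι K E) {e : ι → ℤ}

theorem sqFun_w (a : ι) : W.sqFun τ e (.w a) = -W.d (W.d (τ a)) := by
  simp only [sqFun, leib, Pi.add_apply, Pi.neg_apply, Pi.sub_apply, Pi.smul_apply]
  simp only [wmul, Wd.split]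
  simp only [Wd.split₀, Wd.split₁, Wd.split₂, Wd.split₃]
  simp only [List.map_cons, List.map_nil, List.sum_cons, List.sum_nil, leib, Pi.add_apply,
    Pi.sub_apply, Pi.smul_apply, wmul, Wd.split, Wd.split₀, Wd.split₁, Wd.split₂, Wd.split₃]
  simp only [ceFun, letters]
  simp only [map_zero, LinearMap.zero_apply, smul_zero, add_zero, zero_add, neg_zero, sub_zero,
    LinearMap.id_apply, LinearMap.flip_apply, Wd.deg]
  simp (disch := decide) only [ksgn_sub, ksgn_one, map_neg, map_zsmul, smul_neg, neg_neg,
    smul_smul, mul_neg, mul_one,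
    ksgn_mul_self, neg_mul, neg_smul, one_smul]

-- Here and for the remaining shapes the letters have arbitrary degrees, and `1 - e a` stands for
-- the degree of `τ a`. After an overall sign is split off, each composite of operations gives an
-- identity between signs of quadratic exponents, which is settled modulo two using that `n ^ 2` and
-- `n` have the same parity.
set_option maxHeartbeats 8000000 in
theorem sqFun_w0 (a b : ι) :
    W.sqFun τ e (.w0 a b) = (ksgn (Wd.deg e (.w0 a b) - 1) * pairSign (e a) (e b)) •
      (W.d (W.br (τ a) (τ b)) - W.br (W.d (τ a)) (τ b) - ksgn (1
        - e a) • W.br (τ a) (W.d (τ b))) := by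
  simp only [sqFun, leib, Pi.add_apply, Pi.neg_apply, Pi.sub_apply, Pi.smul_apply]
  simp only [wmul, Wd.split]
  simp only [Wd.split₀, Wd.split₁, Wd.split₂, Wd.split₃]
  simp only [List.map_cons, List.map_nil, List.sum_cons, List.sum_nil, leib, Pi.add_apply,
    Pi.sub_apply, Pi.smul_apply, wmul, Wd.split, Wd.split₀, Wd.split₁, Wd.split₂, Wd.split₃]
  simp only [ceFun, letters]
  simp only [map_zero, LinearMap.zero_apply, smul_zero, add_zero, zero_add, neg_zero, sub_zero,
    LinearMap.id_apply, LinearMap.flip_apply, Wd.deg]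
  simp only [pairSign, pairSignOdd, tripleSign, tripleSignOdd, quadSign, map_neg, map_add, map_sub,
    map_zsmul, map_smul, LinearMap.neg_apply, LinearMap.add_apply, LinearMap.sub_apply,
    LinearMap.smul_apply]
  match_scalars
  all_goals try ring_nf
  all_goals try simp (disch := decide) only [ksgn_add, ksgn_sub, ksgn_neg, ksgn_pow_two, ksgn_one,
    ksgn_even, ksgn_odd, ksgn_mul_even, ksgn_mul_odd]
  all_goals try ring_nf
  all_goals try simp (disch := decide) only [ksgn_pow_even, ksgn_pow_odd]
  all_goals try ring_nf

set_option maxHeartbeats 8000000 in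
theorem sqFun_w1 (a b : ι) :
    W.sqFun τ e (.w1 a b) = (ksgn (Wd.deg e (.w1 a b) - 1) * pairSignOdd (e a) (e b)) •
      (W.d (W.alt (τ a) (τ b)) + W.alt (W.d (τ a)) (τ b) + ksgn (1
        - e a) • W.alt (τ a) (W.d (τ b)) -
      (W.br (τ a) (τ b) + ksgn ((1 - e a) * (1 - e b)) • W.br (τ b) (τ a))) := by
  simp only [sqFun, leib, Pi.add_apply, Pi.neg_apply, Pi.sub_apply, Pi.smul_apply]
  simp only [wmul, Wd.split]
  simp only [Wd.split₀, Wd.split₁, Wd.split₂, Wd.split₃]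
  simp only [List.map_cons, List.map_nil, List.sum_cons, List.sum_nil, leib, Pi.add_apply,
    Pi.sub_apply, Pi.smul_apply, wmul, Wd.split, Wd.split₀, Wd.split₁, Wd.split₂, Wd.split₃]
  simp only [ceFun, letters]
  simp only [map_zero, LinearMap.zero_apply, smul_zero, add_zero, zero_add, neg_zero, sub_zero,
    LinearMap.id_apply, LinearMap.flip_apply, Wd.deg]
  simp only [pairSign, pairSignOdd, tripleSign, tripleSignOdd, quadSign, map_neg, map_add, map_sub,
    map_zsmul, map_smul, LinearMap.neg_apply, LinearMap.add_apply, LinearMap.sub_apply,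
    LinearMap.smul_apply]
  match_scalars
  all_goals try ring_nf
  all_goals try simp (disch := decide) only [ksgn_add, ksgn_sub, ksgn_neg, ksgn_pow_two, ksgn_one,
    ksgn_even, ksgn_odd, ksgn_mul_even, ksgn_mul_odd]
  all_goals try ring_nf
  all_goals try simp (disch := decide) only [ksgn_pow_even, ksgn_pow_odd]
  all_goals try ring_nf

set_option maxHeartbeats 8000000 in
theorem sqFun_w2 (a b : ι) :
    W.sqFun τ e (.w2 a b) = (ksgn (Wd.deg e (.w2 a b) - 1) * pairSign (e a) (e b)) •
      (W.d (W.alt₂ (τ a) (τ b)) - W.alt₂ (W.d (τ a)) (τ b) - ksgn (1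
        - e a) • W.alt₂ (τ a) (W.d (τ b)) -
      (W.alt (τ a) (τ b) - ksgn ((1 - e a) * (1 - e b)) • W.alt (τ b) (τ a))) := by
  simp only [sqFun, leib, Pi.add_apply, Pi.neg_apply, Pi.sub_apply, Pi.smul_apply]
  simp only [wmul, Wd.split]
  simp only [Wd.split₀, Wd.split₁, Wd.split₂, Wd.split₃]
  simp only [List.map_cons, List.map_nil, List.sum_cons, List.sum_nil, leib, Pi.add_apply,
    Pi.sub_apply, Pi.smul_apply, wmul, Wd.split, Wd.split₀, Wd.split₁, Wd.split₂, Wd.split₃]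
  simp only [ceFun, letters]
  simp only [map_zero, LinearMap.zero_apply, smul_zero, add_zero, zero_add, neg_zero, sub_zero,
    LinearMap.id_apply, LinearMap.flip_apply, Wd.deg]
  simp only [pairSign, pairSignOdd, tripleSign, tripleSignOdd, quadSign, map_neg, map_add, map_sub,
    map_zsmul, map_smul, LinearMap.neg_apply, LinearMap.add_apply, LinearMap.sub_apply,
    LinearMap.smul_apply]
  match_scalars
  all_goals try ring_nf
  all_goals try simp (disch := decide) only [ksgn_add, ksgn_sub, ksgn_neg, ksgn_pow_two, ksgn_one,
    ksgn_even, ksgn_odd, ksgn_mul_even, ksgn_mul_odd]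
  all_goals try ring_nf
  all_goals try simp (disch := decide) only [ksgn_pow_even, ksgn_pow_odd]
  all_goals try ring_nf

set_option maxHeartbeats 8000000 in
theorem sqFun_w00 (a b c : ι) :
    W.sqFun τ e (.w00 a b c) = (ksgn (Wd.deg e (.w00 a b c) - 1) * (tripleSignOdd (e a
      + e b) (e c) * pairSign (e a) (e b))) •
      (W.d (W.jac (τ a) (τ b) (τ c)) + W.jac (W.d (τ a)) (τ b) (τ c) + ksgn (1
        - e a) • W.jac (τ a) (W.d (τ b)) (τ c) + ksgn ((1 - e a) + (1
          - e b)) • W.jac (τ a) (τ b) (W.d (τ c)) -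
      (W.br (W.br (τ a) (τ b)) (τ c) - W.br (τ a) (W.br (τ b) (τ c)) + ksgn ((1 - e a) * (1
        - e b)) • W.br (τ b) (W.br (τ a) (τ c)))) := by
  simp only [sqFun, leib, Pi.add_apply, Pi.neg_apply, Pi.sub_apply, Pi.smul_apply]
  simp only [wmul, Wd.split]
  simp only [Wd.split₀, Wd.split₁, Wd.split₂, Wd.split₃]
  simp only [List.map_cons, List.map_nil, List.sum_cons, List.sum_nil, leib, Pi.add_apply,
    Pi.sub_apply, Pi.smul_apply, wmul, Wd.split, Wd.split₀, Wd.split₁, Wd.split₂, Wd.split₃]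
  simp only [ceFun, letters]
  simp only [map_zero, LinearMap.zero_apply, smul_zero, add_zero, zero_add, neg_zero, sub_zero,
    LinearMap.id_apply, LinearMap.flip_apply, Wd.deg]
  simp only [pairSign, pairSignOdd, tripleSign, tripleSignOdd, quadSign, map_neg, map_add, map_sub,
    map_zsmul, map_smul, LinearMap.neg_apply, LinearMap.add_apply, LinearMap.sub_apply,
    LinearMap.smul_apply]
  match_scalars
  all_goals try ring_nf
  all_goals try simp (disch := decide) only [ksgn_add, ksgn_sub, ksgn_neg, ksgn_pow_two, ksgn_one,
    ksgn_even, ksgn_odd, ksgn_mul_even, ksgn_mul_odd]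
  all_goals try ring_nf
  all_goals try simp (disch := decide) only [ksgn_pow_even, ksgn_pow_odd]
  all_goals try ring_nf

set_option maxHeartbeats 8000000 in
theorem sqFun_w10 (a b c : ι) :
    W.sqFun τ e (.w10 a b c) = (ksgn (Wd.deg e (.w10 a b c) - 1) * (tripleSign 0 (e a
      + e b) (e c) * pairSign (e a) (e b))) •
      (W.d (W.jacL (τ a) (τ b) (τ c)) - W.jacL (W.d (τ a)) (τ b) (τ c) - ksgn (1
        - e a) • W.jacL (τ a) (W.d (τ b)) (τ c) - ksgn ((1 - e a) + (1
          - e b)) • W.jacL (τ a) (τ b) (W.d (τ c)) -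
      (W.jac (τ a) (τ b) (τ c) + ksgn ((1 - e a) * (1 - e b)) • W.jac (τ b) (τ a) (τ c)
        - W.br (W.alt (τ a) (τ b)) (τ c))) := by
  simp only [sqFun, leib, Pi.add_apply, Pi.neg_apply, Pi.sub_apply, Pi.smul_apply]
  simp only [wmul, Wd.split]
  simp only [Wd.split₀, Wd.split₁, Wd.split₂, Wd.split₃]
  simp only [List.map_cons, List.map_nil, List.sum_cons, List.sum_nil, leib, Pi.add_apply,
    Pi.sub_apply, Pi.smul_apply, wmul, Wd.split, Wd.split₀, Wd.split₁, Wd.split₂, Wd.split₃]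
  simp only [ceFun, letters]
  simp only [map_zero, LinearMap.zero_apply, smul_zero, add_zero, zero_add, neg_zero, sub_zero,
    LinearMap.id_apply, LinearMap.flip_apply, Wd.deg]
  simp only [pairSign, pairSignOdd, tripleSign, tripleSignOdd, quadSign, map_neg, map_add, map_sub,
    map_zsmul, map_smul, LinearMap.neg_apply, LinearMap.add_apply, LinearMap.sub_apply,
    LinearMap.smul_apply]
  match_scalars
  all_goals try ring_nf
  all_goals try simp (disch := decide) only [ksgn_add, ksgn_sub, ksgn_neg, ksgn_pow_two, ksgn_one,
    ksgn_even, ksgn_odd, ksgn_mul_even, ksgn_mul_odd]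
  all_goals try ring_nf
  all_goals try simp (disch := decide) only [ksgn_pow_even, ksgn_pow_odd]
  all_goals try ring_nf

set_option maxHeartbeats 8000000 in
theorem sqFun_w01 (a b c : ι) :
    W.sqFun τ e (.w01 a b c) = (ksgn (Wd.deg e (.w01 a b c) - 1) * (tripleSign 0 (e a
      + e b) (e c) * pairSign (e a) (e b))) •
      (W.d (W.jacR (τ a) (τ b) (τ c)) - W.jacR (W.d (τ a)) (τ b) (τ c) - ksgn (1
        - e a) • W.jacR (τ a) (W.d (τ b)) (τ c) - ksgn ((1 - e a) + (1
          - e b)) • W.jacR (τ a) (τ b) (W.d (τ c)) -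
      (W.jac (τ a) (τ b) (τ c) + ksgn ((1 - e b) * (1 - e c)) • W.jac (τ a) (τ c) (τ b)
        - W.alt (W.br (τ a) (τ b)) (τ c) + ksgn (1 - e a) • W.br (τ a) (W.alt (τ b) (τ c))
          - ksgn ((1 - e a) * (1 - e b)) • W.alt (τ b) (W.br (τ a) (τ c)))) := by
  simp only [sqFun, leib, Pi.add_apply, Pi.neg_apply, Pi.sub_apply, Pi.smul_apply]
  simp only [wmul, Wd.split]
  simp only [Wd.split₀, Wd.split₁, Wd.split₂, Wd.split₃]
  simp only [List.map_cons, List.map_nil, List.sum_cons, List.sum_nil, leib, Pi.add_apply,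
    Pi.sub_apply, Pi.smul_apply, wmul, Wd.split, Wd.split₀, Wd.split₁, Wd.split₂, Wd.split₃]
  simp only [ceFun, letters]
  simp only [map_zero, LinearMap.zero_apply, smul_zero, add_zero, zero_add, neg_zero, sub_zero,
    LinearMap.id_apply, LinearMap.flip_apply, Wd.deg]
  simp only [pairSign, pairSignOdd, tripleSign, tripleSignOdd, quadSign, map_neg, map_add, map_sub,
    map_zsmul, map_smul, LinearMap.neg_apply, LinearMap.add_apply, LinearMap.sub_apply,
    LinearMap.smul_apply]
  match_scalars
  all_goals try ring_nf
  all_goals try simp (disch := decide) only [ksgn_add, ksgn_sub, ksgn_neg, ksgn_pow_two, ksgn_one,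
    ksgn_even, ksgn_odd, ksgn_mul_even, ksgn_mul_odd]
  all_goals try ring_nf
  all_goals try simp (disch := decide) only [ksgn_pow_even, ksgn_pow_odd]
  all_goals try ring_nf

set_option maxHeartbeats 8000000 in
theorem sqFun_w000 (a b c d : ι) :
    W.sqFun τ e (.w000 a b c d) = (ksgn (Wd.deg e (.w000 a b c d) - 1) * (quadSign (e a + e b
      + e c) (e d) * (tripleSign 0 (e a + e b) (e c) * pairSign (e a) (e b)))) •
      (W.d (W.jac₄ (τ a) (τ b) (τ c) (τ d)) - W.jac₄ (W.d (τ a)) (τ b) (τ c) (τ d) - ksgn (1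
        - e a) • W.jac₄ (τ a) (W.d (τ b)) (τ c) (τ d)
        - ksgn ((1 - e a) + (1 - e b)) • W.jac₄ (τ a) (τ b) (W.d (τ c)) (τ d) - ksgn ((1 - e a)
          + (1 - e b) + (1 - e c)) • W.jac₄ (τ a) (τ b) (τ c) (W.d (τ d)) -
      (W.br (W.jac (τ a) (τ b) (τ c)) (τ d) + ksgn (1 - e a) • W.br (τ a) (W.jac (τ b) (τ c) (τ d))
        - ksgn ((1 - e a) * (1 - e b) + (1 - e b)) • W.br (τ b) (W.jac (τ a) (τ c) (τ d))
        + ksgn ((1 - e a) * (1 - e c) + (1 - e b) * (1 - e c) + (1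
          - e c)) • W.br (τ c) (W.jac (τ a) (τ b) (τ d))
        - W.jac (W.br (τ a) (τ b)) (τ c) (τ d) + W.jac (τ a) (W.br (τ b) (τ c)) (τ d) - ksgn ((1
          - e a) * (1 - e b)) • W.jac (τ b) (W.br (τ a) (τ c)) (τ d)
        - W.jac (τ a) (τ b) (W.br (τ c) (τ d)) + ksgn ((1 - e b) * (1
          - e c)) • W.jac (τ a) (τ c) (W.br (τ b) (τ d))
        - ksgn ((1 - e a) * (1 - e b) + (1 - e a) * (1 - e c)) • W.jac (τ b) (τ c) (W.br (τ a) (τ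
          d)))) := by
  simp only [sqFun, leib, Pi.add_apply, Pi.neg_apply, Pi.sub_apply, Pi.smul_apply]
  simp only [wmul, Wd.split]
  simp only [Wd.split₀, Wd.split₁, Wd.split₂, Wd.split₃]
  simp only [List.map_cons, List.map_nil, List.sum_cons, List.sum_nil, leib, Pi.add_apply,
    Pi.sub_apply, Pi.smul_apply, wmul, Wd.split, Wd.split₀, Wd.split₁, Wd.split₂, Wd.split₃]
  simp only [ceFun, letters]
  simp only [map_zero, LinearMap.zero_apply, smul_zero, add_zero, zero_add, neg_zero, sub_zero,
    LinearMap.id_apply, LinearMap.flip_apply, Wd.deg]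
  simp only [pairSign, pairSignOdd, tripleSign, tripleSignOdd, quadSign, map_neg, map_add, map_sub,
    map_zsmul, map_smul, LinearMap.neg_apply, LinearMap.add_apply, LinearMap.sub_apply,
    LinearMap.smul_apply]
  match_scalars
  all_goals try ring_nf
  all_goals try simp (disch := decide) only [ksgn_add, ksgn_sub, ksgn_neg, ksgn_pow_two, ksgn_one,
    ksgn_even, ksgn_odd, ksgn_mul_even, ksgn_mul_odd]
  all_goals try ring_nf
  all_goals try simp (disch := decide) only [ksgn_pow_even, ksgn_pow_odd]
  all_goals try ring_nf

end LieThreeOps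

/-! ### Reduction to homogeneous basis vectors. -/

section

variable {K E ι M : Type*} [Field K] [AddCommGroup E] [Module K E] [Fintype ι]
  [AddCommGroup M] [Module K M] {ℳ : ℤ → Submodule K E} [DirectSum.Decomposition ℳ]
  {τ : Module.Basis ι K E} {deg : ι → ℤ}

theorem mem_of_coord (hτ : ∀ α, τ α ∈ ℳ (deg α)) {p : ℤ} {x : E}
    (h : ∀ α, τ.coord α x ≠ 0 → deg α = p) : x ∈ ℳ p := by
  rw [← τ.sum_repr x]
  refine Submodule.sum_mem _ fun α _ => ?_
  by_cases h0 : τ.coord α x = 0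
  · rw [← Module.Basis.coord_apply, h0, zero_smul]
    exact Submodule.zero_mem _
  · rw [← h α h0]
    exact Submodule.smul_mem _ _ (hτ α)

/-- Projection to degree `p` fixes the basis vectors of degree `p` and kills the others. If `deg α ≠
p`, the `α`-coordinate therefore vanishes on the whole image of the projection, which contains `x`.
-/
theorem deg_of_coord_ne_zero (hτ : ∀ α, τ α ∈ ℳ (deg α)) {p : ℤ} {x : E} (hx : x ∈ ℳ p) {α : ι}
    (h : τ.coord α x ≠ 0) : deg α = p := by
  by_contra hne
  apply h
  have key : ∀ y : E, τ.coord α (DirectSum.decompose ℳ y p) = 0 := by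
    intro y
    rw [← τ.sum_repr y, DirectSum.decompose_sum, DFinsupp.finsetSum_apply,
      AddSubmonoidClass.coe_finsetSum, map_sum]
    refine Finset.sum_eq_zero fun β _ => ?_
    rw [DirectSum.decompose_smul, DirectSum.smul_apply, Submodule.coe_smul, map_smul]
    by_cases hβ : deg β = p
    · rw [DirectSum.decompose_of_mem_same ℳ (hβ ▸ hτ β)]
      have : α ≠ β := fun hαβ => hne (hαβ ▸ hβ)
      simp [this]
    · rw [DirectSum.decompose_of_mem_ne ℳ (hτ β) hβ]
      simp
  simpa [DirectSum.decompose_of_mem_same ℳ hx] using key x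

theorem deg_cases (hℳ : IsThreeTerm ℳ) (hτ : ∀ α, τ α ∈ ℳ (deg α)) (α : ι) :
    deg α = -2 ∨ deg α = -1 ∨ deg α = 0 := by
  by_contra! h
  have := hτ α
  rw [hℳ _ h.1 h.2.1 h.2.2, Submodule.mem_bot] at this
  exact τ.ne_zero α this

/-- An element of `ℳ p` involves only basis vectors of degree `p`. The target `N` is the zero
subspace when an identity is tested and a graded piece when a degree is. Taking `F` as a plain
function with a linearity proof spares bundling each axiom as a multilinear map. -/
theorem mem_of_basis₁ (hτ : ∀ α, τ α ∈ ℳ (deg α)) {N : Submodule K M} {p : ℤ} {F : E → M}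
    (hF : IsLinearMap K F) (h : ∀ α, deg α = p → F (τ α) ∈ N) : ∀ x ∈ ℳ p, F x ∈ N := by
  intro x hx
  have : hF.mk' F x ∈ N := by
    rw [← τ.sum_repr x, map_sum]
    refine Submodule.sum_mem _ fun α _ => ?_
    rw [map_smul]
    by_cases h0 : τ.coord α x = 0
    · rw [← Module.Basis.coord_apply, h0, zero_smul]
      exact Submodule.zero_mem _
    · exact Submodule.smul_mem _ _ (h α (deg_of_coord_ne_zero hτ hx h0))
  exact this

theorem mem_of_basis₂ (hτ : ∀ α, τ α ∈ ℳ (deg α)) {N : Submodule K M} {p q : ℤ} {F : E → E → M}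
    (hF : ∀ y, IsLinearMap K fun x => F x y) (hF' : ∀ x, IsLinearMap K (F x))
    (h : ∀ α β, deg α = p → deg β = q → F (τ α) (τ β) ∈ N) :
    ∀ x ∈ ℳ p, ∀ y ∈ ℳ q, F x y ∈ N :=
  fun x hx y hy => mem_of_basis₁ hτ (hF y)
    (fun α hα => mem_of_basis₁ hτ (hF' _) (fun β hβ => h α β hα hβ) y hy) x hx

theorem mem_of_basis₃ (hτ : ∀ α, τ α ∈ ℳ (deg α)) {N : Submodule K M} {p q r : ℤ}
    {F : E → E → E → M} (hF : ∀ y z, IsLinearMap K fun x => F x y z)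
    (hF' : ∀ x z, IsLinearMap K fun y => F x y z) (hF'' : ∀ x y, IsLinearMap K (F x y))
    (h : ∀ α β γ, deg α = p → deg β = q → deg γ = r → F (τ α) (τ β) (τ γ) ∈ N) :
    ∀ x ∈ ℳ p, ∀ y ∈ ℳ q, ∀ z ∈ ℳ r, F x y z ∈ N :=
  fun x hx y hy z hz => mem_of_basis₁ hτ (hF y z)
    (fun α hα => mem_of_basis₂ hτ (hF' _) (hF'' _) (fun β γ hβ hγ => h α β γ hα hβ hγ) y hy z hz)
    x hx

theorem mem_of_basis₄ (hτ : ∀ α, τ α ∈ ℳ (deg α)) {N : Submodule K M} {p q r s : ℤ}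
    {F : E → E → E → E → M} (h₁ : ∀ y z u, IsLinearMap K fun x => F x y z u)
    (h₂ : ∀ x z u, IsLinearMap K fun y => F x y z u)
    (h₃ : ∀ x y u, IsLinearMap K fun z => F x y z u) (h₄ : ∀ x y z, IsLinearMap K (F x y z))
    (h : ∀ α β γ δ, deg α = p → deg β = q → deg γ = r → deg δ = s →
      F (τ α) (τ β) (τ γ) (τ δ) ∈ N) :
    ∀ x ∈ ℳ p, ∀ y ∈ ℳ q, ∀ z ∈ ℳ r, ∀ u ∈ ℳ s, F x y z u ∈ N :=
  fun x hx y hy z hz u hu => mem_of_basis₁ hτ (h₁ y z u)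
    (fun α hα => mem_of_basis₃ hτ (h₂ _) (h₃ _) (h₄ _)
      (fun β γ δ hβ hγ hδ => h α β γ δ hα hβ hγ hδ) y hy z hz u hu) x hx

theorem mem_of_basis₅ (hτ : ∀ α, τ α ∈ ℳ (deg α)) {N : Submodule K M} {p q r s t : ℤ}
    {F : E → E → E → E → E → M} (h₁ : ∀ y z u v, IsLinearMap K fun x => F x y z u v)
    (h₂ : ∀ x z u v, IsLinearMap K fun y => F x y z u v)
    (h₃ : ∀ x y u v, IsLinearMap K fun z => F x y z u v)
    (h₄ : ∀ x y z v, IsLinearMap K fun u => F x y z u v)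
    (h₅ : ∀ x y z u, IsLinearMap K (F x y z u))
    (h : ∀ α β γ δ ζ, deg α = p → deg β = q → deg γ = r → deg δ = s → deg ζ = t →
      F (τ α) (τ β) (τ γ) (τ δ) (τ ζ) ∈ N) :
    ∀ x ∈ ℳ p, ∀ y ∈ ℳ q, ∀ z ∈ ℳ r, ∀ u ∈ ℳ s, ∀ v ∈ ℳ t, F x y z u v ∈ N :=
  fun x hx y hy z hz u hu v hv => mem_of_basis₁ hτ (h₁ y z u v)
    (fun α hα => mem_of_basis₄ hτ (h₂ _) (h₃ _) (h₄ _) (h₅ _)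
      (fun β γ δ ζ hβ hγ hδ hζ => h α β γ δ ζ hα hβ hγ hδ hζ) y hy z hz u hu v hv) x hx

theorem mem_of_bilinear (hτ : ∀ α, τ α ∈ ℳ (deg α)) {N : Submodule K M} {p q : ℤ}
    (f : E →ₗ[K] E →ₗ[K] M) (h : ∀ α β, deg α = p → deg β = q → f (τ α) (τ β) ∈ N) :
    ∀ x ∈ ℳ p, ∀ y ∈ ℳ q, f x y ∈ N :=
  mem_of_basis₂ hτ (fun y => (f.flip y).isLinear) (fun x => (f x).isLinear) h

theorem mem_of_trilinear (hτ : ∀ α, τ α ∈ ℳ (deg α)) {N : Submodule K M} {p q r : ℤ}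
    (f : E →ₗ[K] E →ₗ[K] E →ₗ[K] M)
    (h : ∀ α β γ, deg α = p → deg β = q → deg γ = r → f (τ α) (τ β) (τ γ) ∈ N) :
    ∀ x ∈ ℳ p, ∀ y ∈ ℳ q, ∀ z ∈ ℳ r, f x y z ∈ N :=
  mem_of_basis₃ hτ (fun y z => ((f.flip y).flip z).isLinear) (fun x z => ((f x).flip z).isLinear)
    (fun x y => (f x y).isLinear) h

theorem mem_of_quadrilinear (hτ : ∀ α, τ α ∈ ℳ (deg α)) {N : Submodule K M} {p q r s : ℤ}
    (f : E →ₗ[K] E →ₗ[K] E →ₗ[K] E →ₗ[K] M)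
    (h : ∀ α β γ δ, deg α = p → deg β = q → deg γ = r → deg δ = s →
      f (τ α) (τ β) (τ γ) (τ δ) ∈ N) :
    ∀ x ∈ ℳ p, ∀ y ∈ ℳ q, ∀ z ∈ ℳ r, ∀ u ∈ ℳ s, f x y z u ∈ N :=
  mem_of_basis₄ hτ (fun y z u => (((f.flip y).flip z).flip u).isLinear)
    (fun x z u => (((f x).flip z).flip u).isLinear) (fun x y u => ((f x y).flip u).isLinear)
    (fun x y z => (f x y z).isLinear) h

theorem ksgn_smul_eq_zero {n : ℤ} {x : M} (h : ksgn n • x = 0) : x = 0 := by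
  rcases ksgn_eq_one_or n with h' | h' <;> simpa [h'] using h

theorem WeakLieThree.ops_injective :
    Function.Injective (WeakLieThree.ops : WeakLieThree ℳ → LieThreeOps ℳ) := by
  intro W W' h
  cases W
  cases W'
  simp only [WeakLieThree.ops, LieThreeOps.mk.injEq] at h
  obtain ⟨rfl, rfl, rfl, rfl, rfl, rfl, rfl, rfl⟩ := h
  rfl

namespace LieThreeOps

open Eilh

theorem ceGen_mem_homog (hτ : ∀ α, τ α ∈ ℳ (deg α)) (W : LieThreeOps ℳ) (α : ι) :
    W.ceGen τ (fun β => 1 - deg β) α ∈ homog K (fun β => 1 - deg β) (1 - deg α + 1) := by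
  -- For every operation, the degree of the value and the degree of the monomial paired with it add
  -- up to 2. A nonzero `α`-coordinate then forces the monomial to have degree `2 - deg α`.
  have key : ∀ (s : ℤ) {n p : ℤ} {x : E} {y : Eilh K fun β => 1 - deg β}, x ∈ ℳ p →
      y ∈ homog K (fun β => 1 - deg β) n → p + n = 2 →
      s • τ.coord α x • y ∈ homog K (fun β => 1 - deg β) (1 - deg α + 1) := by
    intro s n p x y hx hy h
    by_cases h0 : τ.coord α x = 0
    · rw [h0, zero_smul, smul_zero]
      exact Submodule.zero_mem _
    · rw [deg_of_coord_ne_zero hτ hx h0, show 1 - p + 1 = n by omega]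
      exact zsmul_mem_homog s (Submodule.smul_mem _ _ hy)
  have h2 : ∀ (i : ℕ) (b c : ι), mul _ i (gen K (fun β => 1 - deg β) b) (gen K _ c) ∈
      homog K (fun β => 1 - deg β) (1 - deg b + (1 - deg c) + i) :=
    fun i b c => mul_mem_homog i (gen_mem_homog b) (gen_mem_homog c)
  have h3 : ∀ (i j : ℕ) (b c d : ι), mul _ j (mul _ i (gen K (fun β => 1 - deg β) b)
      (gen K _ c)) (gen K _ d) ∈
      homog K (fun β => 1 - deg β) (1 - deg b + (1 - deg c) + i + (1 - deg d) + j) :=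
    fun i j b c d => mul_mem_homog j (h2 i b c) (gen_mem_homog d)
  have h4 : ∀ (i j k : ℕ) (b c d f : ι), mul _ k (mul _ j (mul _ i (gen K (fun β => 1 - deg β) b)
      (gen K _ c)) (gen K _ d)) (gen K _ f) ∈
      homog K (fun β => 1 - deg β)
        (1 - deg b + (1 - deg c) + i + (1 - deg d) + j + (1 - deg f) + k) :=
    fun i j k b c d f => mul_mem_homog k (h3 i j b c d) (gen_mem_homog f)
  unfold ceGen
  refine neg_mem (add_mem (add_mem (add_mem ?_ ?_) ?_) ?_)
  · exact sum_mem fun b _ => key _ (W.d_mem _ _ (hτ b)) (gen_mem_homog b) (by ring)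
  · refine sum_mem fun b _ => sum_mem fun c _ => add_mem (add_mem ?_ ?_) ?_
    · exact key _ (W.br_mem _ _ _ (hτ b) _ (hτ c)) (h2 0 b c) (by push_cast; ring)
    · exact key _ (W.alt_mem _ _ _ (hτ b) _ (hτ c)) (h2 1 b c) (by push_cast; ring)
    · exact key _ (W.alt₂_mem _ _ _ (hτ b) _ (hτ c)) (h2 2 b c) (by push_cast; ring)
  · refine sum_mem fun b _ => sum_mem fun c _ => sum_mem fun d _ => add_mem (add_mem ?_ ?_) ?_
    · exact key _ (W.jac_mem _ _ _ _ (hτ b) _ (hτ c) _ (hτ d)) (h3 0 0 b c d)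
        (by push_cast; ring)
    · exact key _ (W.jacL_mem _ _ _ _ (hτ b) _ (hτ c) _ (hτ d)) (h3 1 0 b c d)
        (by push_cast; ring)
    · exact key _ (W.jacR_mem _ _ _ _ (hτ b) _ (hτ c) _ (hτ d)) (h3 0 1 b c d)
        (by push_cast; ring)
  · exact sum_mem fun b _ => sum_mem fun c _ => sum_mem fun d _ => sum_mem fun f _ =>
      key _ (W.jac₄_mem _ _ _ _ _ (hτ b) _ (hτ c) _ (hτ d) _ (hτ f)) (h4 0 0 0 b c d f)
        (by push_cast; ring)

theorem coord_fam {e : ι → ℤ} (X : ι → Eilh K e) (w : Wd ι) (α : ι) :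
    τ.coord α (fam X τ w) = coeff e (X α) w := by
  classical
  simp [fam_apply, Finsupp.single_apply]

theorem fam_injective {e : ι → ℤ} {X Y : ι → Eilh K e} (h : fam X τ = fam Y τ) (α : ι) :
    coeff e (X α) = coeff e (Y α) := by
  funext w
  rw [← coord_fam (τ := τ), ← coord_fam (τ := τ), h]

/-- Each operation occurs at a shape of its own, multiplied by a sign, hence can be read off on
basis vectors. -/
theorem eq_of_ceFun_eq {e : ι → ℤ} {W W' : LieThreeOps ℳ} (h : W.ceFun τ e = W'.ceFun τ e) :
    W = W' := by
  have hs : ∀ {n : ℤ} {x y : E}, -(ksgn n • x) = -(ksgn n • y) → x = y := by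
    intro n x y hxy
    rw [neg_inj, ← sub_eq_zero, ← smul_sub] at hxy
    exact sub_eq_zero.1 (ksgn_smul_eq_zero hxy)
  have h1 : W.d = W'.d := τ.ext fun a => hs (congrFun h (.w a))
  have h2 : W.br = W'.br := τ.ext fun a => τ.ext fun b => hs (congrFun h (.w0 a b))
  have h3 : W.alt = W'.alt := τ.ext fun a => τ.ext fun b => hs (congrFun h (.w1 a b))
  have h4 : W.alt₂ = W'.alt₂ := τ.ext fun a => τ.ext fun b => hs (congrFun h (.w2 a b))
  have h5 : W.jac = W'.jac := τ.ext fun a => τ.ext fun b => τ.ext fun c => by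
    have := congrFun h (.w00 a b c)
    simp only [ceFun, tripleSignOdd, pairSign, ← ksgn_add] at this
    exact hs this
  have h6 : W.jacL = W'.jacL := τ.ext fun a => τ.ext fun b => τ.ext fun c => by
    have := congrFun h (.w10 a b c)
    simp only [ceFun, tripleSign, pairSign, ← ksgn_add] at this
    exact hs this
  have h7 : W.jacR = W'.jacR := τ.ext fun a => τ.ext fun b => τ.ext fun c => by
    have := congrFun h (.w01 a b c)
    simp only [ceFun, tripleSign, pairSign, ← ksgn_add] at this
    exact hs this
  have h8 : W.jac₄ = W'.jac₄ := τ.ext fun a => τ.ext fun b => τ.ext fun c => τ.ext fun f => by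
    have := congrFun h (.w000 a b c f)
    simp only [ceFun, quadSign, tripleSign, pairSign, ← ksgn_add] at this
    exact hs this
  cases W
  cases W'
  simp only at h1 h2 h3 h4 h5 h6 h7 h8
  subst h1 h2 h3 h4 h5 h6 h7 h8
  rfl

end LieThreeOps

end

/-! ### The axioms from the vanishing of the square. -/

section

variable {K E ι : Type*} [Field K] [AddCommGroup E] [Module K E] [Fintype ι]
  {ℳ : ℤ → Submodule K E} [DirectSum.Decomposition ℳ]
  {τ : Module.Basis ι K E} {deg : ι → ℤ}

namespace LieThreeOps

open Eilh

set_option maxHeartbeats 8000000 in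
/-- The weak Lie 3-algebra of operations for which the square of the differential vanishes. -/
def toWeakLieThree (hℳ : IsThreeTerm ℳ) (hτ : ∀ α, τ α ∈ ℳ (deg α)) (W : LieThreeOps ℳ)
    (h : ∀ w, W.sqFun τ (fun β => 1 - deg β) w = 0) : WeakLieThree ℳ where
  threeTerm := hℳ
  d := W.d
  br := W.br
  alt := W.alt
  alt₂ := W.alt₂
  jac := W.jac
  jacL := W.jacL
  jacR := W.jacR
  jac₄ := W.jac₄
  d_mem := W.d_mem
  br_mem := W.br_mem
  alt_mem := W.alt_mem
  alt₂_mem := W.alt₂_mem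
  jac_mem := W.jac_mem
  jacL_mem := W.jacL_mem
  jacR_mem := W.jacR_mem
  jac₄_mem := W.jac₄_mem
  d_d := by
    have hd : W.d ∘ₗ W.d = 0 := τ.ext fun a => by
      simpa [sqFun_w] using h (.w a)
    exact fun x => LinearMap.congr_fun hd x
  d_br := by
    intro p q x hx y hy
    -- Written as membership in the zero subspace, the identity can be tested on basis vectors once
    -- it is linear in each argument. The other axioms are treated in the same way.
    rw [← Submodule.mem_bot K]
    revert x hx y hy
    refine mem_of_basis₂ hτ ?_ ?_ ?_
    iterate 2
      intros
      refine IsLinearMap.mk (fun x y => ?_) (fun c x => ?_)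
      · simp only [map_add, LinearMap.add_apply, smul_add]
        abel
      · simp only [map_smul, LinearMap.smul_apply, smul_add, smul_sub, smul_comm c (ksgn _)]
    rintro a b rfl rfl
    have := h (.w0 a b)
    -- With `e = 1 - deg` the exponents `1 - e a` become `deg a`, and the overall sign merges into a
    -- single `ksgn`, which can be cancelled.
    simp only [sqFun_w0, pairSign, pairSignOdd, tripleSign, tripleSignOdd, quadSign, ← ksgn_add,
      sub_sub_cancel] at this
    have := ksgn_smul_eq_zero this
    exact this
  d_alt := by
    intro p q x hx y hy
    rw [← sub_eq_zero]
    rw [← Submodule.mem_bot K]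
    revert x hx y hy
    refine mem_of_basis₂ hτ ?_ ?_ ?_
    iterate 2
      intros
      refine IsLinearMap.mk (fun x y => ?_) (fun c x => ?_)
      · simp only [map_add, LinearMap.add_apply, smul_add]
        abel
      · simp only [map_smul, LinearMap.smul_apply, smul_add, smul_sub, smul_comm c (ksgn _)]
    rintro a b rfl rfl
    have := h (.w1 a b)
    simp only [sqFun_w1, pairSign, pairSignOdd, tripleSign, tripleSignOdd, quadSign, ← ksgn_add,
      sub_sub_cancel] at this
    have := ksgn_smul_eq_zero this
    exact this
  d_alt₂ := by
    intro p q x hx y hy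
    rw [← sub_eq_zero]
    rw [← Submodule.mem_bot K]
    revert x hx y hy
    refine mem_of_basis₂ hτ ?_ ?_ ?_
    iterate 2
      intros
      refine IsLinearMap.mk (fun x y => ?_) (fun c x => ?_)
      · simp only [map_add, LinearMap.add_apply, smul_add]
        abel
      · simp only [map_smul, LinearMap.smul_apply, smul_add, smul_sub, smul_comm c (ksgn _)]
    rintro a b rfl rfl
    have := h (.w2 a b)
    simp only [sqFun_w2, pairSign, pairSignOdd, tripleSign, tripleSignOdd, quadSign, ← ksgn_add,
      sub_sub_cancel] at this
    have := ksgn_smul_eq_zero this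
    exact this
  d_jac := by
    intro p q r x hx y hy z hz
    rw [← sub_eq_zero]
    rw [← Submodule.mem_bot K]
    revert x hx y hy z hz
    refine mem_of_basis₃ hτ ?_ ?_ ?_ ?_
    iterate 3
      intros
      refine IsLinearMap.mk (fun x y => ?_) (fun c x => ?_)
      · simp only [map_add, LinearMap.add_apply, smul_add]
        abel
      · simp only [map_smul, LinearMap.smul_apply, smul_add, smul_sub, smul_comm c (ksgn _)]
    rintro a b c rfl rfl rfl
    have := h (.w00 a b c)
    simp only [sqFun_w00, pairSign, pairSignOdd, tripleSign, tripleSignOdd, quadSign, ← ksgn_add,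
      sub_sub_cancel] at this
    have := ksgn_smul_eq_zero this
    exact this
  d_jacL := by
    intro p q r x hx y hy z hz
    rw [← sub_eq_zero]
    rw [← Submodule.mem_bot K]
    revert x hx y hy z hz
    refine mem_of_basis₃ hτ ?_ ?_ ?_ ?_
    iterate 3
      intros
      refine IsLinearMap.mk (fun x y => ?_) (fun c x => ?_)
      · simp only [map_add, LinearMap.add_apply, smul_add]
        abel
      · simp only [map_smul, LinearMap.smul_apply, smul_add, smul_sub, smul_comm c (ksgn _)]
    rintro a b c rfl rfl rfl
    have := h (.w10 a b c)
    simp only [sqFun_w10, pairSign, pairSignOdd, tripleSign, tripleSignOdd, quadSign, ← ksgn_add,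
      sub_sub_cancel] at this
    have := ksgn_smul_eq_zero this
    exact this
  d_jacR := by
    intro p q r x hx y hy z hz
    rw [← sub_eq_zero]
    rw [← Submodule.mem_bot K]
    revert x hx y hy z hz
    refine mem_of_basis₃ hτ ?_ ?_ ?_ ?_
    iterate 3
      intros
      refine IsLinearMap.mk (fun x y => ?_) (fun c x => ?_)
      · simp only [map_add, LinearMap.add_apply, smul_add]
        abel
      · simp only [map_smul, LinearMap.smul_apply, smul_add, smul_sub, smul_comm c (ksgn _)]
    rintro a b c rfl rfl rfl
    have := h (.w01 a b c)
    simp only [sqFun_w01, pairSign, pairSignOdd, tripleSign, tripleSignOdd, quadSign, ← ksgn_add,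
      sub_sub_cancel] at this
    have := ksgn_smul_eq_zero this
    exact this
  d_jac₄ := by
    intro p q r s x hx y hy z hz u hu
    rw [← sub_eq_zero]
    rw [← Submodule.mem_bot K]
    revert x hx y hy z hz u hu
    refine mem_of_basis₄ hτ ?_ ?_ ?_ ?_ ?_
    iterate 4
      intros
      refine IsLinearMap.mk (fun x y => ?_) (fun c x => ?_)
      · simp only [map_add, LinearMap.add_apply, smul_add]
        abel
      · simp only [map_smul, LinearMap.smul_apply, smul_add, smul_sub, smul_comm c (ksgn _)]
    rintro a b c f rfl rfl rfl rfl
    have := h (.w000 a b c f)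
    simp only [sqFun_w000, pairSign, pairSignOdd, tripleSign, tripleSignOdd, quadSign, ← ksgn_add,
      sub_sub_cancel] at this
    have := ksgn_smul_eq_zero this
    exact this
  alt₂_skew := by
    intro x hx y hy
    rw [← Submodule.mem_bot K]
    revert x hx y hy
    refine mem_of_basis₂ hτ ?_ ?_ ?_
    iterate 2
      intros
      refine IsLinearMap.mk (fun x y => ?_) (fun c x => ?_)
      · simp only [map_add, LinearMap.add_apply, smul_add]
        abel
      · simp only [map_smul, LinearMap.smul_apply, smul_add, smul_sub, smul_comm c (ksgn _)]
    intro a b ha hb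
    have := h (.w3 a b)
    rw [W.sqFun_w3 τ (by simp [ha]) (by simp [hb])] at this
    rw [neg_eq_zero] at this
    exact this
  jacL_coh := by
    intro x hx y hy z hz
    rw [← Submodule.mem_bot K]
    revert x hx y hy z hz
    refine mem_of_basis₃ hτ ?_ ?_ ?_ ?_
    iterate 3
      intros
      refine IsLinearMap.mk (fun x y => ?_) (fun c x => ?_)
      · simp only [map_add, LinearMap.add_apply, smul_add]
        abel
      · simp only [map_smul, LinearMap.smul_apply, smul_add, smul_sub, smul_comm c (ksgn _)]
    intro a b c ha hb hc
    have := h (.w20 a b c)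
    rw [W.sqFun_w20 τ (by simp [ha]) (by simp [hb]) (by simp [hc])] at this
    exact this
  jacR_coh := by
    intro x hx y hy z hz
    rw [← Submodule.mem_bot K]
    revert x hx y hy z hz
    refine mem_of_basis₃ hτ ?_ ?_ ?_ ?_
    iterate 3
      intros
      refine IsLinearMap.mk (fun x y => ?_) (fun c x => ?_)
      · simp only [map_add, LinearMap.add_apply, smul_add]
        abel
      · simp only [map_smul, LinearMap.smul_apply, smul_add, smul_sub, smul_comm c (ksgn _)]
    intro a b c ha hb hc
    have := h (.w02 a b c)
    rw [W.sqFun_w02 τ (by simp [ha]) (by simp [hb]) (by simp [hc])] at this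
    exact this
  braid_coh := by
    intro x hx y hy z hz
    rw [← Submodule.mem_bot K]
    revert x hx y hy z hz
    refine mem_of_basis₃ hτ ?_ ?_ ?_ ?_
    iterate 3
      intros
      refine IsLinearMap.mk (fun x y => ?_) (fun c x => ?_)
      · simp only [map_add, LinearMap.add_apply, smul_add]
        abel
      · simp only [map_smul, LinearMap.smul_apply, smul_add, smul_sub, smul_comm c (ksgn _)]
    intro a b c ha hb hc
    have := h (.w11 a b c)
    rw [W.sqFun_w11 τ (by simp [ha]) (by simp [hb]) (by simp [hc])] at this
    exact this
  jac₄_coh₁ := by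
    intro x hx y hy z hz u hu
    rw [← sub_eq_zero]
    rw [← Submodule.mem_bot K]
    revert x hx y hy z hz u hu
    refine mem_of_basis₄ hτ ?_ ?_ ?_ ?_ ?_
    iterate 4
      intros
      refine IsLinearMap.mk (fun x y => ?_) (fun c x => ?_)
      · simp only [map_add, LinearMap.add_apply, smul_add]
        abel
      · simp only [map_smul, LinearMap.smul_apply, smul_add, smul_sub, smul_comm c (ksgn _)]
    intro a b c f ha hb hc hf
    have := h (.w100 a b c f)
    rw [W.sqFun_w100 τ (by simp [ha]) (by simp [hb]) (by simp [hc]) (by simp [hf])] at this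
    rw [neg_eq_zero] at this
    exact this
  jac₄_coh₂ := by
    intro x hx y hy z hz u hu
    rw [← sub_eq_zero]
    rw [← Submodule.mem_bot K]
    revert x hx y hy z hz u hu
    refine mem_of_basis₄ hτ ?_ ?_ ?_ ?_ ?_
    iterate 4
      intros
      refine IsLinearMap.mk (fun x y => ?_) (fun c x => ?_)
      · simp only [map_add, LinearMap.add_apply, smul_add]
        abel
      · simp only [map_smul, LinearMap.smul_apply, smul_add, smul_sub, smul_comm c (ksgn _)]
    intro a b c f ha hb hc hf
    have := h (.w010 a b c f)
    rw [W.sqFun_w010 τ (by simp [ha]) (by simp [hb]) (by simp [hc]) (by simp [hf])] at this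
    rw [neg_eq_zero] at this
    exact this
  jac₄_coh₃ := by
    intro x hx y hy z hz u hu
    rw [← sub_eq_zero]
    rw [← Submodule.mem_bot K]
    revert x hx y hy z hz u hu
    refine mem_of_basis₄ hτ ?_ ?_ ?_ ?_ ?_
    iterate 4
      intros
      refine IsLinearMap.mk (fun x y => ?_) (fun c x => ?_)
      · simp only [map_add, LinearMap.add_apply, smul_add]
        abel
      · simp only [map_smul, LinearMap.smul_apply, smul_add, smul_sub, smul_comm c (ksgn _)]
    intro a b c f ha hb hc hf
    have := h (.w001 a b c f)
    rw [W.sqFun_w001 τ (by simp [ha]) (by simp [hb]) (by simp [hc]) (by simp [hf])] at this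
    rw [neg_eq_zero] at this
    exact this
  jac₄_coh := by
    intro x hx y hy z hz u hu v hv
    rw [← sub_eq_zero]
    rw [← Submodule.mem_bot K]
    revert x hx y hy z hz u hu v hv
    refine mem_of_basis₅ hτ ?_ ?_ ?_ ?_ ?_ ?_
    iterate 5
      intros
      refine IsLinearMap.mk (fun x y => ?_) (fun c x => ?_)
      · simp only [map_add, LinearMap.add_apply, smul_add]
        abel
      · simp only [map_smul, LinearMap.smul_apply, smul_add, smul_sub, smul_comm c (ksgn _)]
    intro a b c f g ha hb hc hf hg
    have := h (.w0000 a b c f g)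
    rw [W.sqFun_w0000 τ (by simp [ha]) (by simp [hb]) (by simp [hc]) (by simp [hf]) (by simp [hg])]
      at this
    exact this

end LieThreeOps

end

/-! ### The correspondence in both directions. -/

section

variable {K E ι : Type*} [Field K] [AddCommGroup E] [Module K E] [Fintype ι]
  {ℳ : ℤ → Submodule K E} [DirectSum.Decomposition ℳ]
  {τ : Module.Basis ι K E} {deg : ι → ℤ}

open Eilh LieThreeOps

theorem one_le_degree (hℳ : IsThreeTerm ℳ) (hτ : ∀ α, τ α ∈ ℳ (deg α)) (α : ι) :
    1 ≤ 1 - deg α := by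
  rcases deg_cases hℳ hτ α with h | h | h <;> omega

theorem degree_le_three (hℳ : IsThreeTerm ℳ) (hτ : ∀ α, τ α ∈ ℳ (deg α)) (α : ι) :
    1 - deg α ≤ 3 := by
  rcases deg_cases hℳ hτ α with h | h | h <;> omega

set_option maxHeartbeats 1000000 in
/-- The square of the differential dual to a weak Lie 3-algebra has vanishing coefficients at the
words of degree at most five. -/
theorem WeakLieThree.sqFun_eq_zero (hℳ : IsThreeTerm ℳ) (hτ : ∀ α, τ α ∈ ℳ (deg α))
    (W : WeakLieThree ℳ) (w : Wd ι) (hw : w.deg (fun β => 1 - deg β) ≤ 5) :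
    W.ops.sqFun τ (fun β => 1 - deg β) w = 0 := by
  have he := one_le_degree hℳ hτ
  have h0 : ∀ {a}, deg a = 0 → τ a ∈ ℳ 0 := fun {a} ha => ha ▸ hτ a
  have h1 : ∀ {a}, deg a = 0 → (fun β => 1 - deg β) a = 1 := fun ha => by simp [ha]
  cases w with
  | w a => rw [sqFun_w]; exact neg_eq_zero.2 (W.d_d (τ a))
  | w0 a b =>
    rw [sqFun_w0]
    simp only [sub_sub_cancel]
    exact (congrArg _ (W.d_br _ _ _ (hτ a) _ (hτ b))).trans (smul_zero _)
  | w1 a b =>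
    rw [sqFun_w1]
    simp only [sub_sub_cancel]
    exact (congrArg _ (sub_eq_zero.2 (W.d_alt _ _ _ (hτ a) _ (hτ b)))).trans (smul_zero _)
  | w2 a b =>
    rw [sqFun_w2]
    simp only [sub_sub_cancel]
    exact (congrArg _ (sub_eq_zero.2 (W.d_alt₂ _ _ _ (hτ a) _ (hτ b)))).trans (smul_zero _)
  | w00 a b c =>
    rw [sqFun_w00]
    simp only [sub_sub_cancel]
    exact (congrArg _ (sub_eq_zero.2 (W.d_jac _ _ _ _ (hτ a) _ (hτ b) _ (hτ c)))).trans
      (smul_zero _)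
  | w10 a b c =>
    rw [sqFun_w10]
    simp only [sub_sub_cancel]
    exact (congrArg _ (sub_eq_zero.2 (W.d_jacL _ _ _ _ (hτ a) _ (hτ b) _ (hτ c)))).trans
      (smul_zero _)
  | w01 a b c =>
    rw [sqFun_w01]
    simp only [sub_sub_cancel]
    exact (congrArg _ (sub_eq_zero.2 (W.d_jacR _ _ _ _ (hτ a) _ (hτ b) _ (hτ c)))).trans
      (smul_zero _)
  | w000 a b c f =>
    rw [sqFun_w000]
    simp only [sub_sub_cancel]
    exact (congrArg _ (sub_eq_zero.2 (W.d_jac₄ _ _ _ _ _ (hτ a) _ (hτ b) _ (hτ c) _ (hτ f)))).trans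
      (smul_zero _)
  | w3 a b =>
    -- Equality case of the degree bound: weight five and degree at most five force every letter to
    -- have degree one, so its basis vector lies in `E₀`. The same holds for the other shapes of
    -- weight five.
    have ha := he a; have hb := he b
    simp only [Wd.deg] at hw
    obtain ⟨ha, hb⟩ : deg a = 0 ∧ deg b = 0 := by omega
    rw [sqFun_w3 (e := fun β => 1 - deg β) _ _ (h1 ha) (h1 hb)]
    exact neg_eq_zero.2 (W.alt₂_skew _ (h0 ha) _ (h0 hb))
  | w20 a b c =>
    have ha := he a; have hb := he b; have hc := he c
    simp only [Wd.deg] at hw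
    obtain ⟨ha, hb, hc⟩ : deg a = 0 ∧ deg b = 0 ∧ deg c = 0 := by omega
    rw [sqFun_w20 (e := fun β => 1 - deg β) _ _ (h1 ha) (h1 hb) (h1 hc)]
    exact W.jacL_coh _ (h0 ha) _ (h0 hb) _ (h0 hc)
  | w02 a b c =>
    have ha := he a; have hb := he b; have hc := he c
    simp only [Wd.deg] at hw
    obtain ⟨ha, hb, hc⟩ : deg a = 0 ∧ deg b = 0 ∧ deg c = 0 := by omega
    rw [sqFun_w02 (e := fun β => 1 - deg β) _ _ (h1 ha) (h1 hb) (h1 hc)]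
    exact W.jacR_coh _ (h0 ha) _ (h0 hb) _ (h0 hc)
  | w11 a b c =>
    have ha := he a; have hb := he b; have hc := he c
    simp only [Wd.deg] at hw
    obtain ⟨ha, hb, hc⟩ : deg a = 0 ∧ deg b = 0 ∧ deg c = 0 := by omega
    rw [sqFun_w11 (e := fun β => 1 - deg β) _ _ (h1 ha) (h1 hb) (h1 hc)]
    exact W.braid_coh _ (h0 ha) _ (h0 hb) _ (h0 hc)
  | w100 a b c f =>
    have ha := he a; have hb := he b; have hc := he c; have hf := he f
    simp only [Wd.deg] at hw
    obtain ⟨ha, hb, hc, hf⟩ : deg a = 0 ∧ deg b = 0 ∧ deg c = 0 ∧ deg f = 0 := by omega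
    rw [sqFun_w100 (e := fun β => 1 - deg β) _ _ (h1 ha) (h1 hb) (h1 hc) (h1 hf)]
    exact neg_eq_zero.2 (sub_eq_zero.2 (W.jac₄_coh₁ _ (h0 ha) _ (h0 hb) _ (h0 hc) _ (h0 hf)))
  | w010 a b c f =>
    have ha := he a; have hb := he b; have hc := he c; have hf := he f
    simp only [Wd.deg] at hw
    obtain ⟨ha, hb, hc, hf⟩ : deg a = 0 ∧ deg b = 0 ∧ deg c = 0 ∧ deg f = 0 := by omega
    rw [sqFun_w010 (e := fun β => 1 - deg β) _ _ (h1 ha) (h1 hb) (h1 hc) (h1 hf)]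
    exact neg_eq_zero.2 (sub_eq_zero.2 (W.jac₄_coh₂ _ (h0 ha) _ (h0 hb) _ (h0 hc) _ (h0 hf)))
  | w001 a b c f =>
    have ha := he a; have hb := he b; have hc := he c; have hf := he f
    simp only [Wd.deg] at hw
    obtain ⟨ha, hb, hc, hf⟩ : deg a = 0 ∧ deg b = 0 ∧ deg c = 0 ∧ deg f = 0 := by omega
    rw [sqFun_w001 (e := fun β => 1 - deg β) _ _ (h1 ha) (h1 hb) (h1 hc) (h1 hf)]
    exact neg_eq_zero.2 (sub_eq_zero.2 (W.jac₄_coh₃ _ (h0 ha) _ (h0 hb) _ (h0 hc) _ (h0 hf)))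
  | w0000 a b c f g =>
    have ha := he a; have hb := he b; have hc := he c; have hf := he f; have hg := he g
    simp only [Wd.deg] at hw
    obtain ⟨ha, hb, hc, hf, hg⟩ : deg a = 0 ∧ deg b = 0 ∧ deg c = 0 ∧ deg f = 0 ∧ deg g = 0 := by
      omega
    rw [sqFun_w0000 (e := fun β => 1 - deg β) _ _ (h1 ha) (h1 hb) (h1 hc) (h1 hf) (h1 hg)]
    exact sub_eq_zero.2 (W.jac₄_coh _ (h0 ha) _ (h0 hb) _ (h0 hc) _ (h0 hf) _ (h0 hg))

/-- The differential that is dual to a weak Lie 3-algebra. -/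
noncomputable def WeakLieThree.differential (hℳ : IsThreeTerm ℳ) (hτ : ∀ α, τ α ∈ ℳ (deg α))
    (W : WeakLieThree ℳ) : EilhDifferential K (fun α => 1 - deg α) where
  Q := der _ (ceGen_mem_homog hτ W.ops)
  degree := der_mem_homog _
  leibniz := der_isLeibniz _
  sq := by
    refine (der_isLeibniz _).sq_eq_zero (der_mem_homog _) fun α => ?_
    have hmem := der_mem_homog (ceGen_mem_homog hτ W.ops) _ _
      (der_mem_homog (ceGen_mem_homog hτ W.ops) _ _ (gen_mem_homog α))
    -- The square raises the degree of a generator by two, hence to at most five, the range in which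
    -- coefficients detect zero.
    have h3 := degree_le_three hℳ hτ α
    refine eq_zero_of_coeff_eq_zero (one_le_degree hℳ hτ) (by omega) hmem ?_
    funext w
    by_contra hne
    apply hne
    have hw := isHomog_coeff hmem w hne
    rw [← coord_fam (τ := τ) (fun α => der _ (ceGen_mem_homog hτ W.ops)
      (der _ (ceGen_mem_homog hτ W.ops) (gen K _ α))), W.ops.fam_sq τ (der_isLeibniz _)
      (der_mem_homog _) (der_gen _), W.sqFun_eq_zero hℳ hτ w (by omega), map_zero]
    rfl

theorem EilhDifferential.ext_gen {d : ι → ℤ} {D D' : EilhDifferential K d}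
    (h : ∀ α, D.Q (gen K d α) = D'.Q (gen K d α)) : D = D' := by
  have hQ : D.Q = D'.Q := IsLeibniz.ext D.leibniz D'.leibniz h
  cases D
  cases D'
  congr

/-- The coefficient of `Q t^α` at `w` vanishes unless `w` has degree `2 - deg α`, so only basis
vectors of degree `p` enter the value at `w`. -/
theorem EilhDifferential.neg_zsmul_fam_mem (hτ : ∀ α, τ α ∈ ℳ (deg α))
    (D : EilhDifferential K (fun α => 1 - deg α)) (w : Wd ι) (n : ℤ) {p : ℤ}
    (hp : w.deg (fun α => 1 - deg α) = 2 - p) :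
    -(n • fam (fun α => D.Q (gen K _ α)) τ w) ∈ ℳ p := by
  refine neg_mem (zsmul_mem (mem_of_coord hτ fun α hα => ?_) _)
  rw [coord_fam] at hα
  have := isHomog_coeff (D.degree _ _ (gen_mem_homog α)) w hα
  omega

set_option maxHeartbeats 1000000 in
/-- The operations that are dual to the values of a differential on generators. -/
noncomputable def EilhDifferential.ops (hτ : ∀ α, τ α ∈ ℳ (deg α))
    (D : EilhDifferential K (fun α => 1 - deg α)) : LieThreeOps ℳ :=
  let e := fun α => 1 - deg α
  let X := fam (fun α => D.Q (gen K _ α)) τ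
  -- A sign is its own inverse, so the factors of `ceFun`, minus sign included, also solve for the
  -- operations.
  { d := τ.constr K fun a => -(ksgn (e a) • X (.w a))
    br := τ.constr K fun a => τ.constr K fun b => -(pairSign (e a) (e b) • X (.w0 a b))
    alt := τ.constr K fun a => τ.constr K fun b => -(pairSignOdd (e a) (e b) • X (.w1 a b))
    alt₂ := τ.constr K fun a => τ.constr K fun b => -(pairSign (e a) (e b) • X (.w2 a b))
    jac := τ.constr K fun a => τ.constr K fun b => τ.constr K fun c =>
      -((tripleSignOdd (e a + e b) (e c) * pairSign (e a) (e b)) • X (.w00 a b c))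
    jacL := τ.constr K fun a => τ.constr K fun b => τ.constr K fun c =>
      -((tripleSign 0 (e a + e b) (e c) * pairSign (e a) (e b)) • X (.w10 a b c))
    jacR := τ.constr K fun a => τ.constr K fun b => τ.constr K fun c =>
      -((tripleSign 0 (e a + e b) (e c) * pairSign (e a) (e b)) • X (.w01 a b c))
    jac₄ := τ.constr K fun a => τ.constr K fun b => τ.constr K fun c => τ.constr K fun f =>
      -((quadSign (e a + e b + e c) (e f) *
        (tripleSign 0 (e a + e b) (e c) * pairSign (e a) (e b))) • X (.w000 a b c f))
    d_mem := fun p => by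
      refine mem_of_basis₁ hτ (LinearMap.isLinear _) ?_
      rintro a rfl
      rw [Module.Basis.constr_basis]
      exact D.neg_zsmul_fam_mem hτ (.w a) _ (by simp only [Wd.deg]; ring)
    br_mem := fun p q => by
      refine mem_of_bilinear hτ _ ?_
      rintro a b rfl rfl
      simp only [Module.Basis.constr_basis]
      exact D.neg_zsmul_fam_mem hτ (.w0 a b) _ (by simp only [Wd.deg]; ring)
    alt_mem := fun p q => by
      refine mem_of_bilinear hτ _ ?_
      rintro a b rfl rfl
      simp only [Module.Basis.constr_basis]
      exact D.neg_zsmul_fam_mem hτ (.w1 a b) _ (by simp only [Wd.deg]; ring)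
    alt₂_mem := fun p q => by
      refine mem_of_bilinear hτ _ ?_
      rintro a b rfl rfl
      simp only [Module.Basis.constr_basis]
      exact D.neg_zsmul_fam_mem hτ (.w2 a b) _ (by simp only [Wd.deg]; ring)
    jac_mem := fun p q r => by
      refine mem_of_trilinear hτ _ ?_
      rintro a b c rfl rfl rfl
      simp only [Module.Basis.constr_basis]
      exact D.neg_zsmul_fam_mem hτ (.w00 a b c) _ (by simp only [Wd.deg]; ring)
    jacL_mem := fun p q r => by
      refine mem_of_trilinear hτ _ ?_
      rintro a b c rfl rfl rfl
      simp only [Module.Basis.constr_basis]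
      exact D.neg_zsmul_fam_mem hτ (.w10 a b c) _ (by simp only [Wd.deg]; ring)
    jacR_mem := fun p q r => by
      refine mem_of_trilinear hτ _ ?_
      rintro a b c rfl rfl rfl
      simp only [Module.Basis.constr_basis]
      exact D.neg_zsmul_fam_mem hτ (.w01 a b c) _ (by simp only [Wd.deg]; ring)
    jac₄_mem := fun p q r s => by
      refine mem_of_quadrilinear hτ _ ?_
      rintro a b c f rfl rfl rfl rfl
      simp only [Module.Basis.constr_basis]
      exact D.neg_zsmul_fam_mem hτ (.w000 a b c f) _ (by simp only [Wd.deg]; ring) }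

theorem EilhDifferential.ceFun_ops (hℳ : IsThreeTerm ℳ) (hτ : ∀ α, τ α ∈ ℳ (deg α))
    (D : EilhDifferential K (fun α => 1 - deg α)) :
    (D.ops hτ).ceFun τ (fun α => 1 - deg α) = fam (fun α => D.Q (gen K _ α)) τ := by
  have he := one_le_degree hℳ hτ
  have hsgn : ∀ {n : ℤ} {x : E}, -(ksgn n • -(ksgn n • x)) = x := by
    intro n x
    rw [smul_neg, neg_neg, smul_smul, ksgn_mul_self, one_smul]
  -- `Q t^α` has degree at most four, so it has no coefficients at the shapes of weight five, where
  -- `ceFun` is zero by definition.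
  have hzero : ∀ w : Wd ι, 5 ≤ w.deg (fun α => 1 - deg α) →
      fam (fun α => D.Q (gen K _ α)) τ w = 0 := by
    intro w hw
    refine τ.ext_elem fun α => ?_
    rw [map_zero, Finsupp.zero_apply, ← Module.Basis.coord_apply, coord_fam]
    by_contra hne
    have := isHomog_coeff (D.degree _ _ (gen_mem_homog α)) w hne
    have := degree_le_three hℳ hτ α
    omega
  funext w
  cases w
  case w a => simp only [ceFun, ops, Module.Basis.constr_basis, hsgn]
  case w0 a b => simp only [ceFun, ops, Module.Basis.constr_basis, pairSign, hsgn]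
  case w1 a b => simp only [ceFun, ops, Module.Basis.constr_basis, pairSignOdd, hsgn]
  case w2 a b => simp only [ceFun, ops, Module.Basis.constr_basis, pairSign, hsgn]
  case w00 a b c =>
    simp only [ceFun, ops, Module.Basis.constr_basis, tripleSignOdd, pairSign, ← ksgn_add, hsgn]
  case w10 a b c =>
    simp only [ceFun, ops, Module.Basis.constr_basis, tripleSign, pairSign, ← ksgn_add, hsgn]
  case w01 a b c =>
    simp only [ceFun, ops, Module.Basis.constr_basis, tripleSign, pairSign, ← ksgn_add, hsgn]
  case w000 a b c f =>
    simp only [ceFun, ops, Module.Basis.constr_basis, quadSign, tripleSign, pairSign, ← ksgn_add,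
      hsgn]
  case w3 a b =>
    have ha := he a; have hb := he b
    exact (hzero _ (by simp only [Wd.deg]; omega)).symm
  case w20 a b c =>
    have ha := he a; have hb := he b; have hc := he c
    exact (hzero _ (by simp only [Wd.deg]; omega)).symm
  case w11 a b c =>
    have ha := he a; have hb := he b; have hc := he c
    exact (hzero _ (by simp only [Wd.deg]; omega)).symm
  case w02 a b c =>
    have ha := he a; have hb := he b; have hc := he c
    exact (hzero _ (by simp only [Wd.deg]; omega)).symm
  case w100 a b c f =>
    have ha := he a; have hb := he b; have hc := he c; have hf := he f
    exact (hzero _ (by simp only [Wd.deg]; omega)).symm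
  case w010 a b c f =>
    have ha := he a; have hb := he b; have hc := he c; have hf := he f
    exact (hzero _ (by simp only [Wd.deg]; omega)).symm
  case w001 a b c f =>
    have ha := he a; have hb := he b; have hc := he c; have hf := he f
    exact (hzero _ (by simp only [Wd.deg]; omega)).symm
  case w0000 a b c f g =>
    have ha := he a; have hb := he b; have hc := he c; have hf := he f; have hg := he g
    exact (hzero _ (by simp only [Wd.deg]; omega)).symm

/-- Both sides are homogeneous of degree `2 - deg α ≤ 4` and have the same coefficients, and in this
range coefficients determine the element. -/
theorem EilhDifferential.gen_eq_ceGen (hℳ : IsThreeTerm ℳ) (hτ : ∀ α, τ α ∈ ℳ (deg α))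
    (D : EilhDifferential K (fun α => 1 - deg α)) (α : ι) :
    D.Q (gen K _ α) = (D.ops hτ).ceGen τ (fun α => 1 - deg α) α := by
  have h3 := degree_le_three hℳ hτ α
  refine eq_of_coeff_eq (one_le_degree hℳ hτ) (n := 1 - deg α + 1) (by omega)
    (D.degree _ _ (gen_mem_homog α)) (ceGen_mem_homog hτ _ α)
    (fam_injective (X := fun α => D.Q (gen K _ α)) (τ := τ) ?_ α)
  rw [fam_ceGen_eq_ceFun, ceFun_ops hℳ]

theorem EilhDifferential.sqFun_ops (hℳ : IsThreeTerm ℳ) (hτ : ∀ α, τ α ∈ ℳ (deg α))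
    (D : EilhDifferential K (fun α => 1 - deg α)) (w : Wd ι) :
    (D.ops hτ).sqFun τ (fun α => 1 - deg α) w = 0 := by
  rw [← fam_sq _ τ D.leibniz D.degree (D.gen_eq_ceGen hℳ hτ), fam_apply]
  simp [D.sq]

end

/-- On a graded vector space concentrated in degrees `-2`, `-1`, `0` with a finite homogeneous basis
`τ`, an `EL_∞`-algebra structure, i.e. a nilquadratic differential on the semifree `Eilh`-algebra
`𝓔(E[1]*)`, is the same as a weak Lie 3-algebra structure. -/
theorem mainTheorem12 {K E ι : Type*} [Field K] [AddCommGroup E] [Module K E] [Fintype ι]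
    (ℳ : ℤ → Submodule K E) [DirectSum.Decomposition ℳ] (hℳ : IsThreeTerm ℳ)
    (τ : Module.Basis ι K E) (deg : ι → ℤ) (hτ : ∀ α, τ α ∈ ℳ (deg α)) :
    (∀ D : EilhDifferential K (fun α => 1 - deg α), ∃! W : WeakLieThree ℳ,
      ∀ α, D.Q (Eilh.gen K _ α) = W.ceGen τ (fun α => 1 - deg α) α) ∧
    (∀ W : WeakLieThree ℳ, ∃! D : EilhDifferential K (fun α => 1 - deg α),
      ∀ α, D.Q (Eilh.gen K _ α) = W.ceGen τ (fun α => 1 - deg α) α) := by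
  constructor
  · intro D
    refine ⟨(D.ops hτ).toWeakLieThree hℳ hτ (D.sqFun_ops hℳ hτ), D.gen_eq_ceGen hℳ hτ, ?_⟩
    intro W hW
    -- The axioms are propositions, so only operations are compared. They are determined by `ceFun`,
    -- which is the coefficient function of `Q` on the generators.
    apply WeakLieThree.ops_injective
    apply LieThreeOps.eq_of_ceFun_eq (τ := τ) (e := fun α => 1 - deg α)
    rw [← LieThreeOps.fam_ceGen_eq_ceFun]
    exact (congrArg (fun X => Eilh.fam X τ) (funext fun α => (hW α).symm)).trans
      (D.ceFun_ops hℳ hτ).symm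
  · intro W
    refine ⟨W.differential hℳ hτ, fun α => Eilh.der_gen (LieThreeOps.ceGen_mem_homog hτ W.ops) α,
      fun D hD => ?_⟩
    exact EilhDifferential.ext_gen fun α => (hD α).trans
      (Eilh.der_gen (LieThreeOps.ceGen_mem_homog hτ W.ops) α).symm
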